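/- Let $\mathfrak g$ be a finite-dimensional complex Lie algebra, $\mathfrak l\subset\mathfrak g$ a Lie subalgebra with basis $x_1,\dots,x_d$, and $G$ the simply connected complex Lie group with Lie algebra $\mathfrak g$. Let $D$ be the formal neighbourhood of $0$ in $\mathfrak l^*$: functions $D\to V$ are elements of $V[[x_1,\dots,x_d]]$, with the $x_i$ regarded as coordinates on $\mathfrak l^*$. The Lie algebra $\mathfrak l$ acts on $D$ by the coadjoint action, on $\mathfrak g\otimes\mathfrak g$ by the adjoint action and on $G$ by conjugation. A *dynamical r-matrix* is an $\mathfrak l$-equivariant function $r:D\to\mathfrak g\otimes\mathfrak g$ such that $r+r^{21}$ takes values in $(S^2\mathfrak g)^{\mathfrak g}$ and $$\mathrm{Alt}(\overline{dr})+[r^{12},r^{13}]+[r^{12},r^{23}]+[r^{13},r^{23}]=0,$$ where $\overline{dr}=\sum_i x_i\otimes\frac{\partial r}{\partial x_i}$ and $\mathrm{Alt}(a\otimes b\otimes c)=a\otimes b\otimes c-b\otimes a\otimes c+b\otimes c\otimes a$. For an $\mathfrak l$-equivariant formal map $g:D\to G$ put $\eta_i=g^{-1}\frac{\partial g}{\partial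 x_i}$, $\overline{\eta_g}=\sum_i x_i\otimes\eta_i$, $\tau_g(\lambda)=\sum_{i,j}\lambda([x_i,x_j])\,\eta_i(\lambda)\otimes\eta_j(\lambda)$, and $$r^g=(g\otimes g)\left(r-\overline{\eta_g}+\overline{\eta_g}^{21}-\tau_g\right)(g^{-1}\otimes g^{-1}).$$ **Theorem 1.** Assume that $\mathfrak l$ has an $\mathfrak l$-invariant complement $\mathfrak m$ in $\mathfrak g$. If $r$ and $\rho$ are two dynamical r-matrices with $r(0)=\rho(0)$, then there is an $\mathfrak l$-equivariant formal map $g:D\to G$ such that $\rho=r^g$. -/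

import Mathlib

open scoped TensorProduct Manifold ContDiff

noncomputable section

namespace DynamicalRMatrix

/-! ### Functions on the formal neighbourhood of `0` in `𝔩*`

With a basis `x₁, …, x_d` of `𝔩` regarded as coordinates on `D`, a function from `D` to a complex
vector space `V` is an element of `V[[x₁, …, x_d]]`, i.e. a family of coefficients indexed by
multi-indices. -/

/-- The space `V[[x₁, …, x_d]]` of functions `D → V`. -/
abbrev FormalFun (d : ℕ) (V : Type*) := MvPowerSeries (Fin d) V

section FormalFun

variable {d : ℕ} {V W : Type*} [AddCommGroup V] [Module ℂ V] [AddCommGroup W] [Module ℂ W]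

/-- The coefficient of `x^n`. -/
def coef (n : Fin d →₀ ℕ) : FormalFun d V →ₗ[ℂ] V := LinearMap.proj n

/-- The function with given coefficients. -/
def ofCoef (c : (Fin d →₀ ℕ) → V) : FormalFun d V := c

@[simp] theorem coef_ofCoef (c : (Fin d →₀ ℕ) → V) (n : Fin d →₀ ℕ) : coef n (ofCoef c) = c n :=
  rfl

theorem formalFun_ext {f g : FormalFun d V} (h : ∀ n, coef n f = coef n g) : f = g := funext h

theorem coef_eq_coeff {A : Type*} [Ring A] [Algebra ℂ A] (n : Fin d →₀ ℕ) (f : FormalFun d A) :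
    coef n f = MvPowerSeries.coeff n f := rfl

/-- Apply a linear map to the values of a function on `D`. -/
def mapFun (L : V →ₗ[ℂ] W) (f : FormalFun d V) : FormalFun d W := ofCoef fun n => L (coef n f)

/-- The partial derivative `∂f/∂x_i`. -/
def partialDeriv (i : Fin d) (f : FormalFun d V) : FormalFun d V :=
  ofCoef fun n => ((n i + 1 : ℕ) : ℂ) • coef (n + Finsupp.single i 1) f

/-- The product `x_k f`. -/
def mulCoord (k : Fin d) (f : FormalFun d V) : FormalFun d V :=
  ofCoef fun n => if n k = 0 then 0 else coef (n - Finsupp.single k 1) f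

/-- The product of the coordinate function `λ ↦ λ(y)`, for `y ∈ 𝔩`, with `f`. -/
def mulLin {𝔩 : Type*} [AddCommGroup 𝔩] [Module ℂ 𝔩] (x : Module.Basis (Fin d) ℂ 𝔩) (y : 𝔩)
    (f : FormalFun d V) : FormalFun d V :=
  ∑ k, x.repr y k • mulCoord k f

end FormalFun

section Equivariant

variable {𝔤 : Type*} [LieRing 𝔤] [LieAlgebra ℂ 𝔤] {𝔩 : LieSubalgebra ℂ 𝔤} {d : ℕ}
  (x : Module.Basis (Fin d) ℂ 𝔩)

/-- The action of `y ∈ 𝔩` on functions on `D` induced by the coadjoint action on `𝔩*`: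
the derivation with `x_j ↦ [y, x_j]`. -/
def coadDeriv {V : Type*} [AddCommGroup V] [Module ℂ V] (y : 𝔩) (f : FormalFun d V) :
    FormalFun d V :=
  ∑ j, mulLin x ⁅y, x j⁆ (partialDeriv j f)

/-- A function `f : D → V` is `𝔩`-equivariant, where `y ∈ 𝔩` acts on `V` by `act y`:
`f` is invariant for the action on functions induced by those on `D` and on `V`. -/
def IsEquivariant {V : Type*} [AddCommGroup V] [Module ℂ V] (act : 𝔩 → V → V)
    (f : FormalFun d V) : Prop :=
  ∀ (y : 𝔩) (n : Fin d →₀ ℕ), coef n (coadDeriv x y f) + act y (coef n f) = 0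

end Equivariant

/-! ### The classical dynamical Yang-Baxter equation -/

section CDYBE

variable (𝔤 : Type*) [LieRing 𝔤] [LieAlgebra ℂ 𝔤]

/-- The Lie bracket as a linear map `𝔤 ⊗ 𝔤 → 𝔤`. -/
def bracketMap : 𝔤 ⊗[ℂ] 𝔤 →ₗ[ℂ] 𝔤 := (LieModule.toModuleHom ℂ 𝔤 𝔤 : 𝔤 ⊗[ℂ] 𝔤 →ₗ[ℂ] 𝔤)

/-- `r ⊗ s ↦ [r¹², s¹³]`. -/
def bracket1213 : (𝔤 ⊗[ℂ] 𝔤) ⊗[ℂ] (𝔤 ⊗[ℂ] 𝔤) →ₗ[ℂ] 𝔤 ⊗[ℂ] (𝔤 ⊗[ℂ] 𝔤) :=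
  (bracketMap 𝔤).rTensor (𝔤 ⊗[ℂ] 𝔤) ∘ₗ
    (TensorProduct.tensorTensorTensorComm ℂ 𝔤 𝔤 𝔤 𝔤).toLinearMap

/-- `r ⊗ s ↦ [r¹², s²³]`. -/
def bracket1223 : (𝔤 ⊗[ℂ] 𝔤) ⊗[ℂ] (𝔤 ⊗[ℂ] 𝔤) →ₗ[ℂ] 𝔤 ⊗[ℂ] (𝔤 ⊗[ℂ] 𝔤) :=
  ((bracketMap 𝔤).rTensor 𝔤 ∘ₗ (TensorProduct.assoc ℂ 𝔤 𝔤 𝔤).symm.toLinearMap).lTensor 𝔤 ∘ₗ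
    (TensorProduct.assoc ℂ 𝔤 𝔤 (𝔤 ⊗[ℂ] 𝔤)).toLinearMap

/-- `r ⊗ s ↦ [r¹³, s²³]`. -/
def bracket1323 : (𝔤 ⊗[ℂ] 𝔤) ⊗[ℂ] (𝔤 ⊗[ℂ] 𝔤) →ₗ[ℂ] 𝔤 ⊗[ℂ] (𝔤 ⊗[ℂ] 𝔤) :=
  (TensorProduct.assoc ℂ 𝔤 𝔤 𝔤).toLinearMap ∘ₗ (bracketMap 𝔤).lTensor (𝔤 ⊗[ℂ] 𝔤) ∘ₗ
    (TensorProduct.tensorTensorTensorComm ℂ 𝔤 𝔤 𝔤 𝔤).toLinearMap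

variable {𝔤}

theorem bracket1213_tmul (a b c e : 𝔤) :
    bracket1213 𝔤 ((a ⊗ₜ b) ⊗ₜ (c ⊗ₜ e)) = ⁅a, c⁆ ⊗ₜ[ℂ] (b ⊗ₜ[ℂ] e) := by
  simp [bracket1213, bracketMap]

theorem bracket1223_tmul (a b c e : 𝔤) :
    bracket1223 𝔤 ((a ⊗ₜ b) ⊗ₜ (c ⊗ₜ e)) = a ⊗ₜ[ℂ] (⁅b, c⁆ ⊗ₜ[ℂ] e) := by
  simp [bracket1223, bracketMap]

theorem bracket1323_tmul (a b c e : 𝔤) :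
    bracket1323 𝔤 ((a ⊗ₜ b) ⊗ₜ (c ⊗ₜ e)) = a ⊗ₜ[ℂ] (c ⊗ₜ[ℂ] ⁅b, e⁆) := by
  simp [bracket1323, bracketMap]

/-- `CYB(r) = [r¹², r¹³] + [r¹², r²³] + [r¹³, r²³]` for a function `r : D → 𝔤 ⊗ 𝔤`
(the products of coefficients are those of power series). -/
def CYB {d : ℕ} (r : FormalFun d (𝔤 ⊗[ℂ] 𝔤)) : FormalFun d (𝔤 ⊗[ℂ] (𝔤 ⊗[ℂ] 𝔤)) :=
  ofCoef fun n => ∑ p ∈ Finset.HasAntidiagonal.antidiagonal n,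
    (bracket1213 𝔤 + bracket1223 𝔤 + bracket1323 𝔤) (coef p.1 r ⊗ₜ[ℂ] coef p.2 r)

variable (𝔤) in
/-- `Alt(t) = t¹²³ - t²¹³ + t³¹²`, i.e. `a ⊗ b ⊗ c ↦ a ⊗ b ⊗ c - b ⊗ a ⊗ c + b ⊗ c ⊗ a`
(the first factor is put in position 1, 2, 3 and the other two factors keep their order). -/
def Alt : 𝔤 ⊗[ℂ] (𝔤 ⊗[ℂ] 𝔤) →ₗ[ℂ] 𝔤 ⊗[ℂ] (𝔤 ⊗[ℂ] 𝔤) :=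
  LinearMap.id - (TensorProduct.leftComm ℂ 𝔤 𝔤 𝔤).toLinearMap
    + ((TensorProduct.comm ℂ 𝔤 (𝔤 ⊗[ℂ] 𝔤)).trans (TensorProduct.assoc ℂ 𝔤 𝔤 𝔤)).toLinearMap

theorem Alt_tmul (a b c : 𝔤) :
    Alt 𝔤 (a ⊗ₜ (b ⊗ₜ c)) = a ⊗ₜ (b ⊗ₜ c) - b ⊗ₜ (a ⊗ₜ c) + b ⊗ₜ (c ⊗ₜ a) := by
  simp [Alt]

variable {𝔩 : LieSubalgebra ℂ 𝔤} {d : ℕ} (x : Module.Basis (Fin d) ℂ 𝔩)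

/-- The function `∑ x_i ⊗ ∂r/∂x_i : D → 𝔩 ⊗ V ⊆ 𝔤 ⊗ V` associated to the 1-form `dr`. -/
def dBar {V : Type*} [AddCommGroup V] [Module ℂ V] (r : FormalFun d V) :
    FormalFun d (𝔤 ⊗[ℂ] V) :=
  ofCoef fun n => ∑ i, (x i : 𝔤) ⊗ₜ[ℂ] coef n (partialDeriv i r)

/-- Dynamical r-matrices: `𝔩`-equivariant functions `r : D → 𝔤 ⊗ 𝔤` which satisfy the CDYBE and
for which `r + r²¹` takes values in `(S²𝔤)^𝔤`. (It is symmetric by construction.) -/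
structure IsDynamicalRMatrix (r : FormalFun d (𝔤 ⊗[ℂ] 𝔤)) : Prop where
  equivariant : IsEquivariant x (fun y t => ⁅(y : 𝔤), t⁆) r
  cdybe : mapFun (Alt 𝔤) (dBar x r) + CYB r = 0
  quasiUnitary : ∀ (n : Fin d →₀ ℕ) (z : 𝔤), ⁅z, coef n r + TensorProduct.comm ℂ 𝔤 𝔤 (coef n r)⁆ = 0

end CDYBE

/-! ### Formal maps to a Lie group -/

section Coproduct

attribute [local instance 100] LieRing.ofAssociativeRing

variable (𝔤 : Type*) [LieRing 𝔤] [LieAlgebra ℂ 𝔤]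

/-- The universal enveloping algebra. -/
abbrev U := UniversalEnvelopingAlgebra ℂ 𝔤

variable {𝔤} in
/-- The canonical map `𝔤 → U(𝔤)`. -/
abbrev inc : 𝔤 →ₗ⁅ℂ⁆ U 𝔤 := UniversalEnvelopingAlgebra.ι ℂ

/-- The canonical map `𝔤 ⊗ 𝔤 → U(𝔤) ⊗ U(𝔤)`. -/
def inc₂ : 𝔤 ⊗[ℂ] 𝔤 →ₗ[ℂ] U 𝔤 ⊗[ℂ] U 𝔤 :=
  TensorProduct.map (inc (𝔤 := 𝔤)).toLinearMap (inc (𝔤 := 𝔤)).toLinearMap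

/-- The Lie algebra map `y ↦ y ⊗ 1 + 1 ⊗ y`. -/
def primitiveHom : 𝔤 →ₗ⁅ℂ⁆ U 𝔤 ⊗[ℂ] U 𝔤 where
  toFun y := inc y ⊗ₜ 1 + 1 ⊗ₜ inc y
  map_add' y z := by simp [TensorProduct.add_tmul, TensorProduct.tmul_add]; abel
  map_smul' c y := by simp [TensorProduct.smul_tmul']
  map_lie' {y z} := by
    simp only [LieHom.map_lie, LieRing.of_associative_ring_bracket, mul_add, add_mul,
      Algebra.TensorProduct.tmul_mul_tmul, mul_one, one_mul, TensorProduct.sub_tmul,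
      TensorProduct.tmul_sub]
    abel

/-- The coproduct of `U(𝔤)`. -/
def coproduct : U 𝔤 →ₐ[ℂ] U 𝔤 ⊗[ℂ] U 𝔤 :=
  UniversalEnvelopingAlgebra.lift ℂ (primitiveHom 𝔤)

end Coproduct

section FormalMap

attribute [local instance 100] LieRing.ofAssociativeRing

variable {𝔤 : Type*} [LieRing 𝔤] [LieAlgebra ℂ 𝔤] {d : ℕ}

/-- `f ⊗ 1`, for `f : D → U(𝔤)`. -/
def leftFactor : FormalFun d (U 𝔤) →+* FormalFun d (U 𝔤 ⊗[ℂ] U 𝔤) :=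
  MvPowerSeries.map (Algebra.TensorProduct.includeLeftRingHom (R := ℂ))

/-- `1 ⊗ f`, for `f : D → U(𝔤)`. -/
def rightFactor : FormalFun d (U 𝔤) →+* FormalFun d (U 𝔤 ⊗[ℂ] U 𝔤) :=
  MvPowerSeries.map
    (Algebra.TensorProduct.includeRight : U 𝔤 →ₐ[ℂ] U 𝔤 ⊗[ℂ] U 𝔤).toRingHom

/-- `u ⊗ u`, for an invertible `u : D → U(𝔤)`. -/
def square (u : (FormalFun d (U 𝔤))ˣ) : (FormalFun d (U 𝔤 ⊗[ℂ] U 𝔤))ˣ :=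
  Units.map leftFactor.toMonoidHom u * Units.map rightFactor.toMonoidHom u

variable (d 𝔤) in
/-- A formal map from `D` to a Lie group `G` with Lie algebra `𝔤`, written as `λ ↦ g₀ u(λ)`
with `g₀` its value at `0` and `u` a formal map with `u(0) = 1`.

The functions on the formal completion of `G` at `1` form the algebra dual to the coalgebra `U(𝔤)`
of distributions supported at `1`. A map from `D` to this completion, i.e. a continuous
homomorphism `U(𝔤)* → ℂ[[x₁, …, x_d]]`, is the same as a group-like element `u` of
`U(𝔤)[[x₁, …, x_d]]`; it sends `0` to `1` when its constant term is `1`, and products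
and inverses of maps are those of the algebra `U(𝔤)[[x₁, …, x_d]]`. -/
structure FormalMap (G : Type*) where
  /-- The value at `0`. -/
  base : G
  /-- The quotient of the map by its value at `0`. -/
  u : (FormalFun d (U 𝔤))ˣ
  constantCoeff_u : MvPowerSeries.constantCoeff (u : FormalFun d (U 𝔤)) = 1
  groupLike : MvPowerSeries.map (coproduct 𝔤).toRingHom (u : FormalFun d (U 𝔤)) = square u

/-- The model space of a complex Lie group of dimension `N`. -/
abbrev Model (N : ℕ) := EuclideanSpace ℂ (Fin N)

variable {N : ℕ} {G : Type*} [TopologicalSpace G] [ChartedSpace (Model N) G] [Group G]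
  [LieGroup 𝓘(ℂ, Model N) ω G]

/-- The derivative at `1` of `h ↦ g₀ h g₀⁻¹` (where `g₀ 1 g₀⁻¹ = 1`). -/
def conjDeriv (g₀ : G) :
    GroupLieAlgebra 𝓘(ℂ, Model N) G →L[ℂ] GroupLieAlgebra 𝓘(ℂ, Model N) G :=
  mfderiv 𝓘(ℂ, Model N) 𝓘(ℂ, Model N) (fun h : G => g₀ * h * g₀⁻¹) 1

/-- The adjoint action of `g₀ ∈ G` on `𝔤`, for a given identification of `𝔤` with the Lie algebra
of `G`. -/
def Ad (e : GroupLieAlgebra 𝓘(ℂ, Model N) G ≃ₗ⁅ℂ⁆ 𝔤) (g₀ : G) : 𝔤 →ₗ[ℂ] 𝔤 where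
  toFun y := e (conjDeriv g₀ (e.symm y))
  map_add' y z := by rw [map_add, map_add, map_add]
  map_smul' c y := by rw [map_smul, map_smul, map_smul, RingHom.id_apply]

namespace FormalMap

/-- Equivariance of `g = g₀ u` for the action of `𝔩` on `G` by conjugation:
`g₀` is fixed by `𝔩`, which means that `Ad(g₀)` is the identity on `𝔩`, and `u` is equivariant
for the adjoint action. -/
def Equivariant {𝔩 : LieSubalgebra ℂ 𝔤} (x : Module.Basis (Fin d) ℂ 𝔩)
    (e : GroupLieAlgebra 𝓘(ℂ, Model N) G ≃ₗ⁅ℂ⁆ 𝔤) (g : FormalMap 𝔤 d G) : Prop :=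
  (∀ y : 𝔩, Ad e g.base (y : 𝔤) = y) ∧
    IsEquivariant x (fun y v => inc (y : 𝔤) * v - v * inc (y : 𝔤)) (g.u : FormalFun d (U 𝔤))

/-- The component `η_i = g⁻¹ ∂g/∂x_i` of `η_g = g⁻¹ dg`, a function `D → 𝔤`, viewed in `U(𝔤)`. -/
def eta (g : FormalMap 𝔤 d G) (i : Fin d) : FormalFun d (U 𝔤) :=
  (↑g.u⁻¹ : FormalFun d (U 𝔤)) * partialDeriv i (g.u : FormalFun d (U 𝔤))

variable {𝔩 : LieSubalgebra ℂ 𝔤} (x : Module.Basis (Fin d) ℂ 𝔩)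

/-- `η̄_g = ∑ x_i ⊗ η_i`. -/
def etaBar (g : FormalMap 𝔤 d G) : FormalFun d (U 𝔤 ⊗[ℂ] U 𝔤) :=
  ofCoef fun n => ∑ i, inc (x i : 𝔤) ⊗ₜ[ℂ] coef n (g.eta i)

/-- `η̄_g²¹`. -/
def etaBar21 (g : FormalMap 𝔤 d G) : FormalFun d (U 𝔤 ⊗[ℂ] U 𝔤) :=
  mapFun (TensorProduct.comm ℂ (U 𝔤) (U 𝔤)).toLinearMap (g.etaBar x)

/-- `τ_g(λ) = (λ ⊗ 1 ⊗ 1) [η̄_g¹², η̄_g¹³] = ∑ λ([x_i, x_j]) η_i ⊗ η_j`. -/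
def tau (g : FormalMap 𝔤 d G) : FormalFun d (U 𝔤 ⊗[ℂ] U 𝔤) :=
  ∑ i, ∑ j, mulLin x ⁅x i, x j⁆ (leftFactor (g.eta i) * rightFactor (g.eta j))

/-- `ρ` is the gauge transform `r^g = (g ⊗ g)(r - η̄_g + η̄_g²¹ - τ_g)(g⁻¹ ⊗ g⁻¹)`.
The conjugation by `u ⊗ u` is carried out in `(U(𝔤) ⊗ U(𝔤))[[x₁, …, x_d]]`; its result `s` takes
values in `𝔤 ⊗ 𝔤`, and the conjugation by `g₀ ⊗ g₀` is `Ad(g₀) ⊗ Ad(g₀)`. -/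
def IsGaugeTransform (e : GroupLieAlgebra 𝓘(ℂ, Model N) G ≃ₗ⁅ℂ⁆ 𝔤) (g : FormalMap 𝔤 d G)
    (r ρ : FormalFun d (𝔤 ⊗[ℂ] 𝔤)) : Prop :=
  ∃ s : FormalFun d (𝔤 ⊗[ℂ] 𝔤),
    mapFun (inc₂ 𝔤) s =
      (square g.u : FormalFun d (U 𝔤 ⊗[ℂ] U 𝔤)) *
        (mapFun (inc₂ 𝔤) r
          - g.etaBar x + g.etaBar21 x - g.tau x) *
        (↑(square g.u)⁻¹ : FormalFun d (U 𝔤 ⊗[ℂ] U 𝔤)) ∧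
    ρ = mapFun (TensorProduct.map (Ad e g.base) (Ad e g.base)) s

end FormalMap

end FormalMap

end DynamicalRMatrix

end

/-! Gauge transformations act on dynamical r-matrices, and the claim is that those with a given
value at `0` form a single orbit of gauge maps with value `1` at `0`. The map is built degree by
degree. Suppose `r^u` and `ρ` agree below degree `m ≥ 1`, and let `a` be the degree `m` part of `ρ -
r^u`. The quadratic part of the Yang-Baxter equation only affects higher degrees, so `a` is
equivariant and solves the linear equation `Alt(d̄a) = 0`, where `d̄` is `dBar`. Replacing `u` by
`exp(-f) u`, with `f` homogeneous of degree `m + 1`, changes `r^u` in degree `m` by `d̄f - (d̄f)²¹`.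
It therefore suffices that every such `a` has this form (`exists_eq_dBar_sub`).

That statement is a Poincaré lemma. The invariant complement gives an equivariant projection of `𝔤`
onto `𝔩`; call it `p` as an endomorphism of `𝔤`. It allows the first leg of `a` to be paired with
the point `λ`, giving a `𝔤`-valued function `c`. Contracting `Alt(d̄a) = 0` in the same way gives `m
a + (p ⊗ 1) a + (1 ⊗ p) a = d̄c - (d̄c)²¹`. The operator on the left is injective because `m > 0`,
and `f = (m + 1 + p)⁻¹ c` is the required function.

The induction also needs `r^u` to be an equivariant solution again
(`gauge_isEquivariant_and_cdybe`). Write `r^u` as the conjugate by `u ⊗ u` of `r + γ`. Equivariance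
of `u` says `Ad(u⁻¹) x_i = x_i - ∑ λ([x_i, x_j]) η_j`, so `γ = ∑ η_i ⊗ x_i - Ad(u⁻¹)(x_i) ⊗ η_i`.
The Maurer-Cartan equation for `η` and the Jacobi identity of `𝔩` show that `-γ` solves the
Yang-Baxter equation (`cdybe_gaugeTerm`), and the cross terms between `r` and `γ` cancel after
conjugation. This takes place in the tensor cube of `U(𝔤)`. Returning to `𝔤 ⊗ 𝔤 ⊗ 𝔤` uses
injectivity of `𝔤 → U(𝔤)` (`inc_injective`), obtained from the left-invariant vector fields of the
formal group of `𝔤`.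

Differential equations are integrated along rays: the Euler operator `E` multiplies degree `n` by
`n`, so equations such as `E h = φ h` have unique solutions with given constant term. Exponentials,
their group-likeness and equivariance, and the Maurer-Cartan form all come from this. -/

noncomputable section

namespace DynamicalRMatrix

/-! ### Calculus of formal functions -/

section Calculus

open Finset

variable {d : ℕ} {V W Y : Type*} [AddCommGroup V] [Module ℂ V] [AddCommGroup W] [Module ℂ W]
  [AddCommGroup Y] [Module ℂ Y]

/-- `partialDeriv` as a linear map. -/
def partialDerivₗ (i : Fin d) : FormalFun d V →ₗ[ℂ] FormalFun d V where
  toFun := partialDeriv i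
  map_add' f g := formalFun_ext fun n => by simp [partialDeriv]
  map_smul' c f := formalFun_ext fun n => by simp [partialDeriv, smul_smul, mul_comm]

/-- `mulCoord` as a linear map. -/
def mulCoordₗ (k : Fin d) : FormalFun d V →ₗ[ℂ] FormalFun d V where
  toFun := mulCoord k
  map_add' f g := formalFun_ext fun n => by
    simp only [mulCoord, coef_ofCoef, map_add]; split_ifs <;> simp
  map_smul' c f := formalFun_ext fun n => by
    simp only [mulCoord, coef_ofCoef, map_smul, RingHom.id_apply]; split_ifs <;> simp

/-- `mapFun` as a linear map. -/
def mapFunₗ (L : V →ₗ[ℂ] W) : FormalFun d V →ₗ[ℂ] FormalFun d W where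
  toFun := mapFun L
  map_add' f g := formalFun_ext fun n => by simp [mapFun]
  map_smul' c f := formalFun_ext fun n => by simp [mapFun]

theorem partialDerivₗ_apply (i : Fin d) (f : FormalFun d V) :
    partialDerivₗ i f = partialDeriv i f := rfl

theorem mulCoordₗ_apply (i : Fin d) (f : FormalFun d V) : mulCoordₗ i f = mulCoord i f := rfl

theorem mapFunₗ_apply (L : V →ₗ[ℂ] W) (f : FormalFun d V) : mapFunₗ L f = mapFun L f := rfl

theorem coef_partialDeriv (i : Fin d) (f : FormalFun d V) (n : Fin d →₀ ℕ) :
    coef n (partialDeriv i f) = ((n i + 1 : ℕ) : ℂ) • coef (n + Finsupp.single i 1) f := rfl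

@[simp] theorem coef_mapFun (L : V →ₗ[ℂ] W) (f : FormalFun d V) (n : Fin d →₀ ℕ) :
    coef n (mapFun L f) = L (coef n f) := rfl

theorem coef_mulCoord (k : Fin d) (f : FormalFun d V) (n : Fin d →₀ ℕ) :
    coef n (mulCoord k f) = if n k = 0 then 0 else coef (n - Finsupp.single k 1) f := rfl

theorem coef_add_mulCoord (k : Fin d) (f : FormalFun d V) (n : Fin d →₀ ℕ) :
    coef (n + Finsupp.single k 1) (mulCoord k f) = coef n f := by
  simp [coef_mulCoord]

theorem mapFun_mapFun (L : V →ₗ[ℂ] W) (M : W →ₗ[ℂ] Y) (f : FormalFun d V) :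
    mapFun M (mapFun L f) = mapFun (M ∘ₗ L) f := rfl

theorem mapFun_injective {L : V →ₗ[ℂ] W} (hL : Function.Injective L) :
    Function.Injective (mapFun (d := d) L) := fun _ _ h =>
  formalFun_ext fun n => hL (congrArg (coef n) h)

theorem mulCoord_injective (k : Fin d) : Function.Injective (mulCoord (V := V) k) := fun f g h =>
  formalFun_ext fun n => by rw [← coef_add_mulCoord k f, h, coef_add_mulCoord]

theorem partialDeriv_mapFun (i : Fin d) (L : V →ₗ[ℂ] W) (f : FormalFun d V) :
    partialDeriv i (mapFun L f) = mapFun L (partialDeriv i f) :=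
  formalFun_ext fun n => by simp [coef_partialDeriv]

theorem mulCoord_mapFun (k : Fin d) (L : V →ₗ[ℂ] W) (f : FormalFun d V) :
    mulCoord k (mapFun L f) = mapFun L (mulCoord k f) :=
  formalFun_ext fun n => by simp only [coef_mulCoord, coef_mapFun]; split_ifs <;> simp

theorem partialDeriv_comm (i j : Fin d) (f : FormalFun d V) :
    partialDeriv i (partialDeriv j f) = partialDeriv j (partialDeriv i f) := by
  refine formalFun_ext fun n => ?_
  simp only [coef_partialDeriv, smul_smul]
  rcases eq_or_ne i j with rfl | h
  · rfl
  · rw [add_right_comm n]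
    congr 1
    simp [h, h.symm, mul_comm]

theorem mulCoord_partialDeriv_coef (i : Fin d) (f : FormalFun d V) (n : Fin d →₀ ℕ) :
    coef n (mulCoord i (partialDeriv i f)) = (n i : ℂ) • coef n f := by
  rw [coef_mulCoord]
  split_ifs with h
  · simp [h]
  · have h1 : Finsupp.single i 1 ≤ n := by
      rw [Finsupp.single_le_iff]; omega
    have h2 : (n - Finsupp.single i 1 : Fin d →₀ ℕ) i + 1 = n i := by
      simp; omega
    rw [coef_partialDeriv, tsub_add_cancel_of_le h1, h2]

theorem partialDeriv_mulCoord (i k : Fin d) (f : FormalFun d V) :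
    partialDeriv i (mulCoord k f) = (if i = k then f else 0) + mulCoord k (partialDeriv i f) := by
  refine formalFun_ext fun n => ?_
  split_ifs with h
  · subst h
    rw [map_add, mulCoord_partialDeriv_coef, coef_partialDeriv, coef_add_mulCoord]
    push_cast
    rw [add_smul, one_smul, add_comm]
  · have h' : ¬ k = i := fun h' => h h'.symm
    rw [zero_add, coef_partialDeriv, coef_mulCoord, coef_mulCoord]
    by_cases hk : n k = 0
    · simp [hk, h]
    · have h1 : Finsupp.single k 1 ≤ n := by
        rw [Finsupp.single_le_iff]; omega
      rw [if_neg (by simp [hk]), if_neg hk, coef_partialDeriv, tsub_add_eq_add_tsub h1]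
      simp [h]

theorem mulCoord_comm (i k : Fin d) (f : FormalFun d V) :
    mulCoord i (mulCoord k f) = mulCoord k (mulCoord i f) := by
  refine formalFun_ext fun n => ?_
  simp only [coef_mulCoord]
  rcases eq_or_ne i k with rfl | h
  · rfl
  · simp [h, h.symm, tsub_right_comm]
    split_ifs <;> rfl

/-- The convolution `FormalFun d V × FormalFun d W → FormalFun d Y` of a bilinear map. -/
def conv (β : V →ₗ[ℂ] W →ₗ[ℂ] Y) : FormalFun d V →ₗ[ℂ] FormalFun d W →ₗ[ℂ] FormalFun d Y :=
  LinearMap.mk₂ ℂ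
    (fun f g => ofCoef fun n => ∑ p ∈ antidiagonal n, β (coef p.1 f) (coef p.2 g))
    (fun f f' g => formalFun_ext fun n => by simp [sum_add_distrib])
    (fun c f g => formalFun_ext fun n => by simp [smul_sum])
    (fun f g g' => formalFun_ext fun n => by simp [sum_add_distrib])
    (fun c f g => formalFun_ext fun n => by simp [smul_sum])

theorem coef_conv (β : V →ₗ[ℂ] W →ₗ[ℂ] Y) (f : FormalFun d V) (g : FormalFun d W)
    (n : Fin d →₀ ℕ) :
    coef n (conv β f g) = ∑ p ∈ antidiagonal n, β (coef p.1 f) (coef p.2 g) := rfl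

theorem conv_flip (β : V →ₗ[ℂ] W →ₗ[ℂ] Y) (f : FormalFun d V) (g : FormalFun d W) :
    conv β.flip g f = conv β f g :=
  formalFun_ext fun n => by
    rw [coef_conv, coef_conv]
    refine sum_nbij' Prod.swap Prod.swap ?_ ?_ ?_ ?_ ?_ <;>
      simp [HasAntidiagonal.mem_antidiagonal, add_comm]

theorem conv_mulCoord_left (β : V →ₗ[ℂ] W →ₗ[ℂ] Y) (k : Fin d) (f : FormalFun d V)
    (g : FormalFun d W) : conv β (mulCoord k f) g = mulCoord k (conv β f g) := by
  refine formalFun_ext fun n => ?_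
  rw [coef_mulCoord]
  split_ifs with h
  · refine sum_eq_zero fun p hp => ?_
    rw [HasAntidiagonal.mem_antidiagonal] at hp
    have : p.1 k = 0 := by
      have := DFunLike.congr_fun hp k
      simp [h] at this
      exact this.1
    simp [coef_mulCoord, this]
  · have h1 : Finsupp.single k 1 ≤ n := by
      rw [Finsupp.single_le_iff]; omega
    rw [coef_conv, coef_conv]
    symm
    refine sum_of_injOn (fun p => (p.1 + Finsupp.single k 1, p.2)) ?_ ?_ ?_ ?_
    · rintro ⟨a, b⟩ - ⟨a', b'⟩ - hab
      simpa using hab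
    · rintro ⟨a, b⟩ hab
      simp only [mem_coe, HasAntidiagonal.mem_antidiagonal] at hab ⊢
      rw [add_right_comm, hab, tsub_add_cancel_of_le h1]
    -- A pair outside the image of the shift has no `x_k` in its first index, so its term vanishes.
    · rintro ⟨a, b⟩ hab hn
      rw [HasAntidiagonal.mem_antidiagonal] at hab
      have : a k = 0 := by
        by_contra ha
        refine hn ⟨(a - Finsupp.single k 1, b), ?_, ?_⟩
        · have h2 : Finsupp.single k 1 ≤ a := by
            rw [Finsupp.single_le_iff]; omega
          simp only [mem_coe, HasAntidiagonal.mem_antidiagonal]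
          rw [tsub_add_eq_add_tsub h2]
          simp only at hab
          rw [hab]
        · have h2 : Finsupp.single k 1 ≤ a := by
            rw [Finsupp.single_le_iff]; omega
          simp [tsub_add_cancel_of_le h2]
      simp [coef_mulCoord, this]
    · rintro ⟨a, b⟩ -
      simp [coef_add_mulCoord]

theorem conv_mulCoord_right (β : V →ₗ[ℂ] W →ₗ[ℂ] Y) (k : Fin d) (f : FormalFun d V)
    (g : FormalFun d W) : conv β f (mulCoord k g) = mulCoord k (conv β f g) := by
  rw [← conv_flip, conv_mulCoord_left, conv_flip]

/-- Multiplication by `x_i` is injective, and `x_i ∂_i` scales the coefficient of `x^n` by `n i`.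
The Leibniz rule becomes additivity of `n i` over the antidiagonal. -/
theorem partialDeriv_conv (β : V →ₗ[ℂ] W →ₗ[ℂ] Y) (i : Fin d) (f : FormalFun d V)
    (g : FormalFun d W) :
    partialDeriv i (conv β f g) = conv β (partialDeriv i f) g + conv β f (partialDeriv i g) := by
  apply mulCoord_injective i
  rw [← mulCoordₗ_apply, ← mulCoordₗ_apply, map_add]
  simp only [mulCoordₗ_apply]
  rw [← conv_mulCoord_left, ← conv_mulCoord_right]
  refine formalFun_ext fun n => ?_
  simp only [mulCoord_partialDeriv_coef, map_add, coef_conv, map_smul, LinearMap.smul_apply]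
  rw [← sum_add_distrib, smul_sum]
  refine sum_congr rfl fun p hp => ?_
  rw [HasAntidiagonal.mem_antidiagonal] at hp
  rw [← add_smul, ← hp]
  simp

/-! #### The order filtration -/

/-- The formal functions of order at least `m`. -/
def ordGE (V : Type*) [AddCommGroup V] [Module ℂ V] {d : ℕ} (m : ℕ) :
    Submodule ℂ (FormalFun d V) where
  carrier := {f | ∀ n : Fin d →₀ ℕ, n.degree < m → coef n f = 0}
  add_mem' hf hg n hn := by simp [hf n hn, hg n hn]
  zero_mem' n _ := by simp
  smul_mem' c f hf n hn := by simp [hf n hn]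

theorem mem_ordGE_zero (f : FormalFun d V) : f ∈ ordGE V 0 :=
  fun _ h => absurd h (Nat.not_lt_zero _)

theorem ordGE_mono {m m' : ℕ} (h : m ≤ m') {f : FormalFun d V} (hf : f ∈ ordGE V m') :
    f ∈ ordGE V m := fun n hn => hf n (hn.trans_le h)

theorem eq_of_sub_mem_ordGE {f g : FormalFun d V} (h : ∀ m, f - g ∈ ordGE V m) : f = g :=
  formalFun_ext fun n => by
    have := h (n.degree + 1) n (Nat.lt_succ_self _)
    rwa [map_sub, sub_eq_zero] at this

theorem mem_ordGE_one {f : FormalFun d V} : f ∈ ordGE V 1 ↔ coef 0 f = 0 := by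
  constructor
  · intro h
    exact h 0 (by simp)
  · intro h n hn
    rw [Nat.lt_one_iff, Finsupp.degree_eq_zero_iff] at hn
    rwa [hn]

theorem partialDeriv_mem_ordGE (i : Fin d) {m : ℕ} {f : FormalFun d V} (hf : f ∈ ordGE V (m + 1)) :
    partialDeriv i f ∈ ordGE V m := fun n hn => by
  rw [coef_partialDeriv, hf, smul_zero]
  rw [map_add, Finsupp.degree_single]
  omega

theorem mulCoord_mem_ordGE (i : Fin d) {m : ℕ} {f : FormalFun d V} (hf : f ∈ ordGE V m) :
    mulCoord i f ∈ ordGE V (m + 1) := fun n hn => by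
  rw [coef_mulCoord]
  split_ifs with h
  · rfl
  · have h1 : Finsupp.single i 1 ≤ n := by
      rw [Finsupp.single_le_iff]; omega
    apply hf
    have := congrArg Finsupp.degree (tsub_add_cancel_of_le h1)
    rw [map_add, Finsupp.degree_single] at this
    omega

theorem mapFun_mem_ordGE (L : V →ₗ[ℂ] W) {m : ℕ} {f : FormalFun d V} (hf : f ∈ ordGE V m) :
    mapFun L f ∈ ordGE W m := fun n hn => by
  rw [coef_mapFun, hf n hn, map_zero]

theorem conv_mem_ordGE (β : V →ₗ[ℂ] W →ₗ[ℂ] Y) {a b m : ℕ} {f : FormalFun d V}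
    {g : FormalFun d W} (hf : f ∈ ordGE V a) (hg : g ∈ ordGE W b) (h : m ≤ a + b) :
    conv β f g ∈ ordGE Y m := fun n hn => by
  refine sum_eq_zero fun p hp => ?_
  rw [HasAntidiagonal.mem_antidiagonal] at hp
  have h1 := congrArg Finsupp.degree hp
  rw [map_add] at h1
  rcases lt_or_ge p.1.degree a with h2 | h2
  · rw [hf _ h2, map_zero, LinearMap.zero_apply]
  · rw [hg _ (by omega), map_zero]

/-- Completeness for the order filtration. -/
theorem exists_limit (F : ℕ → FormalFun d V) (hF : ∀ k, F (k + 1) - F k ∈ ordGE V k) :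
    ∃ G, ∀ k, G - F k ∈ ordGE V k := by
  have h : ∀ k l, F (k + l) - F k ∈ ordGE V k := by
    intro k l
    induction l with
    | zero => simp
    | succ l ih =>
      have := Submodule.add_mem _ (ordGE_mono (Nat.le_add_right k l) (hF (k + l))) ih
      rwa [sub_add_sub_cancel] at this
  -- Congruence modulo `ordGE V k` controls only degrees below `k`, so the coefficient of `x^n` is
  -- stable from index `n.degree + 1` on.
  refine ⟨ofCoef fun n => coef n (F (n.degree + 1)), fun k n hn => ?_⟩
  obtain ⟨l, rfl⟩ := Nat.exists_eq_add_of_lt hn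
  have := h (n.degree + 1) l n (Nat.lt_succ_self _)
  rw [map_sub, coef_ofCoef, ← neg_sub, ← map_sub, neg_eq_zero, ← this]
  congr 3
  omega

/-- Contraction principle for the order filtration: the iterates starting from `0` converge. -/
theorem exists_fixedPoint (T : FormalFun d V → FormalFun d V)
    (hT : ∀ m F G, F - G ∈ ordGE V m → T F - T G ∈ ordGE V (m + 1)) : ∃ F, T F = F := by
  have h : ∀ k, T^[k + 1] 0 - T^[k] 0 ∈ ordGE V k := by
    intro k
    induction k with
    | zero => exact mem_ordGE_zero _
    | succ k ih =>
      rw [Function.iterate_succ_apply' T (k + 1), Function.iterate_succ_apply' T k] at *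
      exact hT _ _ _ ih
  obtain ⟨G, hG⟩ := exists_limit (fun k => T^[k] 0) h
  refine ⟨G, eq_of_sub_mem_ordGE fun m => ?_⟩
  have h1 := hT _ _ _ (hG m)
  have h2 := hG (m + 1)
  rw [Function.iterate_succ_apply'] at h2
  have := Submodule.sub_mem _ h1 h2
  rw [sub_sub_sub_cancel_right] at this
  exact ordGE_mono (Nat.le_succ m) this

/-! #### The Euler operator -/

/-- The Euler operator `∑ x_i ∂_i`. -/
def euler : FormalFun d V →ₗ[ℂ] FormalFun d V := ∑ i, mulCoordₗ i ∘ₗ partialDerivₗ i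

theorem euler_apply (f : FormalFun d V) : euler f = ∑ i, mulCoord i (partialDeriv i f) := by
  simp [euler, mulCoordₗ_apply, partialDerivₗ_apply]

theorem coef_euler (f : FormalFun d V) (n : Fin d →₀ ℕ) :
    coef n (euler f) = (n.degree : ℂ) • coef n f := by
  rw [euler_apply, map_sum]
  simp only [mulCoord_partialDeriv_coef]
  rw [← sum_smul, Finsupp.degree_eq_sum]
  push_cast
  rfl

theorem euler_conv (β : V →ₗ[ℂ] W →ₗ[ℂ] Y) (f : FormalFun d V) (g : FormalFun d W) :
    euler (conv β f g) = conv β (euler f) g + conv β f (euler g) := by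
  simp only [euler_apply, map_sum, partialDeriv_conv, LinearMap.sum_apply, ← sum_add_distrib,
    conv_mulCoord_left, conv_mulCoord_right]
  refine sum_congr rfl fun i _ => ?_
  exact map_add (mulCoordₗ i) _ _

theorem euler_mapFun (L : V →ₗ[ℂ] W) (f : FormalFun d V) :
    euler (mapFun L f) = mapFun L (euler f) :=
  formalFun_ext fun n => by simp [coef_euler]

theorem euler_partialDeriv (i : Fin d) (f : FormalFun d V) :
    euler (partialDeriv i f) = partialDeriv i (euler f) - partialDeriv i f :=
  formalFun_ext fun n => by
    simp only [coef_euler, coef_partialDeriv, map_sub, map_add, Finsupp.degree_single, smul_smul]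
    rw [← sub_smul]
    push_cast
    congr 1
    ring

/-- A right inverse of `euler + c` on the functions with vanishing constant term (or when `c`
is not zero). -/
def eulerInv (c : ℂ) : FormalFun d V →ₗ[ℂ] FormalFun d V where
  toFun f := ofCoef fun n => ((n.degree : ℂ) + c)⁻¹ • coef n f
  map_add' f g := formalFun_ext fun n => by simp
  map_smul' a f := formalFun_ext fun n => by simp [smul_smul, mul_comm]

theorem coef_eulerInv (c : ℂ) (f : FormalFun d V) (n : Fin d →₀ ℕ) :
    coef n (eulerInv c f) = ((n.degree : ℂ) + c)⁻¹ • coef n f := rfl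

theorem eulerInv_mem_ordGE (c : ℂ) {m : ℕ} {f : FormalFun d V} (hf : f ∈ ordGE V m) :
    eulerInv c f ∈ ordGE V m := fun n hn => by
  rw [coef_eulerInv, hf n hn, smul_zero]

/-- Values of solutions of an Euler equation, by induction on the degree. -/
theorem coef_mem_of_euler (P : Submodule ℂ V) (c : ℕ) (f : FormalFun d V)
    (h0 : coef 0 f ∈ P)
    (h : ∀ n : Fin d →₀ ℕ, n ≠ 0 → (∀ m : Fin d →₀ ℕ, m.degree < n.degree → coef m f ∈ P) →
      coef n (euler f + (c : ℂ) • f) ∈ P) (n : Fin d →₀ ℕ) : coef n f ∈ P := by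
  induction hk : n.degree using Nat.strong_induction_on generalizing n with
  | _ k ih =>
    rcases eq_or_ne n 0 with rfl | hn
    · exact h0
    · have h1 := h n hn fun m hm => ih _ (hk ▸ hm) m rfl
      rw [map_add, map_smul, coef_euler, ← add_smul] at h1
      have h2 : (n.degree : ℂ) + c ≠ 0 := by
        have : n.degree ≠ 0 := by rwa [ne_eq, Finsupp.degree_eq_zero_iff]
        exact_mod_cast (by omega : n.degree + c ≠ 0)
      have := P.smul_mem ((n.degree : ℂ) + c)⁻¹ h1
      rwa [smul_smul, inv_mul_cancel₀ h2, one_smul] at this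

/-- Uniqueness for Euler equations. -/
theorem eq_zero_of_euler (c : ℕ) (f : FormalFun d V) (h0 : c = 0 → coef 0 f = 0)
    (h : ∀ m, f ∈ ordGE V m → euler f + (c : ℂ) • f ∈ ordGE V (m + 1)) : f = 0 := by
  have key : ∀ m, f ∈ ordGE V m := by
    intro m
    induction m with
    | zero => exact mem_ordGE_zero _
    | succ m ih =>
      intro n hn
      have h1 := h m ih n hn
      rw [map_add, map_smul, coef_euler, ← add_smul] at h1
      -- `E + c` is injective in every degree except degree `0` when `c = 0`; that case is covered
      -- by `h0`.
      by_cases h2 : n.degree + c = 0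
      · have : n = 0 := (Finsupp.degree_eq_zero_iff n).1 (by omega)
        rw [this]
        exact h0 (by omega)
      · exact (smul_eq_zero.1 h1).resolve_left (by exact_mod_cast h2)
  exact eq_of_sub_mem_ordGE (by simpa using key)

end Calculus

/-! ### Power series with values in an algebra, and constant functions. -/

section Ring

open Finset

variable {d : ℕ} {V W Y A B : Type*} [AddCommGroup V] [Module ℂ V] [AddCommGroup W] [Module ℂ W]
  [AddCommGroup Y] [Module ℂ Y] [Ring A] [Algebra ℂ A] [Ring B] [Algebra ℂ B]

theorem mul_eq_conv (f g : FormalFun d A) : f * g = conv (LinearMap.mul ℂ A) f g := by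
  classical
  refine formalFun_ext fun n => ?_
  rw [coef_eq_coeff, MvPowerSeries.coeff_mul, coef_conv]
  refine sum_congr ?_ fun _ _ => rfl
  congr

theorem map_eq_mapFun (φ : A →ₐ[ℂ] B) (f : FormalFun d A) :
    MvPowerSeries.map φ.toRingHom f = mapFun φ.toLinearMap f := rfl

theorem mapFun_mul (φ : A →ₐ[ℂ] B) (f g : FormalFun d A) :
    mapFun φ.toLinearMap (f * g) = mapFun φ.toLinearMap f * mapFun φ.toLinearMap g := by
  simp only [← map_eq_mapFun, map_mul]

theorem partialDeriv_add (i : Fin d) (f g : FormalFun d V) :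
    partialDeriv i (f + g) = partialDeriv i f + partialDeriv i g := map_add (partialDerivₗ i) f g

theorem partialDeriv_sub (i : Fin d) (f g : FormalFun d V) :
    partialDeriv i (f - g) = partialDeriv i f - partialDeriv i g := map_sub (partialDerivₗ i) f g

theorem partialDeriv_sum (i : Fin d) {ι : Type*} (s : Finset ι) (f : ι → FormalFun d V) :
    partialDeriv i (∑ j ∈ s, f j) = ∑ j ∈ s, partialDeriv i (f j) :=
  map_sum (partialDerivₗ i) f s

theorem partialDeriv_mul (i : Fin d) (f g : FormalFun d A) :
    partialDeriv i (f * g) = partialDeriv i f * g + f * partialDeriv i g := by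
  simp only [mul_eq_conv, partialDeriv_conv]

theorem euler_mul (f g : FormalFun d A) : euler (f * g) = euler f * g + f * euler g := by
  simp only [mul_eq_conv, euler_conv]

theorem mul_mem_ordGE {a b m : ℕ} {f g : FormalFun d A} (hf : f ∈ ordGE A a) (hg : g ∈ ordGE A b)
    (h : m ≤ a + b) : f * g ∈ ordGE A m := by
  rw [mul_eq_conv]
  exact conv_mem_ordGE _ hf hg h

theorem mul_mem_ordGE_left {m : ℕ} {f : FormalFun d A} (hf : f ∈ ordGE A m) (g : FormalFun d A) :
    f * g ∈ ordGE A m := mul_mem_ordGE hf (mem_ordGE_zero g) le_rfl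

theorem mul_mem_ordGE_right {m : ℕ} {g : FormalFun d A} (hg : g ∈ ordGE A m) (f : FormalFun d A) :
    f * g ∈ ordGE A m := mul_mem_ordGE (mem_ordGE_zero f) hg (by simp)

theorem coef_zero_mul (f g : FormalFun d A) : coef 0 (f * g) = coef 0 f * coef 0 g := by
  rw [mul_eq_conv, coef_conv]
  simp

/-- The constant function with a given value. -/
def const (d : ℕ) : V →ₗ[ℂ] FormalFun d V where
  toFun v := ofCoef fun n => if n = 0 then v else 0
  map_add' v w := formalFun_ext fun n => by
    rw [map_add]; simp only [coef_ofCoef]; split_ifs <;> simp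
  map_smul' c v := formalFun_ext fun n => by
    rw [map_smul]; simp only [coef_ofCoef, RingHom.id_apply]; split_ifs <;> simp

theorem coef_const (v : V) (n : Fin d →₀ ℕ) : coef n (const d v) = if n = 0 then v else 0 := rfl

@[simp] theorem coef_zero_const (v : V) : coef 0 (const d v) = v := rfl

theorem C_eq_const (a : A) : (MvPowerSeries.C a : FormalFun d A) = const d a := by
  classical
  refine formalFun_ext fun n => ?_
  rw [coef_eq_coeff, MvPowerSeries.coeff_C, coef_const]

@[simp] theorem const_one : const d (1 : A) = 1 := by rw [← C_eq_const, map_one]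

theorem const_mul (a b : A) : const d (a * b) = const d a * const d b := by
  simp only [← C_eq_const, map_mul]

theorem coef_const_mul (a : A) (f : FormalFun d A) (n : Fin d →₀ ℕ) :
    coef n (const d a * f) = a * coef n f := by
  rw [← C_eq_const, coef_eq_coeff, MvPowerSeries.coeff_C_mul, coef_eq_coeff]

theorem coef_mul_const (a : A) (f : FormalFun d A) (n : Fin d →₀ ℕ) :
    coef n (f * const d a) = coef n f * a := by
  rw [← C_eq_const, coef_eq_coeff, MvPowerSeries.coeff_mul_C, coef_eq_coeff]

theorem mapFun_const (L : V →ₗ[ℂ] W) (v : V) : mapFun L (const d v) = const d (L v) :=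
  formalFun_ext fun n => by rw [coef_mapFun, coef_const, coef_const]; split_ifs <;> simp

theorem partialDeriv_const (i : Fin d) (v : V) : partialDeriv i (const d v) = 0 :=
  formalFun_ext fun n => by
    rw [coef_partialDeriv, coef_const, if_neg, smul_zero, map_zero]
    intro h
    have := DFunLike.congr_fun h i
    simp at this

@[simp] theorem partialDeriv_one (i : Fin d) : partialDeriv i (1 : FormalFun d A) = 0 := by
  rw [← const_one, partialDeriv_const]

theorem euler_const (v : V) : euler (const d v) = 0 := by
  simp only [euler_apply, partialDeriv_const]
  exact sum_eq_zero fun i _ => map_zero (mulCoordₗ i)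

end Ring

/-! ### Linear coordinate functions and the coadjoint derivations. -/

section Coadjoint

open Finset

variable {d : ℕ} {V W Y A : Type*} [AddCommGroup V] [Module ℂ V] [AddCommGroup W] [Module ℂ W]
  [AddCommGroup Y] [Module ℂ Y] [Ring A] [Algebra ℂ A]

section MulLin

variable {𝔩 : Type*} [AddCommGroup 𝔩] [Module ℂ 𝔩] (x : Module.Basis (Fin d) ℂ 𝔩)

/-- `mulLin` as a bilinear map. -/
def mulLinₗ : 𝔩 →ₗ[ℂ] FormalFun d V →ₗ[ℂ] FormalFun d V where
  toFun y := ∑ k, x.repr y k • mulCoordₗ k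
  map_add' y z := by simp [add_smul, sum_add_distrib]
  map_smul' c y := by simp [mul_smul, smul_sum]

theorem mulLinₗ_apply (y : 𝔩) (f : FormalFun d V) : mulLinₗ x y f = mulLin x y f := by
  simp [mulLinₗ, mulLin, mulCoordₗ_apply]

theorem mulLin_basis (k : Fin d) (f : FormalFun d V) : mulLin x (x k) f = mulCoord k f := by
  simp [mulLin, Finsupp.single_apply, ite_smul]

theorem mulLin_add_left (y z : 𝔩) (f : FormalFun d V) :
    mulLin x (y + z) f = mulLin x y f + mulLin x z f := by
  simp only [← mulLinₗ_apply, map_add, LinearMap.add_apply]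

theorem mulLin_sub_left (y z : 𝔩) (f : FormalFun d V) :
    mulLin x (y - z) f = mulLin x y f - mulLin x z f := by
  simp only [← mulLinₗ_apply, map_sub, LinearMap.sub_apply]

theorem mulLin_neg_left (y : 𝔩) (f : FormalFun d V) : mulLin x (-y) f = -mulLin x y f := by
  simp only [← mulLinₗ_apply, map_neg, LinearMap.neg_apply]

theorem mulLin_smul_left (c : ℂ) (y : 𝔩) (f : FormalFun d V) :
    mulLin x (c • y) f = c • mulLin x y f := by
  simp only [← mulLinₗ_apply, map_smul, LinearMap.smul_apply]

theorem mulLin_sum_left {ι : Type*} (s : Finset ι) (y : ι → 𝔩) (f : FormalFun d V) :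
    mulLin x (∑ j ∈ s, y j) f = ∑ j ∈ s, mulLin x (y j) f := by
  simp only [← mulLinₗ_apply, map_sum, LinearMap.sum_apply]

theorem mulLin_zero_left (f : FormalFun d V) : mulLin x 0 f = 0 := by
  simp only [← mulLinₗ_apply, map_zero, LinearMap.zero_apply]

theorem mulLin_add (y : 𝔩) (f g : FormalFun d V) :
    mulLin x y (f + g) = mulLin x y f + mulLin x y g := by
  simp only [← mulLinₗ_apply, map_add]

theorem mulLin_sub (y : 𝔩) (f g : FormalFun d V) :
    mulLin x y (f - g) = mulLin x y f - mulLin x y g := by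
  simp only [← mulLinₗ_apply, map_sub]

theorem mulLin_smul (c : ℂ) (y : 𝔩) (f : FormalFun d V) :
    mulLin x y (c • f) = c • mulLin x y f := by
  simp only [← mulLinₗ_apply, map_smul]

theorem mulLin_sum {ι : Type*} (s : Finset ι) (y : 𝔩) (f : ι → FormalFun d V) :
    mulLin x y (∑ j ∈ s, f j) = ∑ j ∈ s, mulLin x y (f j) := by
  simp only [← mulLinₗ_apply, map_sum]

theorem mapFun_mulLin (L : V →ₗ[ℂ] W) (y : 𝔩) (f : FormalFun d V) :
    mapFun L (mulLin x y f) = mulLin x y (mapFun L f) := by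
  simp only [mulLin, ← mapFunₗ_apply L, map_sum, map_smul]
  exact sum_congr rfl fun k _ => by rw [mapFunₗ_apply, mapFunₗ_apply, mulCoord_mapFun]

theorem conv_mulLin_left (β : V →ₗ[ℂ] W →ₗ[ℂ] Y) (y : 𝔩) (f : FormalFun d V)
    (g : FormalFun d W) : conv β (mulLin x y f) g = mulLin x y (conv β f g) := by
  simp only [mulLin, map_sum, map_smul, LinearMap.sum_apply, LinearMap.smul_apply,
    conv_mulCoord_left]

theorem conv_mulLin_right (β : V →ₗ[ℂ] W →ₗ[ℂ] Y) (y : 𝔩) (f : FormalFun d V)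
    (g : FormalFun d W) : conv β f (mulLin x y g) = mulLin x y (conv β f g) := by
  simp only [mulLin, map_sum, map_smul, conv_mulCoord_right]

theorem mulLin_mem_ordGE (y : 𝔩) {m : ℕ} {f : FormalFun d V} (hf : f ∈ ordGE V m) :
    mulLin x y f ∈ ordGE V (m + 1) :=
  Submodule.sum_mem _ fun k _ => Submodule.smul_mem _ _ (mulCoord_mem_ordGE k hf)

theorem mulLin_comm (y z : 𝔩) (f : FormalFun d V) :
    mulLin x y (mulLin x z f) = mulLin x z (mulLin x y f) := by
  have h : ∀ (i : Fin d) (y : 𝔩) (g : FormalFun d V),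
      mulCoord i (mulLin x y g) = mulLin x y (mulCoord i g) := by
    intro i y g
    simp only [mulLin, ← mulCoordₗ_apply, map_sum, map_smul]
    exact sum_congr rfl fun k _ => by rw [mulCoordₗ_apply, mulCoordₗ_apply, mulCoord_comm]; rfl
  rw [mulLin]
  simp only [h]
  simp only [← mulLinₗ_apply x z, ← map_smul, ← map_sum]
  rfl

theorem mulLin_mul (y : 𝔩) (f g : FormalFun d A) :
    mulLin x y f * g = mulLin x y (f * g) := by
  simp only [mul_eq_conv, conv_mulLin_left]

theorem partialDeriv_mulLin (i : Fin d) (y : 𝔩) (f : FormalFun d V) :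
    partialDeriv i (mulLin x y f) = x.repr y i • f + mulLin x y (partialDeriv i f) := by
  simp only [mulLin, ← partialDerivₗ_apply, map_sum, map_smul]
  simp only [partialDerivₗ_apply, partialDeriv_mulCoord, smul_add, sum_add_distrib]
  simp

end MulLin

variable {𝔤 : Type*} [LieRing 𝔤] [LieAlgebra ℂ 𝔤] {𝔩 : LieSubalgebra ℂ 𝔤}
  (x : Module.Basis (Fin d) ℂ 𝔩)

/-- `coadDeriv` as a bilinear map. -/
def coadDerivₗ (y : 𝔩) : FormalFun d V →ₗ[ℂ] FormalFun d V :=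
  ∑ j, mulLinₗ x ⁅y, x j⁆ ∘ₗ partialDerivₗ j

theorem coadDerivₗ_apply (y : 𝔩) (f : FormalFun d V) : coadDerivₗ x y f = coadDeriv x y f := by
  simp [coadDerivₗ, coadDeriv, mulLinₗ_apply, partialDerivₗ_apply]

theorem coadDeriv_sub (y : 𝔩) (f g : FormalFun d V) :
    coadDeriv x y (f - g) = coadDeriv x y f - coadDeriv x y g := by
  simp only [← coadDerivₗ_apply, map_sub]

theorem coadDeriv_smul (y : 𝔩) (c : ℂ) (f : FormalFun d V) :
    coadDeriv x y (c • f) = c • coadDeriv x y f := by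
  simp only [← coadDerivₗ_apply, map_smul]

theorem coadDeriv_sum {ι : Type*} (y : 𝔩) (s : Finset ι) (f : ι → FormalFun d V) :
    coadDeriv x y (∑ j ∈ s, f j) = ∑ j ∈ s, coadDeriv x y (f j) := by
  simp only [← coadDerivₗ_apply, map_sum]

theorem coadDeriv_const (y : 𝔩) (v : V) : coadDeriv x y (const d v) = 0 := by
  simp only [coadDeriv, partialDeriv_const, ← mulLinₗ_apply, map_zero, sum_const_zero]

theorem coadDeriv_mapFun (L : V →ₗ[ℂ] W) (y : 𝔩) (f : FormalFun d V) :
    coadDeriv x y (mapFun L f) = mapFun L (coadDeriv x y f) := by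
  simp only [coadDeriv, partialDeriv_mapFun, ← mapFun_mulLin]
  exact (map_sum (mapFunₗ L) _ _).symm

theorem coadDeriv_conv (β : V →ₗ[ℂ] W →ₗ[ℂ] Y) (y : 𝔩) (f : FormalFun d V)
    (g : FormalFun d W) :
    coadDeriv x y (conv β f g) = conv β (coadDeriv x y f) g + conv β f (coadDeriv x y g) := by
  simp only [coadDeriv, partialDeriv_conv, mulLin_add, sum_add_distrib, map_sum,
    LinearMap.sum_apply, conv_mulLin_left, conv_mulLin_right]

theorem coadDeriv_mul (y : 𝔩) (f g : FormalFun d A) :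
    coadDeriv x y (f * g) = coadDeriv x y f * g + f * coadDeriv x y g := by
  simp only [mul_eq_conv, coadDeriv_conv]

theorem coadDeriv_mem_ordGE (y : 𝔩) {m : ℕ} {f : FormalFun d V} (hf : f ∈ ordGE V m) :
    coadDeriv x y f ∈ ordGE V m := by
  refine Submodule.sum_mem _ fun j _ => ?_
  cases m with
  | zero => exact mem_ordGE_zero _
  | succ m => exact mulLin_mem_ordGE x _ (partialDeriv_mem_ordGE j hf)

/-- The derivation sends the linear function `z` to the linear function `[y, z]`; the two orders of
multiplication by linear functions agree. -/
theorem coadDeriv_mulLin (y z : 𝔩) (f : FormalFun d V) :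
    coadDeriv x y (mulLin x z f) = mulLin x ⁅y, z⁆ f + mulLin x z (coadDeriv x y f) := by
  simp only [coadDeriv, partialDeriv_mulLin, mulLin_add, mulLin_smul, sum_add_distrib, mulLin_sum]
  congr 1
  · conv_rhs => rw [← x.sum_repr z, lie_sum, mulLin_sum_left]
    simp only [lie_smul, mulLin_smul_left]
  · exact sum_congr rfl fun j _ => mulLin_comm x _ _ _

theorem euler_mulLin {𝔩 : Type*} [AddCommGroup 𝔩] [Module ℂ 𝔩] (x : Module.Basis (Fin d) ℂ 𝔩)
    (y : 𝔩) (f : FormalFun d V) :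
    euler (mulLin x y f) = mulLin x y f + mulLin x y (euler f) := by
  simp only [euler_apply, partialDeriv_mulLin, ← mulCoordₗ_apply, map_add, sum_add_distrib,
    map_smul, mulLin_sum]
  congr 1
  refine sum_congr rfl fun i _ => ?_
  simp only [mulCoordₗ_apply, ← mulLin_basis x]
  exact mulLin_comm x _ _ _

/-- A vector field with linear coefficients preserves the degree. -/
theorem euler_coadDeriv (y : 𝔩) (f : FormalFun d V) :
    euler (coadDeriv x y f) = coadDeriv x y (euler f) := by
  simp only [coadDeriv, map_sum, euler_mulLin, euler_partialDeriv, mulLin_sub]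
  exact sum_congr rfl fun j _ => by abel

theorem isEquivariant_iff {act : 𝔩 → V → V} (L : 𝔩 → V →ₗ[ℂ] V) (hL : ∀ y v, act y v = L y v)
    (f : FormalFun d V) :
    IsEquivariant x act f ↔ ∀ y, coadDeriv x y f + mapFun (L y) f = 0 := by
  simp only [IsEquivariant, hL]
  exact forall_congr' fun y => ⟨fun h => formalFun_ext h, fun h n => congrArg (coef n) h⟩

end Coadjoint

/-! ### The canonical map to the enveloping algebra is injective -/

section LieSeries

open Finset

theorem sum_antidiagonal_assoc {M V : Type*} [AddCommMonoid M] [HasAntidiagonal M]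
    [AddCommMonoid V] (T : M → M → M → V) (n : M) :
    ∑ p ∈ HasAntidiagonal.antidiagonal n, ∑ q ∈ HasAntidiagonal.antidiagonal p.2,
        T p.1 q.1 q.2 =
      ∑ p ∈ HasAntidiagonal.antidiagonal n, ∑ q ∈ HasAntidiagonal.antidiagonal p.1,
        T q.1 q.2 p.2 := by
  simp only [sum_sigma']
  refine sum_nbij' (fun s => ⟨(s.1.1 + s.2.1, s.2.2), (s.1.1, s.2.1)⟩)
    (fun s => ⟨(s.2.1, s.2.2 + s.1.2), (s.2.2, s.1.2)⟩) ?_ ?_ ?_ ?_ ?_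
  · rintro ⟨⟨a, b⟩, ⟨c, e⟩⟩ h
    simp only [mem_sigma, HasAntidiagonal.mem_antidiagonal] at h ⊢
    exact ⟨by rw [add_assoc, h.2, h.1], trivial⟩
  · rintro ⟨⟨a, b⟩, ⟨c, e⟩⟩ h
    simp only [mem_sigma, HasAntidiagonal.mem_antidiagonal] at h ⊢
    exact ⟨by rw [← add_assoc, h.2, h.1], trivial⟩
  · rintro ⟨⟨a, b⟩, ⟨c, e⟩⟩ h
    simp only [mem_sigma, HasAntidiagonal.mem_antidiagonal] at h
    simp [h.2]
  · rintro ⟨⟨a, b⟩, ⟨c, e⟩⟩ h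
    simp only [mem_sigma, HasAntidiagonal.mem_antidiagonal] at h
    simp [h.2]
  · rintro ⟨⟨a, b⟩, ⟨c, e⟩⟩ h
    rfl

theorem sum_antidiagonal_left_comm {M V : Type*} [AddCommMonoid M] [HasAntidiagonal M]
    [AddCommMonoid V] (T : M → M → M → V) (n : M) :
    ∑ p ∈ HasAntidiagonal.antidiagonal n, ∑ q ∈ HasAntidiagonal.antidiagonal p.2,
        T p.1 q.1 q.2 =
      ∑ p ∈ HasAntidiagonal.antidiagonal n, ∑ q ∈ HasAntidiagonal.antidiagonal p.2,
        T q.1 p.1 q.2 := by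
  rw [sum_antidiagonal_assoc, sum_antidiagonal_assoc (fun a b c => T b a c)]
  refine sum_congr rfl fun p _ => ?_
  refine sum_nbij' Prod.swap Prod.swap ?_ ?_ ?_ ?_ ?_ <;>
    simp [HasAntidiagonal.mem_antidiagonal, add_comm]

variable {d : ℕ} {𝔤 : Type*} [LieRing 𝔤] [LieAlgebra ℂ 𝔤]

/-- The Lie bracket of `𝔤[[x]]`. -/
def lieConv : FormalFun d 𝔤 →ₗ[ℂ] FormalFun d 𝔤 →ₗ[ℂ] FormalFun d 𝔤 :=
  conv (LieAlgebra.ad ℂ 𝔤 : 𝔤 →ₗ[ℂ] Module.End ℂ 𝔤)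

theorem coef_lieConv (f g : FormalFun d 𝔤) (n : Fin d →₀ ℕ) :
    coef n (lieConv f g) =
      ∑ p ∈ HasAntidiagonal.antidiagonal n, ⁅coef p.1 f, coef p.2 g⁆ := rfl

theorem lieConv_skew (f g : FormalFun d 𝔤) : -lieConv f g = lieConv g f :=
  formalFun_ext fun n => by
    rw [map_neg, coef_lieConv, coef_lieConv, ← sum_neg_distrib]
    refine sum_nbij' Prod.swap Prod.swap ?_ ?_ ?_ ?_ ?_ <;>
      simp [HasAntidiagonal.mem_antidiagonal, add_comm]

theorem lieConv_leibniz (f g h : FormalFun d 𝔤) :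
    lieConv f (lieConv g h) = lieConv (lieConv f g) h + lieConv g (lieConv f h) :=
  formalFun_ext fun n => by
    simp only [map_add, coef_lieConv, lie_sum, sum_lie]
    rw [← sum_antidiagonal_assoc (fun a b c => ⁅⁅coef a f, coef b g⁆, coef c h⁆),
      ← sum_antidiagonal_left_comm (fun a b c => ⁅coef b g, ⁅coef a f, coef c h⁆⁆),
      ← sum_add_distrib]
    refine sum_congr rfl fun p _ => ?_
    rw [← sum_add_distrib]
    exact sum_congr rfl fun q _ => leibniz_lie _ _ _

theorem partialDeriv_lieConv (i : Fin d) (f g : FormalFun d 𝔤) :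
    partialDeriv i (lieConv f g) = lieConv (partialDeriv i f) g + lieConv f (partialDeriv i g) :=
  partialDeriv_conv _ _ _ _

theorem euler_lieConv (f g : FormalFun d 𝔤) :
    euler (lieConv f g) = lieConv (euler f) g + lieConv f (euler g) :=
  euler_conv _ _ _

variable (b : Module.Basis (Fin d) ℂ 𝔤)

/-- The tautological function `∑ x_i b_i`. -/
def tautFun : FormalFun d 𝔤 := ∑ i, mulCoord i (const d (b i))

theorem partialDeriv_tautFun (i : Fin d) : partialDeriv i (tautFun b) = const d (b i) := by
  have h : ∀ k, mulCoord k (0 : FormalFun d 𝔤) = 0 := fun k => map_zero (mulCoordₗ k)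
  simp [tautFun, partialDeriv_sum, partialDeriv_mulCoord, partialDeriv_const, h]

theorem tautFun_mem_ordGE : tautFun b ∈ ordGE 𝔤 1 :=
  Submodule.sum_mem _ fun i _ => mulCoord_mem_ordGE i (mem_ordGE_zero _)

/-- This is the radial equation satisfied by the components of `g⁻¹ dg` for `g = exp(∑ x_i b_i)`. It
determines them without reference to a group, since bracketing with `tautFun b` raises the order. -/
theorem exists_maurerCartan_component (i : Fin d) :
    ∃ η : FormalFun d 𝔤, euler η = const d (b i) - lieConv (tautFun b) η - η := by
  obtain ⟨η, hη⟩ := exists_fixedPoint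
    (fun Y => eulerInv 1 (const d (b i) - lieConv (tautFun b) Y)) fun m F G h => by
      rw [← map_sub, sub_sub_sub_cancel_left, ← map_sub]
      apply eulerInv_mem_ordGE
      rw [← neg_sub F G, map_neg]
      exact Submodule.neg_mem _ (conv_mem_ordGE _ (tautFun_mem_ordGE b) h (by omega))
  refine ⟨η, formalFun_ext fun n => ?_⟩
  have h1 := congrArg (coef n) hη
  rw [coef_eulerInv] at h1
  have h2 : (n.degree : ℂ) + 1 ≠ 0 := by exact_mod_cast Nat.succ_ne_zero n.degree
  rw [map_sub, coef_euler, eq_sub_iff_add_eq]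
  calc (n.degree : ℂ) • coef n η + coef n η = ((n.degree : ℂ) + 1) • coef n η := by
        rw [add_smul, one_smul]
    _ = _ := by rw [← h1, smul_smul, mul_inv_cancel₀ h2, one_smul]

/-- The curvature `F` satisfies the homogeneous radial equation `E F + 2 F = -[X, F]` with `X =
tautFun b`. The right side has higher order than `F`, which forces `F = 0`. -/
theorem maurerCartan {η : Fin d → FormalFun d 𝔤}
    (hη : ∀ i, euler (η i) = const d (b i) - lieConv (tautFun b) (η i) - η i) (i j : Fin d) :
    partialDeriv i (η j) - partialDeriv j (η i) + lieConv (η i) (η j) = 0 := by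
  set F := partialDeriv i (η j) - partialDeriv j (η i) + lieConv (η i) (η j) with hF
  -- Since `E ∂_i = ∂_i E - ∂_i`, differentiating the radial equation turns its coefficient `1` into
  -- `2`.
  have h1 : ∀ i j, euler (partialDeriv i (η j)) = -lieConv (const d (b i)) (η j)
      - lieConv (tautFun b) (partialDeriv i (η j)) - (2 : ℂ) • partialDeriv i (η j) := by
    intro i j
    rw [euler_partialDeriv, hη]
    simp only [partialDeriv_sub, partialDeriv_const, partialDeriv_lieConv, partialDeriv_tautFun,
      two_smul]
    abel
  have h2 : euler F + ((2 : ℕ) : ℂ) • F = -lieConv (tautFun b) F := by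
    rw [hF]
    simp only [map_add, map_sub, h1, euler_lieConv, hη, LinearMap.sub_apply, Nat.cast_ofNat]
    rw [lieConv_leibniz (tautFun b) (η i) (η j), ← lieConv_skew (const d (b j)) (η i)]
    simp only [two_smul]
    abel
  refine eq_zero_of_euler 2 F (by simp) fun m hm => ?_
  rw [h2]
  exact Submodule.neg_mem _ (conv_mem_ordGE _ (tautFun_mem_ordGE b) hm (by omega))

theorem coord_lieConv (c : Fin d) (f g : FormalFun d 𝔤) :
    mapFun (b.coord c) (lieConv f g) = ∑ p, ∑ q, b.coord c ⁅b p, b q⁆ •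
      (mapFun (b.coord p) f * mapFun (b.coord q) g) := by
  have key : ∀ u v : 𝔤, b.coord c ⁅u, v⁆ =
      ∑ p, ∑ q, b.coord c ⁅b p, b q⁆ * (b.coord p u * b.coord q v) := by
    intro u v
    conv_lhs => rw [← b.sum_repr u, ← b.sum_repr v]
    simp only [sum_lie, lie_sum, smul_lie, lie_smul, map_sum, map_smul, smul_eq_mul, mul_sum]
    rw [sum_comm]
    refine sum_congr rfl fun p _ => sum_congr rfl fun q _ => ?_
    simp only [Module.Basis.coord_apply]
    ring
  refine formalFun_ext fun n => ?_
  simp only [map_sum, map_smul, mul_eq_conv, coef_conv, coef_mapFun, coef_lieConv,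
    LinearMap.mul_apply']
  rw [sum_congr rfl fun p _ => key _ _, sum_comm]
  refine sum_congr rfl fun p _ => ?_
  rw [sum_comm]
  refine sum_congr rfl fun q _ => ?_
  rw [smul_sum]
  rfl

/-- The vector field with coefficients `X i`. -/
def vectorField (X : Fin d → FormalFun d ℂ) : Module.End ℂ (FormalFun d ℂ) :=
  ∑ i, LinearMap.mulLeft ℂ (X i) ∘ₗ partialDerivₗ i

theorem vectorField_apply (X : Fin d → FormalFun d ℂ) (f : FormalFun d ℂ) :
    vectorField X f = ∑ i, X i * partialDeriv i f := by
  simp [vectorField, partialDerivₗ_apply]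

theorem vectorField_mul (X : Fin d → FormalFun d ℂ) (f g : FormalFun d ℂ) :
    vectorField X (f * g) = vectorField X f * g + f * vectorField X g := by
  simp only [vectorField_apply, partialDeriv_mul, mul_add, sum_add_distrib, sum_mul, mul_sum]
  congr 1 <;> exact sum_congr rfl fun i _ => by ring

/-- The second-order terms cancel by symmetry of mixed partial derivatives. -/
theorem vectorField_commutator (X Y : Fin d → FormalFun d ℂ) (f : FormalFun d ℂ) :
    vectorField X (vectorField Y f) - vectorField Y (vectorField X f) =
      ∑ i, (vectorField X (Y i) - vectorField Y (X i)) * partialDeriv i f := by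
  have h : ∀ X Y : Fin d → FormalFun d ℂ, vectorField X (vectorField Y f) =
      ∑ i, vectorField X (Y i) * partialDeriv i f +
        ∑ i, ∑ j, Y i * X j * partialDeriv j (partialDeriv i f) := by
    intro X Y
    rw [vectorField_apply Y, map_sum, ← sum_add_distrib]
    refine sum_congr rfl fun i _ => ?_
    rw [vectorField_mul, vectorField_apply X (partialDeriv i f), mul_sum]
    congr 1
    exact sum_congr rfl fun j _ => by ring
  rw [h X Y, h Y X, sum_comm (f := fun i j => X i * Y j * partialDeriv j (partialDeriv i f))]
  simp only [partialDeriv_comm (f := f), mul_comm (X _) (Y _), sub_mul, sum_sub_distrib]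
  rw [add_sub_add_comm, sub_self, add_zero]

end LieSeries

/-! ### A faithful representation by left-invariant vector fields. -/

section Embedding

open Finset

attribute [local instance 100] LieRing.ofAssociativeRing

variable (𝔤 : Type*) [LieRing 𝔤] [LieAlgebra ℂ 𝔤] [FiniteDimensional ℂ 𝔤]

/-- The frame dual to the Maurer-Cartan form has the structure constants of `𝔤` as commutators.
Sending a basis of `𝔤` to this frame is thus a Lie algebra map, and it is injective because a frame
is linearly independent. -/
theorem exists_faithful_vectorFields :
    ∃ (d : ℕ) (J : 𝔤 →ₗ⁅ℂ⁆ Module.End ℂ (FormalFun d ℂ)), Function.Injective J := by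
  set d := Module.finrank ℂ 𝔤
  let b : Module.Basis (Fin d) ℂ 𝔤 := Module.finBasis ℂ 𝔤
  choose η hη using exists_maurerCartan_component b
  let H : Matrix (Fin d) (Fin d) (FormalFun d ℂ) := fun c i => mapFun (b.coord c) (η i)
  have hMC : ∀ c i j, partialDeriv i (H c j) - partialDeriv j (H c i) =
      -∑ p, ∑ q, b.coord c ⁅b p, b q⁆ • (H p i * H q j) := by
    intro c i j
    have := congrArg (mapFunₗ (b.coord c)) (maurerCartan b hη i j)
    simp only [map_add, map_sub, map_zero, mapFunₗ_apply, coord_lieConv] at this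
    rw [← partialDeriv_mapFun, ← partialDeriv_mapFun] at this
    exact eq_neg_of_add_eq_zero_left this
  have h0 : ∀ i, coef 0 (η i) = b i := by
    intro i
    have h1 := congrArg (coef 0) (hη i)
    have h2 : coef 0 (lieConv (tautFun b) (η i)) = 0 :=
      mem_ordGE_one.1 (conv_mem_ordGE _ (tautFun_mem_ordGE b) (mem_ordGE_zero (η i)) (by omega))
    rw [map_sub, map_sub, h2, coef_euler, coef_zero_const, map_zero, Nat.cast_zero, zero_smul,
      sub_zero] at h1
    exact (sub_eq_zero.1 h1.symm).symm
  -- At the origin the form is the identity of `𝔤`, so its matrix has determinant `1` there and is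
  -- invertible over the power series.
  have hdet : IsUnit H.det := by
    rw [MvPowerSeries.isUnit_iff_constantCoeff, RingHom.map_det]
    have : (MvPowerSeries.constantCoeff (σ := Fin d) (R := ℂ)).mapMatrix H = 1 := by
      ext c i
      have : (MvPowerSeries.constantCoeff (H c i) : ℂ) = b.coord c (coef 0 (η i)) := rfl
      rw [RingHom.mapMatrix_apply, Matrix.map_apply, this, h0, Module.Basis.coord_apply,
        b.repr_self, Matrix.one_apply, Finsupp.single_apply]
      simp only [eq_comm]
    rw [this, Matrix.det_one]
    exact isUnit_one
  let X := H⁻¹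
  have hHX : ∀ c a, ∑ i, H c i * X i a = if c = a then 1 else 0 := fun c a => by
    rw [← Matrix.mul_apply, Matrix.mul_nonsing_inv H hdet, Matrix.one_apply]
  have hXH : X * H = 1 := Matrix.nonsing_inv_mul H hdet
  let J₀ : 𝔤 →ₗ[ℂ] Module.End ℂ (FormalFun d ℂ) := b.constr ℂ fun a => vectorField fun i => X i a
  have hJ₀ : ∀ y, J₀ y = vectorField fun i => ∑ a, b.coord a y • X i a := by
    intro y
    refine LinearMap.ext fun f => ?_
    rw [Module.Basis.constr_apply_fintype]
    simp only [LinearMap.sum_apply, LinearMap.smul_apply, vectorField_apply, smul_sum, sum_mul]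
    rw [sum_comm]
    simp [Module.Basis.equivFun_apply]
  have hlie : ∀ a c i, vectorField (fun i => X i a) (X i c) - vectorField (fun i => X i c) (X i a)
      = ∑ e, b.coord e ⁅b a, b c⁆ • X i e := by
    intro a c
    set w : Fin d → FormalFun d ℂ := fun i =>
      vectorField (fun i => X i a) (X i c) - vectorField (fun i => X i c) (X i a) with hw
    -- Here the form is evaluated on the commutator of two frame fields. Differentiating `H X = 1`
    -- moves the derivatives onto `H`, where the Maurer-Cartan equation applies.
    have h1 : ∀ e, ∑ i, H e i * w i = b.coord e ⁅b a, b c⁆ • (1 : FormalFun d ℂ) := by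
      intro e
      have h2 : ∀ a c, ∑ i, H e i * vectorField (fun i => X i a) (X i c) =
          -∑ i, ∑ j, X i c * X j a * partialDeriv j (H e i) := by
        intro a c
        have h3 := congrArg (vectorField fun i => X i a) (hHX e c)
        have h4 : vectorField (fun i => X i a)
            (if e = c then (1 : FormalFun d ℂ) else 0) = 0 := by
          split_ifs
          · simp [vectorField_apply]
          · simp
        rw [h4, map_sum] at h3
        simp only [vectorField_mul, sum_add_distrib] at h3
        rw [eq_neg_of_add_eq_zero_right h3]
        congr 1
        refine sum_congr rfl fun i _ => ?_
        rw [vectorField_apply, sum_mul]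
        exact sum_congr rfl fun j _ => by ring
      simp only [hw, mul_sub, sum_sub_distrib, h2]
      rw [sum_comm (f := fun i j => X i a * X j c * partialDeriv j (H e i))]
      have h5 : -∑ i, ∑ j, X i c * X j a * partialDeriv j (H e i) -
          -∑ j, ∑ i, X i a * X j c * partialDeriv j (H e i) =
          -∑ i, ∑ j, X i c * X j a * (partialDeriv j (H e i) - partialDeriv i (H e j)) := by
        simp only [mul_sub, sum_sub_distrib]
        simp only [mul_comm (X _ a) (X _ c)]
        abel
      rw [h5]
      simp only [hMC, mul_neg, sum_neg_distrib, neg_neg]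
      calc ∑ i, ∑ j, X i c * X j a * ∑ p, ∑ q, b.coord e ⁅b p, b q⁆ • (H p j * H q i)
          = ∑ p, ∑ q, b.coord e ⁅b p, b q⁆ • ((∑ j, H p j * X j a) * ∑ i, H q i * X i c) := by
            simp only [sum_mul, mul_sum, smul_sum]
            rw [sum_comm]
            refine (sum_congr rfl fun j _ => sum_comm.trans (sum_congr rfl fun p _ =>
              sum_comm)).trans (sum_comm.trans (sum_congr rfl fun p _ => sum_comm.trans
              (sum_congr rfl fun q _ => ?_)))
            rw [sum_comm]
            refine sum_congr rfl fun i _ => sum_congr rfl fun j _ => ?_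
            rw [mul_smul_comm]
            congr 1
            ring
        _ = _ := by
            simp only [hHX]
            simp
    intro i
    have h6 := congrFun (congrArg (fun M => M.mulVec w) hXH) i
    simp only [← Matrix.mulVec_mulVec, Matrix.one_mulVec] at h6
    rw [← hw] at *
    change w i = _
    rw [← h6]
    change ∑ e, X i e * ∑ k, H e k * w k = _
    simp only [h1]
    exact sum_congr rfl fun e _ => by rw [mul_smul_comm, mul_one]
  have hJ₀lie : ∀ y z, J₀ ⁅y, z⁆ = ⁅J₀ y, J₀ z⁆ := by
    have : (LieAlgebra.ad ℂ 𝔤 : 𝔤 →ₗ[ℂ] Module.End ℂ 𝔤).compr₂ J₀ =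
        ((LieAlgebra.ad ℂ (Module.End ℂ (FormalFun d ℂ)) : _ →ₗ[ℂ] Module.End ℂ _)).compl₁₂
          J₀ J₀ := by
      refine b.ext fun a => b.ext fun c => LinearMap.ext fun f => ?_
      change J₀ ⁅b a, b c⁆ f = ⁅J₀ (b a), J₀ (b c)⁆ f
      rw [LieRing.of_associative_ring_bracket, LinearMap.sub_apply]
      change _ = J₀ (b a) (J₀ (b c) f) - J₀ (b c) (J₀ (b a) f)
      have hb : ∀ a, J₀ (b a) = vectorField fun i => X i a := fun a => b.constr_basis ℂ _ a
      rw [hb, hb, vectorField_commutator, hJ₀, vectorField_apply]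
      simp only [hlie]
    exact fun y z => LinearMap.congr_fun (LinearMap.congr_fun this y) z
  refine ⟨d, { J₀ with map_lie' := fun {y z} => hJ₀lie y z }, ?_⟩
  have hinj : Function.Injective J₀ := by
    rw [injective_iff_map_eq_zero]
    intro y hy
    have h1 : ∀ i, ∑ a, b.coord a y • X i a = 0 := by
      intro i
      -- Applying a vector field to the coordinate functions recovers its coefficients.
      have h2 := LinearMap.congr_fun hy (mulCoord i 1)
      rw [hJ₀, vectorField_apply] at h2
      have h3 : ∀ k, mulCoord k (0 : FormalFun d ℂ) = 0 := fun k => map_zero (mulCoordₗ k)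
      simpa [partialDeriv_mulCoord, h3] using h2
    apply b.repr.injective
    ext c
    have h4 : ∑ i, H c i * ∑ a, b.coord a y • X i a = b.coord c y • (1 : FormalFun d ℂ) := by
      simp only [mul_sum, mul_smul_comm]
      rw [sum_comm]
      simp only [← smul_sum, hHX]
      simp
    simp only [h1, mul_zero, sum_const_zero] at h4
    have h5 := congrArg (coef 0) h4
    rw [map_zero, map_smul, ← const_one, coef_zero_const] at h5
    simpa using h5.symm
  exact hinj

/-- A faithful Lie algebra map into an associative algebra factors through `U(𝔤)`. -/
theorem inc_injective : Function.Injective (inc (𝔤 := 𝔤)) := by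
  obtain ⟨d, J, hJ⟩ := exists_faithful_vectorFields 𝔤
  intro y z h
  apply hJ
  have := congrArg (UniversalEnvelopingAlgebra.lift ℂ J) h
  rwa [UniversalEnvelopingAlgebra.lift_ι_apply, UniversalEnvelopingAlgebra.lift_ι_apply] at this

end Embedding

/-! ### The algebra of gauge transformations -/

section GaugeAlgebra

open Finset

variable {ι A R W : Type*} [Fintype ι] [CommRing A] [Ring R] [Algebra A R] [Ring W] [Algebra A W]

/-- Derivations `D k` of an algebra over a ring of functions with `D k (w i j) = c i j k`. -/
structure DerivationFamily (w : ι → ι → A) (c : ι → ι → ι → A) (W : Type*) [Ring W]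
    [Algebra A W] where
  /-- The derivations. -/
  D : ι → W →+ W
  leibniz : ∀ k v v', D k (v * v') = D k v * v' + v * D k v'
  smul : ∀ k i j v, D k (w i j • v) = c i j k • v + w i j • D k v

/-- The relations satisfied by the structure functions of the Lie algebra `𝔩`, its basis `x`, and
the components `η` of a Maurer-Cartan form with `Ad(g⁻¹) x_i = x_i - ∑ w_ij η_j`. -/
structure GaugeRelations {w : ι → ι → A} {c : ι → ι → ι → A} (𝒟 : DerivationFamily w c R)
    (x η : ι → R) : Prop where
  coeff_skew : ∀ i j, w j i = -w i j
  struct_skew : ∀ i j k, c j i k = -c i j k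
  jacobi : ∀ a b e, ∑ k, (c b e k * w k a - c a e k * w k b + c a b k * w k e) = 0
  D_x : ∀ k i, 𝒟.D k (x i) = 0
  lie_x : ∀ i j, x i * x j - x j * x i = ∑ k, c i j k • x k
  lie_adx : ∀ i j, (x i - ∑ k, w i k • η k) * (x j - ∑ k, w j k • η k)
    - (x j - ∑ k, w j k • η k) * (x i - ∑ k, w i k • η k)
    = ∑ k, c i j k • (x k - ∑ l, w k l • η l)
  lie_adx_η : ∀ i j, (x i - ∑ k, w i k • η k) * η j - η j * (x i - ∑ k, w i k • η k)
    = -∑ k, (c i k j • η k + w i k • 𝒟.D j (η k))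
  maurerCartan : ∀ i j, 𝒟.D i (η j) - 𝒟.D j (η i) = -(η i * η j - η j * η i)

variable (w : ι → ι → A) (x η : ι → R)

/-- `Ad(g⁻¹) x_i`. -/
def adBasis (i : ι) : R := x i - ∑ k, w i k • η k

/-- `∑ η_i ⊗ x_i - Ad(g⁻¹)(x_i) ⊗ η_i`, for `p`, `q` the inclusions of two tensor factors. -/
def gaugeTerm (p q : R →ₐ[A] W) : W :=
  ∑ i, (p (η i) * q (x i) - p (adBasis w x η i) * q (η i))

variable {w x η} {c : ι → ι → ι → A} {p q r : R →ₐ[A] W}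

/-- The expanded form exhibits the antisymmetry, whereas the defining form, with `Ad(g⁻¹) x_i` kept
together, makes commutators short. -/
theorem gaugeTerm_eq (p q : R →ₐ[A] W) :
    gaugeTerm w x η p q = ∑ i, (p (η i) * q (x i) - p (x i) * q (η i))
      + ∑ i, ∑ j, w i j • (p (η j) * q (η i)) := by
  rw [gaugeTerm, ← sum_add_distrib]
  refine sum_congr rfl fun i _ => ?_
  simp only [adBasis, map_sub, map_sum, map_smul, sub_mul, sum_mul, smul_mul_assoc]
  abel

theorem gaugeTerm_skew (hsk : ∀ i j, w j i = -w i j) (hpq : ∀ a b, Commute (p a) (q b)) :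
    gaugeTerm w x η q p = -gaugeTerm w x η p q := by
  rw [gaugeTerm_eq, gaugeTerm_eq, neg_add, ← sum_neg_distrib, ← sum_neg_distrib]
  congr 1
  · exact sum_congr rfl fun i _ => by rw [(hpq _ _).eq, (hpq _ _).eq]; abel
  · rw [sum_comm]
    refine sum_congr rfl fun i _ => ?_
    rw [← sum_neg_distrib]
    exact sum_congr rfl fun j _ => by rw [(hpq _ _).eq, hsk, neg_smul]

theorem sum_swap_outer {M : Type*} [AddCommMonoid M] (F : ι → ι → ι → M) :
    ∑ i, ∑ j, ∑ k, F i j k = ∑ i, ∑ j, ∑ k, F k j i := by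
  rw [sum_comm, sum_congr rfl fun j _ => sum_comm, sum_comm]

/-- Two tensors sharing only the slot `p` have a commutator concentrated in that slot. -/
theorem lie_slots (hqp : ∀ a b, Commute (q a) (p b)) (hrp : ∀ a b, Commute (r a) (p b))
    (hqr : ∀ a b, Commute (q a) (r b)) (a b a' b' : R) :
    p a * q b * (p a' * r b') - p a' * r b' * (p a * q b) =
      p (a * a' - a' * a) * q b * r b' := by
  have h1 : p a * q b * (p a' * r b') = p (a * a') * q b * r b' := by
    rw [map_mul, mul_assoc (p a), ← mul_assoc (q b), (hqp b a').eq]; noncomm_ring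
  have h2 : p a' * r b' * (p a * q b) = p (a' * a) * q b * r b' := by
    rw [map_mul, mul_assoc (p a'), ← mul_assoc (r b'), (hrp b' a).eq, mul_assoc (p a),
      ← (hqr b b').eq]; noncomm_ring
  rw [h1, h2, map_sub, sub_mul, sub_mul]

section Sums

variable (𝒟 : DerivationFamily w c R) (p q r : R →ₐ[A] W)

/-- `∑ p[η_i, η_j] q(x_i) r(x_j)`. -/
def sumLie (η x : ι → R) : W :=
  ∑ i, ∑ j, p (η i * η j - η j * η i) * q (x i) * r (x j)

/-- `∑ c_ijk p(x_k) q(η_i) r(η_j)`. -/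
def sumStruct (c : ι → ι → ι → A) (x η : ι → R) : W :=
  ∑ i, ∑ j, ∑ k, c i j k • (p (x k) * q (η i) * r (η j))

/-- `∑ c_ijk w_kl p(η_l) q(η_i) r(η_j)`. -/
def sumQuad (w : ι → ι → A) (c : ι → ι → ι → A) (η : ι → R) : W :=
  ∑ i, ∑ j, ∑ k, ∑ l, (c i j k * w k l) • (p (η l) * q (η i) * r (η j))

/-- `∑ w_jk p(∂_i η_k) q(x_i) r(η_j)`. -/
def sumMixed (x η : ι → R) : W :=
  ∑ i, ∑ j, ∑ k, w j k • (p (𝒟.D i (η k)) * q (x i) * r (η j))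

/-- `∑ p(∂_k η_i) q(x_k) r(x_i)`. -/
def sumDeriv (x η : ι → R) : W :=
  ∑ k, ∑ i, p (𝒟.D k (η i)) * q (x k) * r (x i)

end Sums

variable {𝒟 : DerivationFamily w c R}

/-- Only the shared slot `p` contributes a bracket. It is one of `[η, η]`, `[Ad(g⁻¹) x, η]` and
`[Ad(g⁻¹) x, Ad(g⁻¹) x]`, and the last two are rewritten by the gauge relations. The named sums on
the right are the building blocks that cancel when the three commutators are combined. -/
theorem gaugeTerm_lie (h : GaugeRelations 𝒟 x η) (hqp : ∀ a b, Commute (q a) (p b))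
    (hrp : ∀ a b, Commute (r a) (p b)) (hqr : ∀ a b, Commute (q a) (r b)) :
    gaugeTerm w x η p q * gaugeTerm w x η p r - gaugeTerm w x η p r * gaugeTerm w x η p q =
      sumLie p q r η x + sumStruct q p r c x η - sumStruct r p q c x η + sumStruct p q r c x η
        - sumQuad p q r w c η - sumMixed 𝒟 p q r x η + sumMixed 𝒟 p r q x η := by
  have e : gaugeTerm w x η p q * gaugeTerm w x η p r - gaugeTerm w x η p r * gaugeTerm w x η p q =
      ∑ i, ∑ j, (p (η i * η j - η j * η i) * q (x i) * r (x j)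
        + p (adBasis w x η j * η i - η i * adBasis w x η j) * q (x i) * r (η j)
        - p (adBasis w x η i * η j - η j * adBasis w x η i) * q (η i) * r (x j)
        + p (adBasis w x η i * adBasis w x η j - adBasis w x η j * adBasis w x η i)
          * q (η i) * r (η j)) := by
    rw [gaugeTerm, gaugeTerm, sum_mul_sum, sum_mul_sum, sum_comm (f := fun i j =>
      (p (η i) * r (x i) - p (adBasis w x η i) * r (η i)) *
      (p (η j) * q (x j) - p (adBasis w x η j) * q (η j))), ← sum_sub_distrib]
    refine sum_congr rfl fun i _ => ?_
    rw [← sum_sub_distrib]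
    refine sum_congr rfl fun j _ => ?_
    have h3 : p (adBasis w x η j * η i - η i * adBasis w x η j) * q (x i) * r (η j) =
        -(p (η i * adBasis w x η j - adBasis w x η j * η i) * q (x i) * r (η j)) := by
      rw [← neg_sub, map_neg, neg_mul, neg_mul]
    rw [h3]
    simp only [← lie_slots hqp hrp hqr]
    noncomm_ring
  have h1 : ∀ i j, adBasis w x η i * η j - η j * adBasis w x η i
      = -∑ k, (c i k j • η k + w i k • 𝒟.D j (η k)) := h.lie_adx_η
  have h2 : ∀ i j, adBasis w x η i * adBasis w x η j - adBasis w x η j * adBasis w x η i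
      = ∑ k, c i j k • (x k - ∑ l, w k l • η l) := h.lie_adx
  have e1 : ∑ i, ∑ j, p (adBasis w x η j * η i - η i * adBasis w x η j) * q (x i) * r (η j) =
      sumStruct q p r c x η - sumMixed 𝒟 p q r x η := by
    have : sumStruct q p r c x η =
        -∑ i, ∑ j, ∑ k, c j k i • (p (η k) * q (x i) * r (η j)) := by
      rw [sumStruct, sum_swap_outer, ← sum_neg_distrib]
      refine sum_congr rfl fun i _ => ?_
      rw [← sum_neg_distrib]
      refine sum_congr rfl fun j _ => ?_
      rw [← sum_neg_distrib]
      exact sum_congr rfl fun k _ => by rw [h.struct_skew j k, neg_smul, (hqp _ _).eq]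
    rw [this, sumMixed]
    simp only [h1, map_neg, map_sum, map_add, map_smul, neg_mul, sum_mul, add_mul, smul_mul_assoc,
      sum_add_distrib, sum_neg_distrib]
    abel
  have e2 : ∑ i, ∑ j, p (adBasis w x η i * η j - η j * adBasis w x η i) * q (η i) * r (x j) =
      sumStruct r p q c x η - sumMixed 𝒟 p r q x η := by
    have h4 : sumStruct r p q c x η =
        -∑ i, ∑ j, ∑ k, c i k j • (p (η k) * q (η i) * r (x j)) := by
      rw [sumStruct, sum_swap_outer, sum_comm, ← sum_neg_distrib]
      refine sum_congr rfl fun i _ => ?_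
      rw [← sum_neg_distrib]
      refine sum_congr rfl fun j _ => ?_
      rw [← sum_neg_distrib]
      exact sum_congr rfl fun k _ => by
        rw [h.struct_skew i k, neg_smul, (hrp _ _).eq, mul_assoc, ← (hqr _ _).eq,
          ← mul_assoc]
    have h5 : sumMixed 𝒟 p r q x η =
        ∑ i, ∑ j, ∑ k, w i k • (p (𝒟.D j (η k)) * q (η i) * r (x j)) := by
      rw [sumMixed, sum_comm]
      refine sum_congr rfl fun i _ => sum_congr rfl fun j _ => sum_congr rfl fun k _ => ?_
      rw [mul_assoc, ← (hqr _ _).eq, ← mul_assoc]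
    rw [h4, h5]
    simp only [h1, map_neg, map_sum, map_add, map_smul, neg_mul, sum_mul, add_mul, smul_mul_assoc,
      sum_add_distrib, sum_neg_distrib]
    abel
  have e3 : ∑ i, ∑ j, p (adBasis w x η i * adBasis w x η j - adBasis w x η j * adBasis w x η i)
      * q (η i) * r (η j) = sumStruct p q r c x η - sumQuad p q r w c η := by
    simp only [h2, sumStruct, sumQuad, map_sum, map_smul, map_sub, sum_mul, sub_mul,
      smul_mul_assoc, smul_sub, sum_sub_distrib, smul_sum, smul_smul]
  rw [e]
  simp only [sum_add_distrib, sum_sub_distrib]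
  rw [e1, e2, e3, sumLie]
  abel

end GaugeAlgebra

/-! ### The Yang-Baxter equation and equivariance for the gauge term. -/

section GaugeIdentity

open Finset

variable {ι A R W : Type*} [Fintype ι] [CommRing A] [Ring R] [Algebra A R] [Ring W] [Algebra A W]
  {w : ι → ι → A} {x η : ι → R} {c : ι → ι → ι → A} {p q r : R →ₐ[A] W}
  {𝒟 : DerivationFamily w c R} {ℰ : DerivationFamily w c W}

/-- The `x_i` are constant, so derivatives fall on the `η` and on the functions `w`. The latter
contribute structure constants, the former the derivative and mixed sums. -/
theorem sum_mul_deriv_gaugeTerm (h : GaugeRelations 𝒟 x η)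
    (hq : ∀ k a, ℰ.D k (q a) = q (𝒟.D k a)) (hr : ∀ k a, ℰ.D k (r a) = r (𝒟.D k a))
    (hqp : ∀ a b, Commute (q a) (p b)) (hrp : ∀ a b, Commute (r a) (p b))
    (hqr : ∀ a b, Commute (q a) (r b)) :
    ∑ k, p (x k) * ℰ.D k (gaugeTerm w x η q r) =
      sumDeriv 𝒟 q p r x η - sumDeriv 𝒟 r p q x η - sumStruct p q r c x η
        + sumMixed 𝒟 q p r x η - sumMixed 𝒟 r p q x η := by
  have e : ∀ k, ℰ.D k (gaugeTerm w x η q r) = ∑ i, q (𝒟.D k (η i)) * r (x i)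
      - ∑ i, q (x i) * r (𝒟.D k (η i)) + ∑ i, ∑ j, c i j k • (q (η j) * r (η i))
      + ∑ i, ∑ j, w i j • (q (𝒟.D k (η j)) * r (η i))
      + ∑ i, ∑ j, w i j • (q (η j) * r (𝒟.D k (η i))) := by
    intro k
    rw [gaugeTerm_eq, map_add, map_sum, map_sum]
    simp only [map_sum, map_sub, ℰ.leibniz, ℰ.smul, hq, hr, h.D_x, map_zero, mul_zero, zero_mul,
      add_zero, zero_add, smul_add, sum_add_distrib, sum_sub_distrib]
    abel
  have e1 : sumStruct p q r c x η =
      -∑ k, ∑ i, ∑ j, c i j k • (p (x k) * (q (η j) * r (η i))) := by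
    rw [sumStruct, sum_swap_outer, ← sum_neg_distrib]
    refine sum_congr rfl fun k _ => ?_
    rw [← sum_neg_distrib]
    refine sum_congr rfl fun i _ => ?_
    rw [← sum_neg_distrib]
    exact sum_congr rfl fun j _ => by rw [h.struct_skew i j, neg_smul, mul_assoc]
  have e2 : sumMixed 𝒟 q p r x η =
      ∑ k, ∑ i, ∑ j, w i j • (p (x k) * (q (𝒟.D k (η j)) * r (η i))) :=
    sum_congr rfl fun k _ => sum_congr rfl fun i _ => sum_congr rfl fun j _ => by
      rw [(hqp _ _).eq, mul_assoc]
  have e3 : sumMixed 𝒟 r p q x η =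
      -∑ k, ∑ i, ∑ j, w i j • (p (x k) * (q (η j) * r (𝒟.D k (η i)))) := by
    rw [sumMixed, ← sum_neg_distrib]
    refine sum_congr rfl fun k _ => ?_
    rw [sum_comm, ← sum_neg_distrib]
    refine sum_congr rfl fun i _ => ?_
    rw [← sum_neg_distrib]
    exact sum_congr rfl fun j _ => by
      rw [h.coeff_skew i j, neg_smul, (hrp _ _).eq, mul_assoc, (hqr _ _).eq]
  have e4 : sumDeriv 𝒟 q p r x η = ∑ k, ∑ i, p (x k) * (q (𝒟.D k (η i)) * r (x i)) :=
    sum_congr rfl fun k _ => sum_congr rfl fun i _ => by rw [(hqp _ _).eq, mul_assoc]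
  have e5 : sumDeriv 𝒟 r p q x η = ∑ k, ∑ i, p (x k) * (q (x i) * r (𝒟.D k (η i))) :=
    sum_congr rfl fun k _ => sum_congr rfl fun i _ => by
      rw [(hrp _ _).eq, mul_assoc, (hqr _ _).eq]
  rw [e1, e2, e3, e4, e5]
  simp only [e, mul_add, mul_sub, mul_sum, mul_smul_comm, sum_add_distrib, sum_sub_distrib]
  abel

/-- The difference antisymmetrizes `∂_k η_i`, and the Maurer-Cartan equation turns this into a
bracket. -/
theorem sumDeriv_sub (h : GaugeRelations 𝒟 x η) (hqr : ∀ a b, Commute (q a) (r b)) :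
    sumDeriv 𝒟 p q r x η - sumDeriv 𝒟 p r q x η = -sumLie p q r η x := by
  have : sumDeriv 𝒟 p r q x η = ∑ k, ∑ i, p (𝒟.D i (η k)) * q (x k) * r (x i) := by
    rw [sumDeriv, sum_comm]
    exact sum_congr rfl fun k _ => sum_congr rfl fun i _ => by
      rw [mul_assoc, ← (hqr _ _).eq, ← mul_assoc]
  rw [this, sumDeriv, sumLie, ← sum_sub_distrib, ← sum_neg_distrib]
  refine sum_congr rfl fun k _ => ?_
  rw [← sum_sub_distrib, ← sum_neg_distrib]
  exact sum_congr rfl fun i _ => by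
    rw [← sub_mul, ← sub_mul, ← map_sub, h.maurerCartan, map_neg, neg_mul, neg_mul]

theorem sumStruct_swap (h : GaugeRelations 𝒟 x η) (hqr : ∀ a b, Commute (q a) (r b)) :
    sumStruct p r q c x η = -sumStruct p q r c x η := by
  rw [sumStruct, sum_comm, sumStruct, ← sum_neg_distrib]
  refine sum_congr rfl fun i _ => ?_
  rw [← sum_neg_distrib]
  refine sum_congr rfl fun j _ => ?_
  rw [← sum_neg_distrib]
  exact sum_congr rfl fun k _ => by
    rw [h.struct_skew i j, neg_smul, mul_assoc, ← (hqr _ _).eq, ← mul_assoc]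

/-- After renaming indices, the coefficient of `η_a ⊗ η_b ⊗ η_e` is the Jacobi identity evaluated at
`λ`. -/
theorem sum_sumQuad (h : GaugeRelations 𝒟 x η) (hpq : ∀ a b, Commute (p a) (q b))
    (hpr : ∀ a b, Commute (p a) (r b)) (hqr : ∀ a b, Commute (q a) (r b)) :
    sumQuad p q r w c η - sumQuad q p r w c η + sumQuad r p q w c η = 0 := by
  have e1 : sumQuad p q r w c η =
      ∑ a, ∑ b, ∑ e, ∑ k, (c b e k * w k a) • (p (η a) * q (η b) * r (η e)) := by
    calc _ = ∑ b, ∑ e, ∑ a, ∑ k, (c b e k * w k a) • (p (η a) * q (η b) * r (η e)) :=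
          sum_congr rfl fun b _ => sum_congr rfl fun e _ => sum_comm
      _ = _ := by
          rw [sum_congr rfl fun b _ => sum_comm, sum_comm]
  have e2 : sumQuad q p r w c η =
      ∑ a, ∑ b, ∑ e, ∑ k, (c a e k * w k b) • (p (η a) * q (η b) * r (η e)) := by
    refine sum_congr rfl fun a _ => ?_
    rw [sum_comm, sum_congr rfl fun b _ => sum_comm, sum_comm]
    rw [sum_comm, sum_congr rfl fun b _ => sum_comm, sum_comm]
    rw [sum_congr rfl fun b _ => sum_comm, sum_comm]
    exact sum_congr rfl fun b _ => sum_congr rfl fun e _ => sum_congr rfl fun k _ => by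
      rw [(hpq _ _).eq]
  have e3 : sumQuad r p q w c η =
      ∑ a, ∑ b, ∑ e, ∑ k, (c a b k * w k e) • (p (η a) * q (η b) * r (η e)) := by
    refine sum_congr rfl fun a _ => sum_congr rfl fun b _ => ?_
    rw [sum_comm]
    exact sum_congr rfl fun e _ => sum_congr rfl fun k _ => by
      rw [mul_assoc, ← ((hpr _ _).mul_left (hqr _ _)).eq]
  rw [e1, e2, e3, ← sum_sub_distrib, ← sum_add_distrib]
  refine sum_eq_zero fun a _ => ?_
  rw [← sum_sub_distrib, ← sum_add_distrib]
  refine sum_eq_zero fun b _ => ?_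
  rw [← sum_sub_distrib, ← sum_add_distrib]
  refine sum_eq_zero fun e _ => ?_
  simp only [← sum_smul]
  rw [← sub_smul, ← add_smul, ← sum_sub_distrib, ← sum_add_distrib, h.jacobi, zero_smul]

/-- The classical dynamical Yang-Baxter equation for `-gaugeTerm`. -/
theorem cdybe_gaugeTerm (h : GaugeRelations 𝒟 x η) {s₁ s₂ s₃ : R →ₐ[A] W}
    (h₁ : ∀ k a, ℰ.D k (s₁ a) = s₁ (𝒟.D k a)) (h₂ : ∀ k a, ℰ.D k (s₂ a) = s₂ (𝒟.D k a))
    (h₃ : ∀ k a, ℰ.D k (s₃ a) = s₃ (𝒟.D k a)) (h₁₂ : ∀ a b, Commute (s₁ a) (s₂ b))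
    (h₁₃ : ∀ a b, Commute (s₁ a) (s₃ b)) (h₂₃ : ∀ a b, Commute (s₂ a) (s₃ b)) :
    ∑ k, s₁ (x k) * ℰ.D k (gaugeTerm w x η s₂ s₃) - ∑ k, s₂ (x k) * ℰ.D k (gaugeTerm w x η s₁ s₃)
      + ∑ k, s₃ (x k) * ℰ.D k (gaugeTerm w x η s₁ s₂) =
    (gaugeTerm w x η s₁ s₂ * gaugeTerm w x η s₁ s₃ - gaugeTerm w x η s₁ s₃ * gaugeTerm w x η s₁ s₂)
    + (gaugeTerm w x η s₁ s₂ * gaugeTerm w x η s₂ s₃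
        - gaugeTerm w x η s₂ s₃ * gaugeTerm w x η s₁ s₂)
    + (gaugeTerm w x η s₁ s₃ * gaugeTerm w x η s₂ s₃
        - gaugeTerm w x η s₂ s₃ * gaugeTerm w x η s₁ s₃) := by
  have h₂₁ := fun a b => (h₁₂ b a).symm
  have h₃₁ := fun a b => (h₁₃ b a).symm
  have h₃₂ := fun a b => (h₂₃ b a).symm
  have C1 := gaugeTerm_lie h h₂₁ h₃₁ h₂₃
  have C2 := gaugeTerm_lie h h₁₂ h₃₂ h₁₃
  have C3 := gaugeTerm_lie h h₁₃ h₂₃ h₁₂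
  -- The commutator formula wants the shared slot first; antisymmetry of the gauge term reverses the
  -- slots at the cost of a sign.
  rw [gaugeTerm_skew h.coeff_skew h₁₂] at C2
  rw [gaugeTerm_skew h.coeff_skew h₁₃, gaugeTerm_skew h.coeff_skew h₂₃] at C3
  have C2' : gaugeTerm w x η s₁ s₂ * gaugeTerm w x η s₂ s₃
        - gaugeTerm w x η s₂ s₃ * gaugeTerm w x η s₁ s₂ = -(-gaugeTerm w x η s₁ s₂ *
        gaugeTerm w x η s₂ s₃ - gaugeTerm w x η s₂ s₃ * -gaugeTerm w x η s₁ s₂) := by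
    noncomm_ring
  have C3' : gaugeTerm w x η s₁ s₃ * gaugeTerm w x η s₂ s₃
        - gaugeTerm w x η s₂ s₃ * gaugeTerm w x η s₁ s₃ = -gaugeTerm w x η s₁ s₃ *
        -gaugeTerm w x η s₂ s₃ - -gaugeTerm w x η s₂ s₃ * -gaugeTerm w x η s₁ s₃ := by
    noncomm_ring
  rw [C2', C3', C1, C2, C3, sum_mul_deriv_gaugeTerm h h₂ h₃ h₂₁ h₃₁ h₂₃,
    sum_mul_deriv_gaugeTerm h h₁ h₃ h₁₂ h₃₂ h₁₃, sum_mul_deriv_gaugeTerm h h₁ h₂ h₁₃ h₂₃ h₁₂]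
  have Y1 := sumDeriv_sub (p := s₁) h h₂₃
  have Y2 := sumDeriv_sub (p := s₂) h h₁₃
  have Y3 := sumDeriv_sub (p := s₃) h h₁₂
  rw [sumStruct_swap (p := s₁) h h₂₃, sumStruct_swap (p := s₂) h h₁₃,
    sumStruct_swap (p := s₃) h h₁₂]
  have Q := sum_sumQuad h h₁₂ h₁₃ h₂₃
  rw [← sub_eq_zero] at Y1 Y2 Y3 ⊢
  -- Three Maurer-Cartan identities and one Jacobi identity account for the whole difference; the
  -- remaining sums cancel identically.
  have : (0 : W) = -(sumDeriv 𝒟 s₁ s₂ s₃ x η - sumDeriv 𝒟 s₁ s₃ s₂ x η - -sumLie s₁ s₂ s₃ η x)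
      + (sumDeriv 𝒟 s₂ s₁ s₃ x η - sumDeriv 𝒟 s₂ s₃ s₁ x η - -sumLie s₂ s₁ s₃ η x)
      - (sumDeriv 𝒟 s₃ s₁ s₂ x η - sumDeriv 𝒟 s₃ s₂ s₁ x η - -sumLie s₃ s₁ s₂ η x)
      + (sumQuad s₁ s₂ s₃ w c η - sumQuad s₂ s₁ s₃ w c η + sumQuad s₃ s₁ s₂ w c η) := by
    rw [Y1, Y2, Y3, Q]; simp
  rw [this]
  abel

/-- The effect of `Ad(g⁻¹)` on the derivative of an equivariant function. -/
theorem sum_adBasis_mul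
    (h : GaugeRelations 𝒟 x η) {T : W} (hT : ∀ a, Commute (p a) T)
    (heq : ∀ i, ∑ j, w i j • ℰ.D j T + ((q (x i) + r (x i)) * T - T * (q (x i) + r (x i))) = 0) :
    ∑ i, p (adBasis w x η i) *
        (ℰ.D i T + ((q (η i) + r (η i)) * T - T * (q (η i) + r (η i)))) =
      ∑ i, p (x i) * ℰ.D i T - ((gaugeTerm w x η p q + gaugeTerm w x η p r) * T
        - T * (gaugeTerm w x η p q + gaugeTerm w x η p r)) := by
  have e1 : (gaugeTerm w x η p q + gaugeTerm w x η p r) * T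
        - T * (gaugeTerm w x η p q + gaugeTerm w x η p r) =
      ∑ i, (p (η i) * ((q (x i) + r (x i)) * T - T * (q (x i) + r (x i)))
        - p (adBasis w x η i) * ((q (η i) + r (η i)) * T - T * (q (η i) + r (η i)))) := by
    rw [gaugeTerm, gaugeTerm, ← sum_add_distrib, sum_mul, mul_sum, ← sum_sub_distrib]
    refine sum_congr rfl fun i _ => ?_
    have a1 : T * (p (η i) * q (x i) - p (adBasis w x η i) * q (η i) +
        (p (η i) * r (x i) - p (adBasis w x η i) * r (η i))) =
        p (η i) * (T * (q (x i) + r (x i))) - p (adBasis w x η i) * (T * (q (η i) + r (η i))) := by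
      rw [← mul_assoc (p _), ← mul_assoc (p _), (hT _).eq, (hT _).eq]
      noncomm_ring
    rw [a1]
    noncomm_ring
  -- Equivariance replaces the bracket with `x_i` by a derivative along the coadjoint field. By
  -- antisymmetry of `w` it matches the correction in `Ad(g⁻¹) x_i`.
  have e2 : ∀ i, (q (x i) + r (x i)) * T - T * (q (x i) + r (x i)) = -∑ j, w i j • ℰ.D j T :=
    fun i => eq_neg_of_add_eq_zero_right (heq i)
  have e3 : ∑ i, p (adBasis w x η i) * ℰ.D i T = ∑ i, p (x i) * ℰ.D i T +
      ∑ i, p (η i) * ∑ j, w i j • ℰ.D j T := by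
    simp only [adBasis, map_sub, map_sum, map_smul, sub_mul, sum_mul, mul_sum, smul_mul_assoc,
      mul_smul_comm, sum_sub_distrib]
    rw [sub_eq_add_neg, sum_comm, ← sum_neg_distrib]
    congr 1
    refine sum_congr rfl fun i _ => ?_
    rw [← sum_neg_distrib]
    exact sum_congr rfl fun j _ => by rw [h.coeff_skew i j, neg_smul, neg_neg]
  rw [e1, sum_congr rfl fun i _ => mul_add _ _ _, sum_add_distrib, e3]
  simp only [e2, sum_sub_distrib, mul_neg, sum_neg_distrib]
  abel

/-- The derivation `∑ w_mj D_j + [y, ·]`. -/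
def twistedDeriv (ℰ : DerivationFamily w c W) (m : ι) (y : W) : W →+ W :=
  ∑ j, (DistribSMul.toAddMonoidHom W (w m j)).comp (ℰ.D j) +
    (AddMonoidHom.mulLeft y - AddMonoidHom.mulRight y)

theorem twistedDeriv_apply (m : ι) (y T : W) :
    twistedDeriv ℰ m y T = ∑ j, w m j • ℰ.D j T + (y * T - T * y) := by
  simp [twistedDeriv, AddMonoidHom.finsetSum_apply]

theorem twistedDeriv_mul (m : ι) (y S T : W) :
    twistedDeriv ℰ m y (S * T) = twistedDeriv ℰ m y S * T + S * twistedDeriv ℰ m y T := by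
  simp only [twistedDeriv_apply, ℰ.leibniz, smul_add, sum_add_distrib, add_mul, mul_add, sum_mul,
    mul_sum, smul_mul_assoc, mul_smul_comm]
  noncomm_ring

theorem twistedDeriv_smul (m : ι) (y T : W) (i j : ι) :
    twistedDeriv ℰ m y (w i j • T) = (∑ k, w m k * c i j k) • T
      + w i j • twistedDeriv ℰ m y T := by
  simp only [twistedDeriv_apply, ℰ.smul, smul_add, smul_sub, sum_add_distrib, mul_smul_comm,
    smul_mul_assoc, sum_smul, smul_sum, smul_smul, mul_comm (w m _)]
  abel

theorem twistedDeriv_x (h : GaugeRelations 𝒟 x η) (m i : ι) :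
    twistedDeriv 𝒟 m (x m) (x i) = ∑ k, c m i k • x k := by
  rw [twistedDeriv_apply, h.lie_x]
  simp [h.D_x]

/-- The relation for `[Ad(g⁻¹) x_m, η_j]` contains `∂_j η_k`. The Maurer-Cartan equation exchanges
it for `∂_k η_j`, and what remains says that the `η_j` transform dually to the basis `x`. -/
theorem twistedDeriv_η (h : GaugeRelations 𝒟 x η) (m j : ι) :
    twistedDeriv 𝒟 m (x m) (η j) = -∑ k, c m k j • η k := by
  have h1 := h.lie_adx_η m j
  have h2 : ∀ k, 𝒟.D j (η k) = 𝒟.D k (η j) + (η k * η j - η j * η k) := by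
    intro k
    rw [← sub_eq_iff_eq_add', h.maurerCartan]
    noncomm_ring
  simp only [h2, sub_mul, mul_sub, sum_mul, mul_sum, smul_mul_assoc, mul_smul_comm, smul_add,
    smul_sub, sum_add_distrib, sum_sub_distrib] at h1
  rw [twistedDeriv_apply, ← sub_eq_zero, sub_neg_eq_add]
  rw [← sub_eq_zero] at h1
  rw [← h1]
  abel

theorem twistedDeriv_left (hp : ∀ k a, ℰ.D k (p a) = p (𝒟.D k a))
    (hpq : ∀ a b, Commute (p a) (q b)) (m : ι) (y a : R) :
    twistedDeriv ℰ m (p y + q y) (p a) = p (twistedDeriv 𝒟 m y a) := by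
  simp only [twistedDeriv_apply, map_add, map_sum, map_smul, map_sub, map_mul, hp]
  rw [add_mul, mul_add, (hpq a y).eq]
  abel

theorem twistedDeriv_right (hq : ∀ k a, ℰ.D k (q a) = q (𝒟.D k a))
    (hpq : ∀ a b, Commute (p a) (q b)) (m : ι) (y a : R) :
    twistedDeriv ℰ m (p y + q y) (q a) = q (twistedDeriv 𝒟 m y a) := by
  simp only [twistedDeriv_apply, map_add, map_sum, map_smul, map_sub, map_mul, hq]
  rw [add_mul, mul_add, (hpq y a).eq]
  abel

/-- The infinitesimal equivariance of `gaugeTerm`. -/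
theorem gaugeTerm_equivariant (h : GaugeRelations 𝒟 x η)
    (hp : ∀ k a, ℰ.D k (p a) = p (𝒟.D k a)) (hq : ∀ k a, ℰ.D k (q a) = q (𝒟.D k a))
    (hpq : ∀ a b, Commute (p a) (q b)) (m : ι) :
    ∑ j, w m j • ℰ.D j (gaugeTerm w x η p q) + ((p (x m) + q (x m)) * gaugeTerm w x η p q
      - gaugeTerm w x η p q * (p (x m) + q (x m))) = 0 := by
  rw [← twistedDeriv_apply]
  rw [gaugeTerm_eq]
  simp only [map_add, map_sum, map_sub, twistedDeriv_mul, twistedDeriv_smul,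
    twistedDeriv_left hp hpq, twistedDeriv_right hq hpq, twistedDeriv_x h, twistedDeriv_η h,
    map_neg, map_smul, sum_mul, mul_sum, smul_mul_assoc,
    mul_smul_comm, neg_mul, mul_neg, sum_add_distrib, sum_sub_distrib, sum_neg_distrib, smul_add,
    smul_neg, smul_sum, smul_smul]
  -- In the terms linear in `η`, the action on `x` and the dual action on `η` cancel by exchanging
  -- indices. The quadratic terms, handled in `e3`, cancel by the Jacobi identity.
  have e1 : ∑ i, ∑ k, c m k i • (p (η k) * q (x i)) = ∑ i, ∑ k, c m i k • (p (η i) * q (x k)) :=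
    sum_comm
  have e2 : ∑ i, ∑ k, c m k i • (p (x i) * q (η k)) = ∑ i, ∑ k, c m i k • (p (x k) * q (η i)) :=
    sum_comm
  have e3 : ∑ i, ∑ j, (∑ k, w m k * c i j k) • (p (η j) * q (η i))
      - ∑ i, ∑ j, ∑ k, (w i j * c m k j) • (p (η k) * q (η i))
      - ∑ i, ∑ j, ∑ k, (w i j * c m k i) • (p (η j) * q (η k)) = 0 := by
    have f1 : ∑ i, ∑ j, ∑ k, (w i j * c m k j) • (p (η k) * q (η i)) =
        ∑ i, ∑ j, (∑ k, w i k * c m j k) • (p (η j) * q (η i)) := by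
      refine sum_congr rfl fun i _ => ?_
      rw [sum_comm]
      simp only [sum_smul]
    have f2 : ∑ i, ∑ j, ∑ k, (w i j * c m k i) • (p (η j) * q (η k)) =
        ∑ i, ∑ j, (∑ k, w k j * c m i k) • (p (η j) * q (η i)) := by
      rw [sum_swap_outer]
      simp only [sum_smul]
    rw [f1, f2, ← sum_sub_distrib, ← sum_sub_distrib]
    refine sum_eq_zero fun i _ => ?_
    rw [← sum_sub_distrib, ← sum_sub_distrib]
    refine sum_eq_zero fun j _ => ?_
    rw [← sub_smul, ← sub_smul]
    have := h.jacobi m i j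
    rw [← neg_eq_zero, ← sum_neg_distrib] at this
    rw [← sum_sub_distrib, ← sum_sub_distrib, sum_congr rfl fun k _ => ?_, this, zero_smul]
    rw [h.coeff_skew k m, h.coeff_skew k i]
    ring
  rw [e1, e2, ← e3]
  abel

end GaugeIdentity

/-! ### Covariance of the Yang-Baxter expression under conjugation. -/

section GaugeCovariance

open Finset

variable {ι A R R₂ W : Type*} [Fintype ι] [CommRing A] [Ring R] [Algebra A R] [Ring R₂]
  [Algebra A R₂] [Ring W] [Algebra A W] {w : ι → ι → A} {x η : ι → R} {c : ι → ι → ι → A}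
  {𝒟 : DerivationFamily w c R} {ℱ : DerivationFamily w c R₂} {ℰ : DerivationFamily w c W}

/-- Inclusions of one and two tensor factors into a threefold tensor product, for the inclusions
`l`, `r` of the factors of a twofold tensor product. -/
structure TensorSlots (l r : R →ₐ[A] R₂) (W : Type*) [Ring W] [Algebra A W] where
  /-- The first factor. -/
  s₁ : R →ₐ[A] W
  /-- The second factor. -/
  s₂ : R →ₐ[A] W
  /-- The third factor. -/
  s₃ : R →ₐ[A] W
  /-- The first and second factors. -/
  t₁₂ : R₂ →ₐ[A] W
  /-- The first and third factors. -/
  t₁₃ : R₂ →ₐ[A] W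
  /-- The second and third factors. -/
  t₂₃ : R₂ →ₐ[A] W
  t₁₂_l : ∀ a, t₁₂ (l a) = s₁ a
  t₁₂_r : ∀ a, t₁₂ (r a) = s₂ a
  t₁₃_l : ∀ a, t₁₃ (l a) = s₁ a
  t₁₃_r : ∀ a, t₁₃ (r a) = s₃ a
  t₂₃_l : ∀ a, t₂₃ (l a) = s₂ a
  t₂₃_r : ∀ a, t₂₃ (r a) = s₃ a
  comm₁ : ∀ a T, Commute (s₁ a) (t₂₃ T)
  comm₂ : ∀ a T, Commute (s₂ a) (t₁₃ T)
  comm₃ : ∀ a T, Commute (s₃ a) (t₁₂ T)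

variable {l r : R →ₐ[A] R₂} (𝒯 : TensorSlots l r W)

/-- The left hand side of the classical dynamical Yang-Baxter equation. -/
def cdybeSlots (ℰ : DerivationFamily w c W) (x : ι → R) (S : R₂) : W :=
  ∑ k, 𝒯.s₁ (x k) * ℰ.D k (𝒯.t₂₃ S) - ∑ k, 𝒯.s₂ (x k) * ℰ.D k (𝒯.t₁₃ S)
    + ∑ k, 𝒯.s₃ (x k) * ℰ.D k (𝒯.t₁₂ S)
    + ((𝒯.t₁₂ S * 𝒯.t₁₃ S - 𝒯.t₁₃ S * 𝒯.t₁₂ S) + (𝒯.t₁₂ S * 𝒯.t₂₃ S - 𝒯.t₂₃ S * 𝒯.t₁₂ S)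
      + (𝒯.t₁₃ S * 𝒯.t₂₃ S - 𝒯.t₂₃ S * 𝒯.t₁₃ S))

theorem map_gaugeTerm (t : R₂ →ₐ[A] W) {p q : R →ₐ[A] W} (hp : ∀ a, t (l a) = p a)
    (hq : ∀ a, t (r a) = q a) : t (gaugeTerm w x η l r) = gaugeTerm w x η p q := by
  simp only [gaugeTerm, map_sum, map_sub, map_mul, hp, hq]

/-- The left hand side of the classical dynamical Yang-Baxter equation, conjugated. -/
theorem cdybeSlots_add_gaugeTerm (h : GaugeRelations 𝒟 x η)
    (hl : ∀ k a, ℱ.D k (l a) = l (𝒟.D k a)) (hr : ∀ k a, ℱ.D k (r a) = r (𝒟.D k a))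
    (h₁₂ : ∀ k T, ℰ.D k (𝒯.t₁₂ T) = 𝒯.t₁₂ (ℱ.D k T))
    (h₁₃ : ∀ k T, ℰ.D k (𝒯.t₁₃ T) = 𝒯.t₁₃ (ℱ.D k T))
    (h₂₃ : ∀ k T, ℰ.D k (𝒯.t₂₃ T) = 𝒯.t₂₃ (ℱ.D k T))
    (hlr : ∀ a b, Commute (l a) (r b)) {S β : R₂} (hβ : β = S + gaugeTerm w x η l r)
    (hS : ∀ m, twistedDeriv ℱ m (l (x m) + r (x m)) S = 0) :
    ∑ i, 𝒯.s₁ (adBasis w x η i) * 𝒯.t₂₃ (ℱ.D i β + ((l (η i) + r (η i)) * β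
        - β * (l (η i) + r (η i))))
      - ∑ i, 𝒯.s₂ (adBasis w x η i) * 𝒯.t₁₃ (ℱ.D i β + ((l (η i) + r (η i)) * β
        - β * (l (η i) + r (η i))))
      + ∑ i, 𝒯.s₃ (adBasis w x η i) * 𝒯.t₁₂ (ℱ.D i β + ((l (η i) + r (η i)) * β
        - β * (l (η i) + r (η i))))
      + ((𝒯.t₁₂ β * 𝒯.t₁₃ β - 𝒯.t₁₃ β * 𝒯.t₁₂ β) + (𝒯.t₁₂ β * 𝒯.t₂₃ β - 𝒯.t₂₃ β * 𝒯.t₁₂ β)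
        + (𝒯.t₁₃ β * 𝒯.t₂₃ β - 𝒯.t₂₃ β * 𝒯.t₁₃ β)) = cdybeSlots 𝒯 ℰ x S := by
  -- Both `S` and the gauge term are invariant, hence so is their sum; this is what
  -- `sum_adBasis_mul` requires in each pair of slots.
  have hβeq : ∀ m, twistedDeriv ℱ m (l (x m) + r (x m)) β = 0 := by
    intro m
    rw [hβ, map_add, hS, zero_add, twistedDeriv_apply, gaugeTerm_equivariant h hl hr hlr]
  have c₁₂ : ∀ a b, Commute (𝒯.s₁ a) (𝒯.s₂ b) := fun a b => by
    rw [← 𝒯.t₂₃_l]; exact 𝒯.comm₁ _ _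
  have c₁₃ : ∀ a b, Commute (𝒯.s₁ a) (𝒯.s₃ b) := fun a b => by
    rw [← 𝒯.t₂₃_r]; exact 𝒯.comm₁ _ _
  have c₂₃ : ∀ a b, Commute (𝒯.s₂ a) (𝒯.s₃ b) := fun a b => by
    rw [← 𝒯.t₁₃_r]; exact 𝒯.comm₂ _ _
  have eq₂₃ : ∀ i, ∑ j, w i j • ℰ.D j (𝒯.t₂₃ β) + ((𝒯.s₂ (x i) + 𝒯.s₃ (x i)) * 𝒯.t₂₃ β
      - 𝒯.t₂₃ β * (𝒯.s₂ (x i) + 𝒯.s₃ (x i))) = 0 := fun i => by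
    have := congrArg 𝒯.t₂₃ (hβeq i)
    simpa only [twistedDeriv_apply, map_add, map_sum, map_smul, map_sub, map_mul, map_zero, h₂₃,
      𝒯.t₂₃_l, 𝒯.t₂₃_r] using this
  have eq₁₃ : ∀ i, ∑ j, w i j • ℰ.D j (𝒯.t₁₃ β) + ((𝒯.s₁ (x i) + 𝒯.s₃ (x i)) * 𝒯.t₁₃ β
      - 𝒯.t₁₃ β * (𝒯.s₁ (x i) + 𝒯.s₃ (x i))) = 0 := fun i => by
    have := congrArg 𝒯.t₁₃ (hβeq i)
    simpa only [twistedDeriv_apply, map_add, map_sum, map_smul, map_sub, map_mul, map_zero, h₁₃,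
      𝒯.t₁₃_l, 𝒯.t₁₃_r] using this
  have eq₁₂ : ∀ i, ∑ j, w i j • ℰ.D j (𝒯.t₁₂ β) + ((𝒯.s₁ (x i) + 𝒯.s₂ (x i)) * 𝒯.t₁₂ β
      - 𝒯.t₁₂ β * (𝒯.s₁ (x i) + 𝒯.s₂ (x i))) = 0 := fun i => by
    have := congrArg 𝒯.t₁₂ (hβeq i)
    simpa only [twistedDeriv_apply, map_add, map_sum, map_smul, map_sub, map_mul, map_zero, h₁₂,
      𝒯.t₁₂_l, 𝒯.t₁₂_r] using this
  have E1 := sum_adBasis_mul h (fun a => 𝒯.comm₁ a β) eq₂₃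
  have E2 := sum_adBasis_mul h (fun a => 𝒯.comm₂ a β) eq₁₃
  have E3 := sum_adBasis_mul h (fun a => 𝒯.comm₃ a β) eq₁₂
  have d₁ : ∀ k a, ℰ.D k (𝒯.s₁ a) = 𝒯.s₁ (𝒟.D k a) := fun k a => by
    rw [← 𝒯.t₁₂_l, h₁₂, hl, 𝒯.t₁₂_l]
  have d₂ : ∀ k a, ℰ.D k (𝒯.s₂ a) = 𝒯.s₂ (𝒟.D k a) := fun k a => by
    rw [← 𝒯.t₁₂_r, h₁₂, hr, 𝒯.t₁₂_r]
  have d₃ : ∀ k a, ℰ.D k (𝒯.s₃ a) = 𝒯.s₃ (𝒟.D k a) := fun k a => by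
    rw [← 𝒯.t₁₃_r, h₁₃, hr, 𝒯.t₁₃_r]
  have K := cdybe_gaugeTerm h d₁ d₂ d₃ c₁₂ c₁₃ c₂₃
  rw [gaugeTerm_skew h.coeff_skew c₁₂] at E2
  rw [gaugeTerm_skew h.coeff_skew c₁₃, gaugeTerm_skew h.coeff_skew c₂₃] at E3
  simp only [map_add, map_sub, map_mul, ← h₁₂, ← h₁₃, ← h₂₃, 𝒯.t₁₂_l, 𝒯.t₁₂_r, 𝒯.t₁₃_l, 𝒯.t₁₃_r,
    𝒯.t₂₃_l, 𝒯.t₂₃_r]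
  rw [E1, E2, E3]
  have g₁₂ : 𝒯.t₁₂ β = 𝒯.t₁₂ S + gaugeTerm w x η 𝒯.s₁ 𝒯.s₂ := by
    rw [hβ, map_add, map_gaugeTerm _ 𝒯.t₁₂_l 𝒯.t₁₂_r]
  have g₁₃ : 𝒯.t₁₃ β = 𝒯.t₁₃ S + gaugeTerm w x η 𝒯.s₁ 𝒯.s₃ := by
    rw [hβ, map_add, map_gaugeTerm _ 𝒯.t₁₃_l 𝒯.t₁₃_r]
  have g₂₃ : 𝒯.t₂₃ β = 𝒯.t₂₃ S + gaugeTerm w x η 𝒯.s₂ 𝒯.s₃ := by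
    rw [hβ, map_add, map_gaugeTerm _ 𝒯.t₂₃_l 𝒯.t₂₃_r]
  rw [g₁₂, g₁₃, g₂₃, cdybeSlots]
  simp only [map_add, mul_add (_ : W) (ℰ.D _ _) (ℰ.D _ _), sum_add_distrib]
  -- Write `γ` for the gauge term. Its cross terms with `S` cancel. The brackets of `γ` with itself
  -- occur with total coefficient `1 - 2 = -1`, and by `K` they cancel the derivative terms of `γ`.
  rw [← sub_eq_zero] at K ⊢
  rw [← K]
  noncomm_ring

/-- Every ingredient `T` of the expression for `σ` satisfies `T U = U T'` with `U = u ⊗ u ⊗ u`. This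
intertwining passes to sums and products, so the whole expression is intertwined with the one
evaluated in `cdybeSlots_add_gaugeTerm`. For the derivative of `σ`, the partner `T'` is a covariant
derivative with connection form `η ⊗ 1 + 1 ⊗ η`. -/
theorem cdybeSlots_gauge (h : GaugeRelations 𝒟 x η)
    (hl : ∀ k a, ℱ.D k (l a) = l (𝒟.D k a)) (hr : ∀ k a, ℱ.D k (r a) = r (𝒟.D k a))
    (h₁₂ : ∀ k T, ℰ.D k (𝒯.t₁₂ T) = 𝒯.t₁₂ (ℱ.D k T))
    (h₁₃ : ∀ k T, ℰ.D k (𝒯.t₁₃ T) = 𝒯.t₁₃ (ℱ.D k T))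
    (h₂₃ : ∀ k T, ℰ.D k (𝒯.t₂₃ T) = 𝒯.t₂₃ (ℱ.D k T))
    (hlr : ∀ a b, Commute (l a) (r b)) {S σ : R₂} {u : R}
    (hS : ∀ m, twistedDeriv ℱ m (l (x m) + r (x m)) S = 0)
    (hσ : σ * (l u * r u) = l u * r u * (S + gaugeTerm w x η l r))
    (hη : ∀ i, 𝒟.D i u = u * η i) (hx : ∀ i, x i * u = u * adBasis w x η i) :
    cdybeSlots 𝒯 ℰ x σ * (𝒯.s₁ u * 𝒯.s₂ u * 𝒯.s₃ u) =
      𝒯.s₁ u * 𝒯.s₂ u * 𝒯.s₃ u * cdybeSlots 𝒯 ℰ x S := by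
  set β := S + gaugeTerm w x η l r with hβ
  rw [← cdybeSlots_add_gaugeTerm 𝒯 h hl hr h₁₂ h₁₃ h₂₃ hlr hβ hS]
  have c₁₂ : ∀ a b, Commute (𝒯.s₁ a) (𝒯.s₂ b) := fun a b => by
    rw [← 𝒯.t₂₃_l]; exact 𝒯.comm₁ _ _
  have c₁₃ : ∀ a b, Commute (𝒯.s₁ a) (𝒯.s₃ b) := fun a b => by
    rw [← 𝒯.t₂₃_r]; exact 𝒯.comm₁ _ _
  have c₂₃ : ∀ a b, Commute (𝒯.s₂ a) (𝒯.s₃ b) := fun a b => by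
    rw [← 𝒯.t₁₃_r]; exact 𝒯.comm₂ _ _
  -- Differentiate `hσ`, using that the derivative of `u ⊗ u` is `(u ⊗ u)(η_i ⊗ 1 + 1 ⊗ η_i)`.
  have hDσ : ∀ i, ℱ.D i σ * (l u * r u) = l u * r u * (ℱ.D i β + ((l (η i) + r (η i)) * β
      - β * (l (η i) + r (η i)))) := by
    intro i
    have e := congrArg (ℱ.D i) hσ
    have e' : ℱ.D i (l u * r u) = l u * r u * (l (η i) + r (η i)) := by
      rw [ℱ.leibniz, hl, hr, hη, map_mul, map_mul, mul_assoc (l u), (hlr _ _).eq]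
      noncomm_ring
    rw [ℱ.leibniz i σ, ℱ.leibniz i (l u * r u) β, e', ← mul_assoc σ, hσ, ← eq_sub_iff_add_eq] at e
    rw [e]
    noncomm_ring
  have k₁₂ : ∀ T T', T * (l u * r u) = l u * r u * T' →
      𝒯.t₁₂ T * (𝒯.s₁ u * 𝒯.s₂ u * 𝒯.s₃ u) = 𝒯.s₁ u * 𝒯.s₂ u * 𝒯.s₃ u * 𝒯.t₁₂ T' := by
    intro T T' hT
    have := congrArg 𝒯.t₁₂ hT
    simp only [map_mul, 𝒯.t₁₂_l, 𝒯.t₁₂_r] at this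
    rw [← mul_assoc, this, mul_assoc, ← (𝒯.comm₃ _ _).eq, ← mul_assoc]
  have k₁₃ : ∀ T T', T * (l u * r u) = l u * r u * T' →
      𝒯.t₁₃ T * (𝒯.s₁ u * 𝒯.s₂ u * 𝒯.s₃ u) = 𝒯.s₁ u * 𝒯.s₂ u * 𝒯.s₃ u * 𝒯.t₁₃ T' := by
    intro T T' hT
    have := congrArg 𝒯.t₁₃ hT
    simp only [map_mul, 𝒯.t₁₃_l, 𝒯.t₁₃_r] at this
    rw [mul_assoc (𝒯.s₁ u), (c₂₃ _ _).eq, ← mul_assoc (𝒯.s₁ u), ← mul_assoc (𝒯.t₁₃ T), this,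
      mul_assoc, ← (𝒯.comm₂ _ _).eq, ← mul_assoc]
  have k₂₃ : ∀ T T', T * (l u * r u) = l u * r u * T' →
      𝒯.t₂₃ T * (𝒯.s₁ u * 𝒯.s₂ u * 𝒯.s₃ u) = 𝒯.s₁ u * 𝒯.s₂ u * 𝒯.s₃ u * 𝒯.t₂₃ T' := by
    intro T T' hT
    have := congrArg 𝒯.t₂₃ hT
    simp only [map_mul, 𝒯.t₂₃_l, 𝒯.t₂₃_r] at this
    rw [mul_assoc (𝒯.s₁ u), ← mul_assoc, ← (𝒯.comm₁ _ _).eq, mul_assoc, this, ← mul_assoc]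
  have m₁ : ∀ i, 𝒯.s₁ (x i) * (𝒯.s₁ u * 𝒯.s₂ u * 𝒯.s₃ u) =
      𝒯.s₁ u * 𝒯.s₂ u * 𝒯.s₃ u * 𝒯.s₁ (adBasis w x η i) := by
    intro i
    rw [← mul_assoc, ← mul_assoc, ← map_mul, hx, map_mul, mul_assoc (𝒯.s₁ u) _ (𝒯.s₂ u),
      (c₁₂ _ _).eq, mul_assoc, mul_assoc (𝒯.s₂ u), (c₁₃ _ _).eq]
    noncomm_ring
  have m₂ : ∀ i, 𝒯.s₂ (x i) * (𝒯.s₁ u * 𝒯.s₂ u * 𝒯.s₃ u) =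
      𝒯.s₁ u * 𝒯.s₂ u * 𝒯.s₃ u * 𝒯.s₂ (adBasis w x η i) := by
    intro i
    rw [← mul_assoc, ← mul_assoc, ← (c₁₂ _ _).eq, mul_assoc (𝒯.s₁ u), ← map_mul, hx, map_mul,
      mul_assoc, mul_assoc (𝒯.s₂ u), (c₂₃ _ _).eq]
    noncomm_ring
  have m₃ : ∀ i, 𝒯.s₃ (x i) * (𝒯.s₁ u * 𝒯.s₂ u * 𝒯.s₃ u) =
      𝒯.s₁ u * 𝒯.s₂ u * 𝒯.s₃ u * 𝒯.s₃ (adBasis w x η i) := by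
    intro i
    rw [← mul_assoc, ← ((c₁₃ _ _).mul_left (c₂₃ _ _)).eq, mul_assoc, ← map_mul, hx, map_mul]
    noncomm_ring
  set U := 𝒯.s₁ u * 𝒯.s₂ u * 𝒯.s₃ u
  have hmul : ∀ {a b a' b' : W}, a * U = U * a' → b * U = U * b' → a * b * U = U * (a' * b') := by
    intro a b a' b' ha hb
    rw [mul_assoc, hb, ← mul_assoc, ha, mul_assoc]
  have hadd : ∀ {a b a' b' : W}, a * U = U * a' → b * U = U * b' → (a + b) * U = U * (a' + b') :=
    fun ha hb => by rw [add_mul, mul_add, ha, hb]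
  have hsub : ∀ {a b a' b' : W}, a * U = U * a' → b * U = U * b' → (a - b) * U = U * (a' - b') :=
    fun ha hb => by rw [sub_mul, mul_sub, ha, hb]
  have hsum : ∀ {f f' : ι → W}, (∀ i, f i * U = U * f' i) → (∑ i, f i) * U = U * ∑ i, f' i :=
    fun hf => by rw [sum_mul, mul_sum]; exact sum_congr rfl fun i _ => hf i
  simp only [cdybeSlots, h₁₂, h₁₃, h₂₃]
  have n₁₂ := k₁₂ _ _ hσ
  have n₁₃ := k₁₃ _ _ hσ
  have n₂₃ := k₂₃ _ _ hσ
  refine hadd (hadd (hsub (hsum fun i => hmul (m₁ i) (k₂₃ _ _ (hDσ i)))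
    (hsum fun i => hmul (m₂ i) (k₁₃ _ _ (hDσ i)))) (hsum fun i => hmul (m₃ i) (k₁₂ _ _ (hDσ i))))
    (hadd (hadd (hsub (hmul n₁₂ n₁₃) (hmul n₁₃ n₁₂)) (hsub (hmul n₁₂ n₂₃) (hmul n₂₃ n₁₂)))
    (hsub (hmul n₁₃ n₂₃) (hmul n₂₃ n₁₃)))

end GaugeCovariance

/-! ### Gauge relations from an equivariant unit. -/

section GaugeRelationsOfUnit

open Finset

variable {ι A R : Type*} [CommRing A] [Ring R] [Algebra A R] {w : ι → ι → A}
  {x : ι → R} {c : ι → ι → ι → A} {𝒟 : DerivationFamily w c R}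

theorem DerivationFamily.D_one (k : ι) : 𝒟.D k 1 = 0 := by
  simpa using 𝒟.leibniz k 1 1

theorem DerivationFamily.D_inv (k : ι) (u : Rˣ) :
    𝒟.D k (↑u⁻¹ : R) = -(↑u⁻¹ * 𝒟.D k u * ↑u⁻¹ : R) := by
  have h := 𝒟.leibniz k (u⁻¹ : Rˣ) u
  rw [Units.inv_mul, 𝒟.D_one] at h
  rw [eq_neg_iff_add_eq_zero]
  calc _ = (𝒟.D k (↑u⁻¹ : R) * u + ↑u⁻¹ * 𝒟.D k u) * (↑u⁻¹ : R) := by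
        rw [add_mul, mul_assoc _ (u : R), Units.mul_inv, mul_one]
    _ = 0 := by rw [← h, zero_mul]

/-- Infinitesimal equivariance is exactly the formula for `Ad(u⁻¹) x_i` in terms of the logarithmic
derivative. -/
theorem mul_eq_mul_adBasis [Fintype ι] (u : Rˣ)
    (hu : ∀ i, ∑ j, w i j • 𝒟.D j (u : R) + (x i * u - u * x i) = 0) (i : ι) :
    x i * u = u * adBasis w x (fun i => (↑u⁻¹ : R) * 𝒟.D i u) i := by
  rw [adBasis, mul_sub, mul_sum, ← sub_eq_zero, ← hu i]
  simp only [mul_smul_comm, ← mul_assoc, Units.mul_inv, one_mul]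
  abel

/-- Conjugation by `u` preserves brackets, which gives `lie_adx`. Differentiating `u⁻¹ x_i u` and
its expression through `η` gives the two sides of `lie_adx_η`. The Maurer-Cartan equation comes from
commuting derivations. -/
theorem gaugeRelations_of_unit [Fintype ι] (u : Rˣ)
    (hu : ∀ i, ∑ j, w i j • 𝒟.D j (u : R) + (x i * u - u * x i) = 0)
    (hDD : ∀ i j a, 𝒟.D i (𝒟.D j a) = 𝒟.D j (𝒟.D i a))
    (coeff_skew : ∀ i j, w j i = -w i j) (struct_skew : ∀ i j k, c j i k = -c i j k)
    (jacobi : ∀ a b e, ∑ k, (c b e k * w k a - c a e k * w k b + c a b k * w k e) = 0)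
    (D_x : ∀ k i, 𝒟.D k (x i) = 0) (lie_x : ∀ i j, x i * x j - x j * x i = ∑ k, c i j k • x k) :
    GaugeRelations 𝒟 x (fun i => (↑u⁻¹ : R) * 𝒟.D i u) := by
  have hx := mul_eq_mul_adBasis u hu
  set η := fun i => (↑u⁻¹ : R) * 𝒟.D i u with hη
  have hx' : ∀ i, adBasis w x η i = ↑u⁻¹ * x i * u := fun i => by
    rw [mul_assoc, hx, ← mul_assoc, Units.inv_mul, one_mul]
  have hDu : ∀ i, 𝒟.D i (u : R) = u * η i := fun i => by
    rw [hη, ← mul_assoc, Units.mul_inv, one_mul]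
  have hDu' : ∀ i, 𝒟.D i (↑u⁻¹ : R) = -(η i * ↑u⁻¹) := fun i => 𝒟.D_inv i u
  refine ⟨coeff_skew, struct_skew, jacobi, D_x, lie_x, fun i j => ?_, fun i j => ?_,
    fun i j => ?_⟩
  · change adBasis w x η i * adBasis w x η j - adBasis w x η j * adBasis w x η i =
      ∑ k, c i j k • adBasis w x η k
    have e : ∀ i j, adBasis w x η i * adBasis w x η j = ↑u⁻¹ * (x i * x j) * u := fun i j => by
      rw [hx' i, mul_assoc, ← hx j]
      noncomm_ring
    rw [e, e, ← sub_mul, ← mul_sub, lie_x]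
    simp only [hx', mul_sum, sum_mul, mul_smul_comm, smul_mul_assoc]
  · change adBasis w x η i * η j - η j * adBasis w x η i = _
    have e1 : 𝒟.D j (adBasis w x η i) = adBasis w x η i * η j - η j * adBasis w x η i := by
      rw [hx', 𝒟.leibniz, 𝒟.leibniz, hDu, hDu', D_x]
      noncomm_ring
    rw [← e1, adBasis, map_sub, D_x, map_sum]
    simp only [𝒟.smul, zero_sub]
  · have e : ∀ i j, 𝒟.D i (η j) = ↑u⁻¹ * 𝒟.D i (𝒟.D j u) - η i * η j := fun i j => by
      change 𝒟.D i (↑u⁻¹ * 𝒟.D j ↑u) = _ - η i * (↑u⁻¹ * 𝒟.D j ↑u)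
      rw [𝒟.leibniz, hDu' i]
      noncomm_ring
    rw [e, e, hDD i j]
    abel

end GaugeRelationsOfUnit

/-! ### Formal functions with values in algebras as algebras over `ℂ[[x]]` -/

section FormalAlgebra

open Finset

variable {d : ℕ} {B B₁ B₂ : Type*} [Ring B] [Algebra ℂ B] [Ring B₁] [Algebra ℂ B₁] [Ring B₂]
  [Algebra ℂ B₂]

theorem commute_of_coef {f g : FormalFun d B} (h : ∀ m n, Commute (coef m f) (coef n g)) :
    Commute f g := by
  change f * g = g * f
  rw [mul_eq_conv, mul_eq_conv, ← conv_flip]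
  exact formalFun_ext fun n => sum_congr rfl fun p _ => (h p.2 p.1).eq

variable (d B) in
/-- The structure of a `ℂ[[x]]`-algebra on `B[[x]]`. -/
@[reducible] def formalAlgebra : Algebra (FormalFun d ℂ) (FormalFun d B) :=
  RingHom.toAlgebra' (MvPowerSeries.map (algebraMap ℂ B)) fun _ _ =>
    commute_of_coef fun _ _ => Algebra.commutes _ _

attribute [local instance] formalAlgebra

theorem formal_smul_def (a : FormalFun d ℂ) (f : FormalFun d B) :
    a • f = mapFun (Algebra.ofId ℂ B).toLinearMap a * f := rfl

/-- The map of `ℂ[[x]]`-algebras induced by a map of algebras. -/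
def formalMap (φ : B →ₐ[ℂ] B₁) : FormalFun d B →ₐ[FormalFun d ℂ] FormalFun d B₁ where
  __ := MvPowerSeries.map φ.toRingHom
  commutes' a := formalFun_ext fun n => φ.commutes (coef n a)

theorem formalMap_apply (φ : B →ₐ[ℂ] B₁) (f : FormalFun d B) :
    formalMap φ f = mapFun φ.toLinearMap f := rfl

theorem commute_formalMap {φ : B →ₐ[ℂ] B₂} {ψ : B₁ →ₐ[ℂ] B₂} (h : ∀ a b, Commute (φ a) (ψ b))
    (f : FormalFun d B) (g : FormalFun d B₁) : Commute (formalMap φ f) (formalMap ψ g) :=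
  commute_of_coef fun _ _ => h _ _

variable {𝔤 : Type*} [LieRing 𝔤] [LieAlgebra ℂ 𝔤] {𝔩 : LieSubalgebra ℂ 𝔤}
  (x : Module.Basis (Fin d) ℂ 𝔩)

/-- The functions `λ ↦ λ([x_i, x_j])`. -/
def structFun (i j : Fin d) : FormalFun d ℂ := mulLin x ⁅x i, x j⁆ 1

/-- The structure constants of `𝔩`, as functions. -/
def structConst (i j k : Fin d) : FormalFun d ℂ := const d (x.repr ⁅x i, x j⁆ k)

theorem mulLin_smul_eq (y : 𝔩) (f : FormalFun d B) :
    mulLin x y (1 : FormalFun d ℂ) • f = mulLin x y f := by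
  rw [formal_smul_def, mapFun_mulLin, mulLin_mul, ← const_one, mapFun_const]
  simp

theorem structFun_smul (i j : Fin d) (f : FormalFun d B) :
    structFun x i j • f = mulLin x ⁅x i, x j⁆ f := mulLin_smul_eq x _ f

theorem const_smul_eq (a : ℂ) (f : FormalFun d B) : const d a • f = a • f := by
  rw [formal_smul_def, mapFun_const]
  refine formalFun_ext fun n => ?_
  rw [coef_const_mul, map_smul, Algebra.smul_def]
  rfl

theorem structConst_smul (i j k : Fin d) (f : FormalFun d B) :
    structConst x i j k • f = x.repr ⁅x i, x j⁆ k • f := const_smul_eq _ f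

variable (B) in
/-- The partial derivatives. -/
def partialDerivFamily : DerivationFamily (structFun x) (structConst x) (FormalFun d B) where
  D k := (partialDerivₗ k).toAddMonoidHom
  leibniz k f g := partialDeriv_mul k f g
  smul k i j f := by
    rw [structFun_smul, structConst_smul, structFun_smul]
    exact partialDeriv_mulLin x k _ f

theorem partialDerivFamily_apply (k : Fin d) (f : FormalFun d B) :
    (partialDerivFamily B x).D k f = partialDeriv k f := rfl

theorem partialDeriv_formalMap (φ : B →ₐ[ℂ] B₁) (k : Fin d) (f : FormalFun d B) :
    (partialDerivFamily B₁ x).D k (formalMap φ f) =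
      formalMap φ ((partialDerivFamily B x).D k f) := partialDeriv_mapFun k φ.toLinearMap f

theorem sum_structFun_smul (m : Fin d) (f : FormalFun d B) :
    ∑ j, structFun x m j • (partialDerivFamily B x).D j f = coadDeriv x (x m) f := by
  simp only [structFun_smul]
  rfl

theorem structFun_skew (i j : Fin d) : structFun x j i = -structFun x i j := by
  rw [structFun, structFun, ← mulLin_neg_left, lie_skew]

theorem structConst_skew (i j k : Fin d) : structConst x j i k = -structConst x i j k := by
  rw [structConst, structConst, ← map_neg, ← lie_skew, map_neg, Finsupp.neg_apply]

/-- Each sum over `k` is the linear function attached to a double bracket, so the identity is Jacobi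
in `𝔩`. -/
theorem structConst_jacobi (a b e : Fin d) :
    ∑ k, (structConst x b e k * structFun x k a - structConst x a e k * structFun x k b
      + structConst x a b k * structFun x k e) = 0 := by
  have h : ∀ (y : 𝔩) (a : Fin d), ∑ k, const d (x.repr y k) * structFun x k a =
      mulLin x ⁅y, x a⁆ 1 := by
    intro y a
    conv_rhs => rw [← x.sum_repr y, sum_lie, mulLin_sum_left]
    refine sum_congr rfl fun k _ => ?_
    rw [smul_lie, mulLin_smul_left, structFun]
    refine formalFun_ext fun n => ?_
    rw [coef_const_mul, map_smul, smul_eq_mul]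
  simp only [sum_add_distrib, sum_sub_distrib, structConst, h]
  rw [← mulLin_sub_left, ← mulLin_add_left]
  have : ⁅⁅x b, x e⁆, x a⁆ - ⁅⁅x a, x e⁆, x b⁆ + ⁅⁅x a, x b⁆, x e⁆ = 0 := by
    rw [← lie_skew ⁅x b, x e⁆ (x a), leibniz_lie (x a), ← lie_skew ⁅x a, x e⁆ (x b)]
    abel
  rw [this, mulLin_zero_left]

attribute [local instance 100] LieRing.ofAssociativeRing

/-- The basis of `𝔩`, as constant functions with values in `U(𝔤)`. -/
def basisFun (i : Fin d) : FormalFun d (U 𝔤) := const d (inc (x i : 𝔤))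

theorem basisFun_lie (i j : Fin d) : basisFun x i * basisFun x j - basisFun x j * basisFun x i =
    ∑ k, structConst x i j k • basisFun x k := by
  simp only [basisFun, ← const_mul, structConst_smul, ← map_sub, ← map_smul, ← map_sum]
  congr 1
  have h1 : ⁅(x i : 𝔤), (x j : 𝔤)⁆ = ∑ k, x.repr ⁅x i, x j⁆ k • (x k : 𝔤) := by
    have := congrArg 𝔩.toSubmodule.subtype (x.sum_repr ⁅x i, x j⁆)
    simp only [map_sum, map_smul] at this
    exact this.symm
  rw [← LieRing.of_associative_ring_bracket, ← LieHom.map_lie, h1]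

theorem gaugeRelations (u : (FormalFun d (U 𝔤))ˣ)
    (hu : ∀ y : 𝔩, coadDeriv x y (u : FormalFun d (U 𝔤)) +
      (const d (inc (y : 𝔤)) * u - u * const d (inc (y : 𝔤))) = 0) :
    GaugeRelations (partialDerivFamily (U 𝔤) x) (basisFun x) (fun i =>
      (↑u⁻¹ : FormalFun d (U 𝔤)) * partialDeriv i u) := by
  refine gaugeRelations_of_unit (𝒟 := partialDerivFamily (U 𝔤) x) u (fun i => ?_) ?_
    (structFun_skew x) (structConst_skew x) (structConst_jacobi x) (fun k i => ?_) (basisFun_lie x)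
  · rw [sum_structFun_smul]
    exact hu (x i)
  · exact fun i j f => partialDeriv_comm i j f
  · exact partialDeriv_const k (inc (x i : 𝔤))

end FormalAlgebra

/-! ### Transfer between tensors over the Lie algebra and over its enveloping algebra. -/

section Covariance

open Finset

attribute [local instance] formalAlgebra
attribute [local instance 100] LieRing.ofAssociativeRing

variable {d : ℕ} {𝔤 : Type*} [LieRing 𝔤] [LieAlgebra ℂ 𝔤]

variable (d 𝔤) in
/-- The inclusions of tensor factors for functions with values in `U(𝔤)`. -/
def formalSlots : TensorSlots
    (formalMap (d := d) (Algebra.TensorProduct.includeLeft : U 𝔤 →ₐ[ℂ] U 𝔤 ⊗[ℂ] U 𝔤))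
    (formalMap (d := d) (Algebra.TensorProduct.includeRight : U 𝔤 →ₐ[ℂ] U 𝔤 ⊗[ℂ] U 𝔤))
    (FormalFun d (U 𝔤 ⊗[ℂ] (U 𝔤 ⊗[ℂ] U 𝔤))) where
  s₁ := formalMap Algebra.TensorProduct.includeLeft
  s₂ := formalMap (Algebra.TensorProduct.includeRight.comp Algebra.TensorProduct.includeLeft)
  s₃ := formalMap (Algebra.TensorProduct.includeRight.comp Algebra.TensorProduct.includeRight)
  t₁₂ := formalMap (Algebra.TensorProduct.map (AlgHom.id ℂ _) Algebra.TensorProduct.includeLeft)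
  t₁₃ := formalMap (Algebra.TensorProduct.map (AlgHom.id ℂ _) Algebra.TensorProduct.includeRight)
  t₂₃ := formalMap Algebra.TensorProduct.includeRight
  t₁₂_l a := formalFun_ext fun n => by simp [formalMap_apply]; rfl
  t₁₂_r a := formalFun_ext fun n => by simp [formalMap_apply]
  t₁₃_l a := formalFun_ext fun n => by simp [formalMap_apply]; rfl
  t₁₃_r a := formalFun_ext fun n => by simp [formalMap_apply]
  t₂₃_l a := rfl
  t₂₃_r a := rfl
  comm₁ := commute_formalMap fun a b => by simp [Commute, SemiconjBy]
  comm₂ := commute_formalMap fun a b => by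
    induction b using TensorProduct.induction_on with
    | zero => simp
    | add y z hy hz => rw [map_add]; exact hy.add_right hz
    | tmul y z => simp [Commute, SemiconjBy]
  comm₃ := commute_formalMap fun a b => by
    induction b using TensorProduct.induction_on with
    | zero => simp
    | add y z hy hz => rw [map_add]; exact hy.add_right hz
    | tmul y z => simp [Commute, SemiconjBy]

variable (𝔤) in
/-- The canonical map `𝔤 ⊗ 𝔤 ⊗ 𝔤 → U(𝔤) ⊗ U(𝔤) ⊗ U(𝔤)`. -/
def inc₃ : 𝔤 ⊗[ℂ] (𝔤 ⊗[ℂ] 𝔤) →ₗ[ℂ] U 𝔤 ⊗[ℂ] (U 𝔤 ⊗[ℂ] U 𝔤) :=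
  TensorProduct.map (inc (𝔤 := 𝔤)).toLinearMap (inc₂ 𝔤)

@[simp] theorem inc₂_tmul (a b : 𝔤) : inc₂ 𝔤 (a ⊗ₜ b) = inc a ⊗ₜ inc b := rfl

@[simp] theorem inc₃_tmul (a : 𝔤) (t : 𝔤 ⊗[ℂ] 𝔤) : inc₃ 𝔤 (a ⊗ₜ t) = inc a ⊗ₜ inc₂ 𝔤 t := rfl

theorem inc₂_injective [FiniteDimensional ℂ 𝔤] : Function.Injective (inc₂ 𝔤) :=
  TensorProduct.map_injective_of_flat_flat _ _ (inc_injective 𝔤) (inc_injective 𝔤)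

theorem inc₃_injective [FiniteDimensional ℂ 𝔤] : Function.Injective (inc₃ 𝔤) :=
  TensorProduct.map_injective_of_flat_flat _ _ (inc_injective 𝔤) inc₂_injective

theorem inc₃_Alt (y : 𝔤) (t : 𝔤 ⊗[ℂ] 𝔤) :
    inc₃ 𝔤 (Alt 𝔤 (y ⊗ₜ t)) = (inc y ⊗ₜ 1) * (1 ⊗ₜ inc₂ 𝔤 t)
      - (1 ⊗ₜ (inc y ⊗ₜ 1)) * Algebra.TensorProduct.map (AlgHom.id ℂ (U 𝔤))
          (Algebra.TensorProduct.includeRight : U 𝔤 →ₐ[ℂ] U 𝔤 ⊗[ℂ] U 𝔤) (inc₂ 𝔤 t)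
      + (1 ⊗ₜ (1 ⊗ₜ inc y)) * Algebra.TensorProduct.map (AlgHom.id ℂ (U 𝔤))
          (Algebra.TensorProduct.includeLeft : U 𝔤 →ₐ[ℂ] U 𝔤 ⊗[ℂ] U 𝔤) (inc₂ 𝔤 t) := by
  induction t using TensorProduct.induction_on with
  | zero => simp
  | add a b ha hb =>
    simp only [TensorProduct.tmul_add, map_add, ha, hb, mul_add]
    abel
  | tmul a b =>
    rw [Alt_tmul]
    simp

theorem inc₃_bracket (s t : 𝔤 ⊗[ℂ] 𝔤) {T₁₂ T₁₃ T₂₃ : U 𝔤 ⊗[ℂ] U 𝔤 →ₐ[ℂ] U 𝔤 ⊗[ℂ] (U 𝔤 ⊗[ℂ] U 𝔤)}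
    (h₁₂ : T₁₂ = Algebra.TensorProduct.map (AlgHom.id ℂ _) Algebra.TensorProduct.includeLeft)
    (h₁₃ : T₁₃ = Algebra.TensorProduct.map (AlgHom.id ℂ _) Algebra.TensorProduct.includeRight)
    (h₂₃ : T₂₃ = Algebra.TensorProduct.includeRight) :
    inc₃ 𝔤 ((bracket1213 𝔤 + bracket1223 𝔤 + bracket1323 𝔤) (s ⊗ₜ t)) =
      (T₁₂ (inc₂ 𝔤 s) * T₁₃ (inc₂ 𝔤 t) - T₁₃ (inc₂ 𝔤 t) * T₁₂ (inc₂ 𝔤 s))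
      + (T₁₂ (inc₂ 𝔤 s) * T₂₃ (inc₂ 𝔤 t) - T₂₃ (inc₂ 𝔤 t) * T₁₂ (inc₂ 𝔤 s))
      + (T₁₃ (inc₂ 𝔤 s) * T₂₃ (inc₂ 𝔤 t) - T₂₃ (inc₂ 𝔤 t) * T₁₃ (inc₂ 𝔤 s)) := by
  induction s using TensorProduct.induction_on with
  | zero => simp
  | add a b ha hb =>
    rw [TensorProduct.add_tmul, map_add, map_add, ha, hb]
    simp only [map_add, mul_add, add_mul]
    abel
  | tmul a b =>
    induction t using TensorProduct.induction_on with
    | zero => simp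
    | add a b ha hb =>
      rw [TensorProduct.tmul_add, map_add, map_add, ha, hb]
      simp only [map_add, mul_add, add_mul]
      abel
    | tmul a' b' =>
      subst h₁₂ h₁₃ h₂₃
      simp only [LinearMap.add_apply, bracket1213_tmul, bracket1223_tmul, bracket1323_tmul,
        map_add, inc₃_tmul, inc₂_tmul, LieHom.map_lie, LieRing.of_associative_ring_bracket,
        TensorProduct.sub_tmul, TensorProduct.tmul_sub]
      simp

theorem coef_mul_sub_mul {B B' : Type*} [Ring B] [Algebra ℂ B] [Ring B'] [Algebra ℂ B']
    (φ ψ : B →ₐ[ℂ] B') (f g : FormalFun d B) (n : Fin d →₀ ℕ) :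
    coef n (formalMap φ f * formalMap ψ g - formalMap ψ g * formalMap φ f) =
      ∑ p ∈ HasAntidiagonal.antidiagonal n,
        (φ (coef p.1 f) * ψ (coef p.2 g) - ψ (coef p.2 g) * φ (coef p.1 f)) := by
  rw [mul_eq_conv, mul_eq_conv, ← conv_flip _ (formalMap ψ g), map_sub, sum_sub_distrib]
  rfl

variable {𝔩 : LieSubalgebra ℂ 𝔤} (x : Module.Basis (Fin d) ℂ 𝔩)

theorem formalMap_const {B B' : Type*} [Ring B] [Algebra ℂ B] [Ring B'] [Algebra ℂ B']
    (φ : B →ₐ[ℂ] B') (b : B) : formalMap φ (const d b) = const d (φ b) :=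
  mapFun_const φ.toLinearMap b

theorem coef_formalMap_const_mul {B B' : Type*} [Ring B] [Algebra ℂ B] [Ring B'] [Algebra ℂ B']
    (φ : B →ₐ[ℂ] B') (b : B) (f : FormalFun d B') (n : Fin d →₀ ℕ) :
    coef n (formalMap φ (const d b) * f) = φ b * coef n f := by
  rw [formalMap_const, coef_const_mul]

theorem coef_partialDerivFamily_formalMap_inc₂ {B : Type*} [Ring B] [Algebra ℂ B]
    (φ : U 𝔤 ⊗[ℂ] U 𝔤 →ₐ[ℂ] B) (r : FormalFun d (𝔤 ⊗[ℂ] 𝔤)) (k : Fin d) (n : Fin d →₀ ℕ) :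
    coef n ((partialDerivFamily B x).D k (formalMap φ (mapFun (inc₂ 𝔤) r))) =
      φ (inc₂ 𝔤 (coef n (partialDeriv k r))) := by
  rw [partialDerivFamily_apply, formalMap_apply, partialDeriv_mapFun, partialDeriv_mapFun]
  rfl

/-- In each Yang-Baxter bracket the two tensors share one slot, so the Lie bracket there becomes a
commutator in the tensor cube of `U(𝔤)`. -/
theorem cdybeSlots_inc₂ (r : FormalFun d (𝔤 ⊗[ℂ] 𝔤)) :
    cdybeSlots (formalSlots d 𝔤) (partialDerivFamily _ x) (basisFun x) (mapFun (inc₂ 𝔤) r) =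
      mapFun (inc₃ 𝔤) (mapFun (Alt 𝔤) (dBar x r) + CYB r) := by
  refine formalFun_ext fun n => ?_
  rw [cdybeSlots, coef_mapFun, map_add (coef n), map_add (coef n) (mapFun _ _) (CYB r),
    map_add (inc₃ 𝔤)]
  refine congrArg₂ (· + ·) ?_ ?_
  · rw [coef_mapFun, dBar, coef_ofCoef]
    simp only [map_add, map_sub, map_sum, inc₃_Alt, sum_add_distrib, sum_sub_distrib]
    refine congrArg₂ (· + ·) (congrArg₂ (· - ·) ?_ ?_) ?_ <;>
    · refine sum_congr rfl fun k _ => ?_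
      refine (coef_formalMap_const_mul _ _ _ n).trans (congrArg₂ (· * ·) ?_ ?_)
      · rfl
      · exact coef_partialDerivFamily_formalMap_inc₂ x _ r k n
  · rw [CYB, coef_ofCoef, map_sum, map_add (coef n), map_add (coef n)]
    simp only [inc₃_bracket _ _ rfl rfl rfl, sum_add_distrib]
    exact congrArg₂ (· + ·) (congrArg₂ (· + ·) (coef_mul_sub_mul _ _ _ _ _)
      (coef_mul_sub_mul _ _ _ _ _)) (coef_mul_sub_mul _ _ _ _ _)

theorem inc₂_lie (y : 𝔤) (t : 𝔤 ⊗[ℂ] 𝔤) :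
    inc₂ 𝔤 ⁅y, t⁆ =
      (inc y ⊗ₜ 1 + 1 ⊗ₜ inc y) * inc₂ 𝔤 t - inc₂ 𝔤 t * (inc y ⊗ₜ 1 + 1 ⊗ₜ inc y) := by
  induction t using TensorProduct.induction_on with
  | zero => simp
  | add a b ha hb =>
    rw [lie_add, map_add, ha, hb, map_add]
    noncomm_ring
  | tmul a b =>
    rw [TensorProduct.LieModule.lie_tmul_right, map_add, inc₂_tmul, inc₂_tmul, inc₂_tmul,
      LieHom.map_lie, LieHom.map_lie, LieRing.of_associative_ring_bracket,
      LieRing.of_associative_ring_bracket, TensorProduct.sub_tmul, TensorProduct.tmul_sub]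
    simp [add_mul, mul_add]
    abel

theorem coadDeriv_sum_left {V : Type*} [AddCommGroup V] [Module ℂ V] (y : 𝔩) (f : FormalFun d V) :
    coadDeriv x y f = ∑ m, x.repr y m • coadDeriv x (x m) f := by
  conv_lhs => rw [coadDeriv, ← x.sum_repr y]
  simp only [sum_lie, smul_lie, mulLin_sum_left, mulLin_smul_left]
  rw [sum_comm]
  simp only [coadDeriv, smul_sum]

/-- Equivariance may be tested on a basis. -/
theorem isEquivariant_iff_basis {V : Type*} [AddCommGroup V] [Module ℂ V] {act : 𝔩 → V → V}
    (L : 𝔩 →ₗ[ℂ] V →ₗ[ℂ] V) (hL : ∀ y v, act y v = L y v) (f : FormalFun d V) :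
    IsEquivariant x act f ↔ ∀ m, coadDeriv x (x m) f + mapFun (L (x m)) f = 0 := by
  rw [isEquivariant_iff x (fun y => L y) hL]
  refine ⟨fun h m => h _, fun h y => ?_⟩
  have h1 : mapFun (L y) f = ∑ m, x.repr y m • mapFun (L (x m)) f := by
    conv_lhs => rw [← x.sum_repr y]
    refine formalFun_ext fun n => ?_
    simp only [map_sum, map_smul, LinearMap.sum_apply, LinearMap.smul_apply, coef_mapFun]
  rw [coadDeriv_sum_left, h1, ← sum_add_distrib]
  exact sum_eq_zero fun m _ => by rw [← smul_add, h, smul_zero]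

/-- The adjoint action on `𝔤 ⊗ 𝔤`. -/
def adTensor (𝔩 : LieSubalgebra ℂ 𝔤) : 𝔩 →ₗ[ℂ] (𝔤 ⊗[ℂ] 𝔤) →ₗ[ℂ] 𝔤 ⊗[ℂ] 𝔤 :=
  (LieModule.toEnd ℂ 𝔤 (𝔤 ⊗[ℂ] 𝔤) : 𝔤 →ₗ[ℂ] Module.End ℂ _) ∘ₗ 𝔩.toSubmodule.subtype

theorem isEquivariant_adTensor_iff (r : FormalFun d (𝔤 ⊗[ℂ] 𝔤)) :
    IsEquivariant x (fun y t => ⁅(y : 𝔤), t⁆) r ↔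
      ∀ m, coadDeriv x (x m) r + mapFun (adTensor 𝔩 (x m)) r = 0 :=
  isEquivariant_iff_basis x (adTensor 𝔩) (fun _ _ => rfl) r

theorem twistedDeriv_inc₂ (m : Fin d) (r : FormalFun d (𝔤 ⊗[ℂ] 𝔤)) :
    twistedDeriv (partialDerivFamily (U 𝔤 ⊗[ℂ] U 𝔤) x) m
      (formalMap Algebra.TensorProduct.includeLeft (basisFun x m)
        + formalMap Algebra.TensorProduct.includeRight (basisFun x m)) (mapFun (inc₂ 𝔤) r) =
    mapFun (inc₂ 𝔤) (coadDeriv x (x m) r + mapFun (adTensor 𝔩 (x m)) r) := by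
  rw [twistedDeriv_apply, sum_structFun_smul, coadDeriv_mapFun]
  have : formalMap Algebra.TensorProduct.includeLeft (basisFun x m)
        + formalMap Algebra.TensorProduct.includeRight (basisFun x m) =
      const d (inc (x m : 𝔤) ⊗ₜ[ℂ] (1 : U 𝔤) + (1 : U 𝔤) ⊗ₜ[ℂ] inc (x m : 𝔤)) := by
    rw [map_add, formalMap_apply, formalMap_apply, basisFun, mapFun_const, mapFun_const]
    rfl
  rw [this]
  refine formalFun_ext fun n => ?_
  rw [map_add, map_sub, coef_const_mul, coef_mul_const, coef_mapFun, coef_mapFun, coef_mapFun,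
    map_add, map_add, ← inc₂_lie]
  rfl

/-- Gauge transformations preserve the equivariance and the classical dynamical Yang-Baxter
equation. -/
theorem gauge_isEquivariant_and_cdybe [FiniteDimensional ℂ 𝔤] (u : (FormalFun d (U 𝔤))ˣ)
    (hu : ∀ y : 𝔩, coadDeriv x y (u : FormalFun d (U 𝔤)) +
      (const d (inc (y : 𝔤)) * u - u * const d (inc (y : 𝔤))) = 0)
    {r s : FormalFun d (𝔤 ⊗[ℂ] 𝔤)}
    (hs : mapFun (inc₂ 𝔤) s * (formalMap Algebra.TensorProduct.includeLeft (u : FormalFun d (U 𝔤))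
        * formalMap Algebra.TensorProduct.includeRight (u : FormalFun d (U 𝔤))) =
      formalMap Algebra.TensorProduct.includeLeft (u : FormalFun d (U 𝔤))
        * formalMap Algebra.TensorProduct.includeRight (u : FormalFun d (U 𝔤)) *
      (mapFun (inc₂ 𝔤) r + gaugeTerm (structFun x) (basisFun x)
        (fun i => (↑u⁻¹ : FormalFun d (U 𝔤)) * partialDeriv i u)
        (formalMap Algebra.TensorProduct.includeLeft)
        (formalMap Algebra.TensorProduct.includeRight)))
    (hr₁ : IsEquivariant x (fun y t => ⁅(y : 𝔤), t⁆) r)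
    (hr₂ : mapFun (Alt 𝔤) (dBar x r) + CYB r = 0) :
    IsEquivariant x (fun y t => ⁅(y : 𝔤), t⁆) s ∧ mapFun (Alt 𝔤) (dBar x s) + CYB s = 0 := by
  have h := gaugeRelations x u hu
  have hl := partialDeriv_formalMap x (Algebra.TensorProduct.includeLeft : U 𝔤 →ₐ[ℂ] U 𝔤 ⊗[ℂ] U 𝔤)
  have hr := partialDeriv_formalMap x (Algebra.TensorProduct.includeRight : U 𝔤 →ₐ[ℂ] U 𝔤 ⊗[ℂ] U 𝔤)
  have hlr : ∀ a b : FormalFun d (U 𝔤),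
      Commute (formalMap (Algebra.TensorProduct.includeLeft : U 𝔤 →ₐ[ℂ] U 𝔤 ⊗[ℂ] U 𝔤) a)
        (formalMap (Algebra.TensorProduct.includeRight : U 𝔤 →ₐ[ℂ] U 𝔤 ⊗[ℂ] U 𝔤) b) :=
    commute_formalMap fun a b => by simp [Commute, SemiconjBy]
  have hS : ∀ m, twistedDeriv (partialDerivFamily (U 𝔤 ⊗[ℂ] U 𝔤) x) m
      (formalMap Algebra.TensorProduct.includeLeft (basisFun x m)
        + formalMap Algebra.TensorProduct.includeRight (basisFun x m)) (mapFun (inc₂ 𝔤) r) = 0 := by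
    intro m
    rw [twistedDeriv_inc₂, (isEquivariant_adTensor_iff x r).1 hr₁ m]
    exact map_zero (mapFunₗ (inc₂ 𝔤))
  have hxu : ∀ m, basisFun x m * (u : FormalFun d (U 𝔤)) = u * adBasis (structFun x) (basisFun x)
      (fun i => (↑u⁻¹ : FormalFun d (U 𝔤)) * partialDeriv i u) m := fun m =>
    mul_eq_mul_adBasis (𝒟 := partialDerivFamily (U 𝔤) x) u
      (fun i => by rw [sum_structFun_smul]; exact hu (x i)) m
  constructor
  · rw [isEquivariant_adTensor_iff]
    intro m
    apply mapFun_injective (inc₂_injective (𝔤 := 𝔤))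
    rw [← twistedDeriv_inc₂]
    -- The element `u ⊗ u` is invariant because `u` is. Applying the derivation to `hs` therefore
    -- leaves only its action on `s`, multiplied by a unit.
    have hU : twistedDeriv (partialDerivFamily (U 𝔤 ⊗[ℂ] U 𝔤) x) m
        (formalMap Algebra.TensorProduct.includeLeft (basisFun x m)
          + formalMap Algebra.TensorProduct.includeRight (basisFun x m))
        (formalMap Algebra.TensorProduct.includeLeft (u : FormalFun d (U 𝔤))
        * formalMap Algebra.TensorProduct.includeRight (u : FormalFun d (U 𝔤))) = 0 := by
      rw [twistedDeriv_mul, twistedDeriv_left hl hlr, twistedDeriv_right hr hlr,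
        twistedDeriv_apply, sum_structFun_smul]
      change formalMap _ (coadDeriv x (x m) (u : FormalFun d (U 𝔤)) +
        (const d (inc (x m : 𝔤)) * (u : FormalFun d (U 𝔤)) - (u : FormalFun d (U 𝔤)) *
          const d (inc (x m : 𝔤)))) * _ + _ *
        formalMap _ (coadDeriv x (x m) (u : FormalFun d (U 𝔤)) +
        (const d (inc (x m : 𝔤)) * (u : FormalFun d (U 𝔤)) - (u : FormalFun d (U 𝔤)) *
          const d (inc (x m : 𝔤)))) = 0
      rw [hu]
      simp only [map_zero, zero_mul, mul_zero, add_zero]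
    have e := congrArg (twistedDeriv (partialDerivFamily (U 𝔤 ⊗[ℂ] U 𝔤) x) m
        (formalMap Algebra.TensorProduct.includeLeft (basisFun x m)
          + formalMap Algebra.TensorProduct.includeRight (basisFun x m))) hs
    rw [twistedDeriv_mul _ _ (mapFun (inc₂ 𝔤) s), hU,
      twistedDeriv_mul _ _ _ (mapFun (inc₂ 𝔤) r + _), hU, mul_zero, zero_mul, add_zero, zero_add,
      map_add, hS, twistedDeriv_apply (T := gaugeTerm _ _ _ _ _), gaugeTerm_equivariant h hl hr hlr,
      add_zero, mul_zero] at e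
    have e2 := ((Units.map (formalMap (d := d) (Algebra.TensorProduct.includeLeft :
        U 𝔤 →ₐ[ℂ] U 𝔤 ⊗[ℂ] U 𝔤)).toRingHom.toMonoidHom u) * (Units.map (formalMap (d := d)
        (Algebra.TensorProduct.includeRight : U 𝔤 →ₐ[ℂ] U 𝔤 ⊗[ℂ] U 𝔤)).toRingHom.toMonoidHom
        u)).isUnit.mul_left_eq_zero.1 e
    rw [e2]
    exact (map_zero (mapFunₗ (inc₂ 𝔤))).symm
  · apply mapFun_injective (inc₃_injective (𝔤 := 𝔤))
    rw [← cdybeSlots_inc₂]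
    have e := cdybeSlots_gauge (formalSlots d 𝔤) h hl hr (ℰ := partialDerivFamily _ x)
      (partialDeriv_formalMap x _) (partialDeriv_formalMap x _) (partialDeriv_formalMap x _) hlr hS
      hs (fun i => by rw [← mul_assoc, Units.mul_inv, one_mul]; rfl) hxu
    have hz : mapFun (inc₃ 𝔤) (0 : FormalFun d (𝔤 ⊗[ℂ] (𝔤 ⊗[ℂ] 𝔤))) = 0 :=
      map_zero (mapFunₗ (inc₃ 𝔤))
    rw [cdybeSlots_inc₂ x r, hr₂, hz, mul_zero] at e
    rw [hz]
    exact ((Units.map (formalSlots d 𝔤).s₁.toRingHom.toMonoidHom u) *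
      (Units.map (formalSlots d 𝔤).s₂.toRingHom.toMonoidHom u) *
      (Units.map (formalSlots d 𝔤).s₃.toRingHom.toMonoidHom u)).isUnit.mul_left_eq_zero.1 e

end Covariance

/-! ### Functions with values in a subspace -/

section ValuedIn

open Finset

variable {d : ℕ} {V W : Type*} [AddCommGroup V] [Module ℂ V] [AddCommGroup W] [Module ℂ W]

/-- The functions with values in a subspace. -/
def valuedIn (P : Submodule ℂ V) : Submodule ℂ (FormalFun d V) where
  carrier := {f | ∀ n, coef n f ∈ P}
  add_mem' hf hg n := P.add_mem (hf n) (hg n)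
  zero_mem' _ := P.zero_mem
  smul_mem' c _ hf n := P.smul_mem c (hf n)

theorem mem_valuedIn_range {L : V →ₗ[ℂ] W} {f : FormalFun d W} :
    f ∈ valuedIn (LinearMap.range L) ↔ ∃ F, f = mapFun L F := by
  constructor
  · intro h
    choose F hF using h
    exact ⟨ofCoef F, formalFun_ext fun n => (hF n).symm⟩
  · rintro ⟨F, rfl⟩ n
    exact ⟨coef n F, rfl⟩

theorem const_mem_valuedIn {P : Submodule ℂ V} {v : V} (hv : v ∈ P) :
    const d v ∈ valuedIn P := fun n => by
  rw [coef_const]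
  split_ifs
  exacts [hv, P.zero_mem]

theorem partialDeriv_mem_valuedIn {P : Submodule ℂ V} (i : Fin d) {f : FormalFun d V}
    (hf : f ∈ valuedIn P) : partialDeriv i f ∈ valuedIn P := fun n => by
  rw [coef_partialDeriv]
  exact P.smul_mem _ (hf _)

attribute [local instance] formalAlgebra

theorem coef_formal_smul {B : Type*} [Ring B] [Algebra ℂ B] (a : FormalFun d ℂ)
    (f : FormalFun d B) (n : Fin d →₀ ℕ) :
    coef n (a • f) = ∑ p ∈ HasAntidiagonal.antidiagonal n, coef p.1 a • coef p.2 f := by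
  rw [formal_smul_def, mul_eq_conv, coef_conv]
  refine sum_congr rfl fun p _ => ?_
  rw [Algebra.smul_def]
  rfl

theorem smul_mem_valuedIn {B : Type*} [Ring B] [Algebra ℂ B] {P : Submodule ℂ B}
    (a : FormalFun d ℂ) {f : FormalFun d B} (hf : f ∈ valuedIn P) : a • f ∈ valuedIn P := by
  intro n
  rw [coef_formal_smul]
  exact P.sum_mem fun p _ => P.smul_mem _ (hf _)

/-- Writing a function as a combination of constants over `ℂ[[x]]` reduces `ℂ[[x]]`-linear
statements to constant functions. -/
theorem mapFun_eq_sum_basis {ι B : Type*} [Fintype ι] [Ring B] [Algebra ℂ B]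
    (b : Module.Basis ι ℂ V) (L : V →ₗ[ℂ] B) (F : FormalFun d V) :
    mapFun L F = ∑ i, mapFun (b.coord i) F • const d (L (b i)) := by
  refine formalFun_ext fun n => ?_
  have h : ∀ i, coef n (mapFun (b.coord i) F • const d (L (b i))) =
      b.repr (coef n F) i • L (b i) := by
    intro i
    rw [formal_smul_def, mapFun_mapFun, coef_mul_const, coef_mapFun, Algebra.smul_def]
    rfl
  rw [map_sum, coef_mapFun, sum_congr rfl fun i _ => h i]
  conv_lhs => rw [← b.sum_repr (coef n F)]
  simp only [map_sum, map_smul]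

end ValuedIn

/-! ### Exponentials of homogeneous functions -/

section EulerEquation

open Finset

variable {d : ℕ} {V B : Type*} [AddCommGroup V] [Module ℂ V] [Ring B] [Algebra ℂ B]

theorem mem_ordGE_of_euler {m : ℕ} {f : FormalFun d V} (h0 : coef 0 f = 0)
    (h : euler f ∈ ordGE V m) : f ∈ ordGE V m := fun n hn => by
  rcases eq_or_ne n 0 with rfl | h1
  · exact h0
  · have h2 := h n hn
    rw [coef_euler] at h2
    refine (smul_eq_zero.1 h2).resolve_left ?_
    rwa [Nat.cast_eq_zero, Finsupp.degree_eq_zero_iff]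

theorem mem_ordGE_of_homogeneous {c : ℕ} {f : FormalFun d V} (h : euler f = (c : ℂ) • f) :
    f ∈ ordGE V c := fun n hn => by
  have h1 := congrArg (coef n) h
  rw [coef_euler, map_smul, ← sub_eq_zero, ← sub_smul] at h1
  refine (smul_eq_zero.1 h1).resolve_left ?_
  rw [sub_eq_zero, Nat.cast_inj]
  exact hn.ne

/-- `E - c` is injective above degree `c`, which is why the order must exceed `c` at the start. -/
theorem eq_zero_of_euler_sub {c : ℕ} {f : FormalFun d V} (h0 : f ∈ ordGE V (c + 1))
    (h : ∀ m, f ∈ ordGE V m → euler f - (c : ℂ) • f ∈ ordGE V (m + 1)) : f = 0 := by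
  have key : ∀ m, f ∈ ordGE V (c + 1 + m) := by
    intro m
    induction m with
    | zero => exact h0
    | succ m ih =>
      intro n hn
      rcases lt_or_ge n.degree (c + 1 + m) with h2 | h2
      · exact ih n h2
      have h1 := h _ ih n hn
      rw [map_sub, map_smul, coef_euler, ← sub_smul] at h1
      refine (smul_eq_zero.1 h1).resolve_left ?_
      rw [sub_eq_zero, Nat.cast_inj]
      omega
  exact eq_of_sub_mem_ordGE fun m => by
    rw [sub_zero]
    exact ordGE_mono (Nat.le_add_left m _) (key m)

/-- Uniqueness for the radial equation of an exponential: the difference of two solutions gains one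
order each time the equation is applied. -/
theorem eq_of_euler_mul {φ f g : FormalFun d B} (hφ : φ ∈ ordGE B 1) (hf : euler f = φ * f)
    (hg : euler g = φ * g) (h0 : coef 0 f = coef 0 g) : f = g := by
  rw [← sub_eq_zero]
  refine eq_zero_of_euler 0 _ (fun _ => by rw [map_sub, h0, sub_self]) fun m hm => ?_
  rw [map_sub, hf, hg, ← mul_sub, Nat.cast_zero, zero_smul, add_zero]
  exact mul_mem_ordGE hφ hm (by omega)

theorem exists_euler_mul {φ : FormalFun d B} (hφ : φ ∈ ordGE B 1) :
    ∃ h : FormalFun d B, coef 0 h = 1 ∧ euler h = φ * h := by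
  -- In degree `0` the operator `eulerInv 0` multiplies by `0⁻¹ = 0`, so the fixed point has
  -- constant term `1`.
  obtain ⟨h, hh⟩ := exists_fixedPoint (fun F => 1 + eulerInv 0 (φ * F)) fun m F G hFG => by
    rw [add_sub_add_left_eq_sub, ← map_sub, ← mul_sub]
    exact eulerInv_mem_ordGE _ (mul_mem_ordGE hφ hFG (by omega))
  have hn : ∀ n, coef n h = coef n (const d (1 : B)) + ((n.degree : ℂ) + 0)⁻¹ • coef n (φ * h) := by
    intro n
    conv_lhs => rw [← hh]
    rw [map_add, coef_eulerInv, const_one]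
  have h0 : coef 0 (φ * h) = 0 := mem_ordGE_one.1 (mul_mem_ordGE_left hφ h)
  refine ⟨h, by rw [hn, h0, smul_zero, add_zero, coef_zero_const], formalFun_ext fun n => ?_⟩
  rw [coef_euler]
  rcases eq_or_ne n 0 with rfl | h1
  · rw [h0]; simp
  · rw [hn, coef_const, if_neg h1, zero_add, add_zero, smul_smul, mul_inv_cancel₀, one_smul]
    rw [Nat.cast_ne_zero]
    rwa [ne_eq, Finsupp.degree_eq_zero_iff]

theorem isUnit_of_coef_zero {h : FormalFun d B} (h0 : coef 0 h = 1) : IsUnit h := by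
  rw [MvPowerSeries.isUnit_iff_constantCoeff]
  exact (congrArg IsUnit h0).mpr isUnit_one

/-- The exponential of `(c + 1)⁻¹ φ`, for a homogeneous function `φ` of degree `c + 1`. -/
theorem exists_exp {c : ℕ} {φ : FormalFun d B} (hφ : euler φ = ((c + 1 : ℕ) : ℂ) • φ) :
    ∃ h : (FormalFun d B)ˣ, coef 0 (h : FormalFun d B) = 1 ∧ euler (h : FormalFun d B) = φ * h ∧
      φ * h = h * φ ∧ (h : FormalFun d B) - (1 + ((c + 1 : ℕ) : ℂ)⁻¹ • φ) ∈ ordGE B (c + 2) := by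
  have h1 := mem_ordGE_of_homogeneous hφ
  have hφ1 : φ ∈ ordGE B 1 := ordGE_mono (by omega) h1
  obtain ⟨h, h0, hh⟩ := exists_euler_mul hφ1
  obtain ⟨h, rfl⟩ := isUnit_of_coef_zero h0
  have e1 : euler (1 : FormalFun d B) = 0 := by rw [← const_one, euler_const]
  have c1 : coef 0 (1 : FormalFun d B) = 1 := by rw [← const_one, coef_zero_const]
  have h2 : (h : FormalFun d B) - 1 ∈ ordGE B (c + 1) := by
    refine mem_ordGE_of_euler (by rw [map_sub, h0, c1, sub_self]) ?_
    rw [map_sub, e1, sub_zero, hh]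
    exact mul_mem_ordGE_left h1 _
  refine ⟨h, h0, hh, ?_, ?_⟩
  · rw [← sub_eq_zero]
    -- The commutator `ψ = φ h - h φ` solves `E ψ - (c + 1) ψ = φ ψ`. It starts above degree `c + 1`
    -- because `h - 1` itself has order `c + 1`.
    refine eq_zero_of_euler_sub (c := c + 1) ?_ fun m hm => ?_
    · have : φ * (h : FormalFun d B) - (h : FormalFun d B) * φ =
        φ * (h - 1) - (h - 1) * φ := by noncomm_ring
      rw [this]
      exact Submodule.sub_mem _ (mul_mem_ordGE h1 h2 (by omega)) (mul_mem_ordGE h2 h1 (by omega))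
    · have : euler (φ * (h : FormalFun d B) - (h : FormalFun d B) * φ)
          - ((c + 1 : ℕ) : ℂ) • (φ * (h : FormalFun d B) - (h : FormalFun d B) * φ) =
          φ * (φ * h - h * φ) := by
        rw [map_sub, euler_mul, euler_mul, hφ, hh, smul_sub, smul_mul_assoc, mul_smul_comm]
        noncomm_ring
      rw [this]
      exact mul_mem_ordGE hφ1 hm (by omega)
  · refine mem_ordGE_of_euler ?_ ?_
    · rw [map_sub, map_add, map_smul, h0, c1, mem_ordGE_one.1 hφ1, smul_zero, add_zero, sub_self]
    · have : euler ((h : FormalFun d B) - (1 + ((c + 1 : ℕ) : ℂ)⁻¹ • φ)) =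
          φ * ((h : FormalFun d B) - 1) := by
        rw [map_sub, map_add, e1, map_smul, hφ, hh, smul_smul, inv_mul_cancel₀, one_smul, zero_add,
          mul_sub, mul_one]
        exact_mod_cast Nat.succ_ne_zero c
      rw [this]
      exact mul_mem_ordGE h1 h2 (by omega)

theorem euler_inv {φ : FormalFun d B} {h : (FormalFun d B)ˣ}
    (hh : euler (h : FormalFun d B) = φ * (h : FormalFun d B))
    (hc : φ * (h : FormalFun d B) = h * φ) : euler (↑h⁻¹ : FormalFun d B) = -(φ * ↑h⁻¹) := by
  have h1 : euler ((↑h⁻¹ : FormalFun d B) * (h : FormalFun d B)) = 0 := by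
    rw [Units.inv_mul, ← const_one, euler_const]
  rw [euler_mul, hh, hc, ← mul_assoc, Units.inv_mul, one_mul] at h1
  rw [eq_neg_iff_add_eq_zero]
  calc _ = (euler (↑h⁻¹ : FormalFun d B) * (h : FormalFun d B) + φ) *
        (↑h⁻¹ : FormalFun d B) := by
        rw [add_mul, mul_assoc, Units.mul_inv, mul_one]
    _ = 0 := by rw [h1, zero_mul]

/-- Values of solutions of equations `E Y + c Y = ζ + [φ, Y]`. -/
theorem mem_valuedIn_of_euler_lie {P : Submodule ℂ B} (hP : ∀ a ∈ P, ∀ b ∈ P, a * b - b * a ∈ P)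
    (c : ℕ) {φ ζ Y : FormalFun d B} (hφ1 : φ ∈ ordGE B 1) (hφ : φ ∈ valuedIn P)
    (hζ : ζ ∈ valuedIn P) (h : euler Y + (c : ℂ) • Y = ζ + (φ * Y - Y * φ)) (h0 : coef 0 Y ∈ P) :
    Y ∈ valuedIn P := by
  refine coef_mem_of_euler P c Y h0 fun n _ ih => ?_
  rw [h, map_add]
  refine P.add_mem (hζ n) ?_
  rw [mul_eq_conv, mul_eq_conv, ← conv_flip _ Y, map_sub, coef_conv, coef_conv,
    ← sum_sub_distrib]
  refine P.sum_mem fun p hp => ?_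
  change coef p.1 φ * coef p.2 Y - coef p.2 Y * coef p.1 φ ∈ P
  -- As `φ` has no constant term, only coefficients of `Y` of lower degree enter.
  rcases eq_or_ne p.1 0 with h2 | h2
  · rw [h2, mem_ordGE_one.1 hφ1, zero_mul, mul_zero, sub_zero]
    exact P.zero_mem
  · refine hP _ (hφ _) _ (ih _ ?_)
    rw [HasAntidiagonal.mem_antidiagonal] at hp
    have h3 := congrArg Finsupp.degree hp
    rw [map_add] at h3
    have : p.1.degree ≠ 0 := by rwa [ne_eq, Finsupp.degree_eq_zero_iff]
    omega

end EulerEquation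

/-! ### Gauge transformations -/

section Gauge

open Finset

attribute [local instance] formalAlgebra
attribute [local instance 100] LieRing.ofAssociativeRing

variable {d : ℕ} {𝔤 : Type*} [LieRing 𝔤] [LieAlgebra ℂ 𝔤]

variable (d 𝔤) in
/-- The functions with values in `𝔤`, viewed in `U(𝔤)[[x]]`. -/
abbrev lieFun : Submodule ℂ (FormalFun d (U 𝔤)) :=
  valuedIn (LinearMap.range (inc (𝔤 := 𝔤)).toLinearMap)

variable (d 𝔤) in
/-- `f ↦ f ⊗ 1`. -/
abbrev formalLeft : FormalFun d (U 𝔤) →ₐ[FormalFun d ℂ] FormalFun d (U 𝔤 ⊗[ℂ] U 𝔤) :=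
  formalMap Algebra.TensorProduct.includeLeft

variable (d 𝔤) in
/-- `f ↦ 1 ⊗ f`. -/
abbrev formalRight : FormalFun d (U 𝔤) →ₐ[FormalFun d ℂ] FormalFun d (U 𝔤 ⊗[ℂ] U 𝔤) :=
  formalMap Algebra.TensorProduct.includeRight

theorem formalLeft_commute_formalRight (a b : FormalFun d (U 𝔤)) :
    Commute (formalLeft d 𝔤 a) (formalRight d 𝔤 b) :=
  commute_formalMap (fun a b => by simp [Commute, SemiconjBy]) a b

theorem lie_mem_range_inc : ∀ a ∈ LinearMap.range (inc (𝔤 := 𝔤)).toLinearMap,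
    ∀ b ∈ LinearMap.range (inc (𝔤 := 𝔤)).toLinearMap,
    a * b - b * a ∈ LinearMap.range (inc (𝔤 := 𝔤)).toLinearMap := by
  rintro _ ⟨a, rfl⟩ _ ⟨b, rfl⟩
  exact ⟨⁅a, b⁆, (inc (𝔤 := 𝔤)).map_lie a b⟩

variable {𝔩 : LieSubalgebra ℂ 𝔤} (x : Module.Basis (Fin d) ℂ 𝔩)

/-- The equivariant formal maps from `D` to a Lie group with Lie algebra `𝔤`, with value `1` at
`0`. -/
structure IsGauge (u : (FormalFun d (U 𝔤))ˣ) : Prop where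
  coef_zero : coef 0 (u : FormalFun d (U 𝔤)) = 1
  groupLike : formalMap (coproduct 𝔤) (u : FormalFun d (U 𝔤)) =
    formalLeft d 𝔤 u * formalRight d 𝔤 u
  equivariant : ∀ y : 𝔩, coadDeriv x y (u : FormalFun d (U 𝔤)) +
    (const d (inc (y : 𝔤)) * u - u * const d (inc (y : 𝔤))) = 0
  -- These last three conditions keep gauge transforms inside `𝔤 ⊗ 𝔤`. They are carried through the
  -- induction and hold for exponentials and products.
  conj_mem : ∀ f ∈ lieFun d 𝔤, u * f * ↑u⁻¹ ∈ lieFun d 𝔤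
  inv_conj_mem : ∀ f ∈ lieFun d 𝔤, ↑u⁻¹ * f * u ∈ lieFun d 𝔤
  logDeriv_mem : ∀ i, ↑u⁻¹ * partialDeriv i (u : FormalFun d (U 𝔤)) ∈ lieFun d 𝔤

theorem IsGauge.one : IsGauge x (1 : (FormalFun d (U 𝔤))ˣ) where
  coef_zero := by rw [Units.val_one, ← const_one, coef_zero_const]
  groupLike := by simp only [Units.val_one, map_one, mul_one]
  equivariant y := by
    rw [Units.val_one, mul_one, one_mul, sub_self, add_zero, ← const_one, coadDeriv_const]
  conj_mem f hf := by simpa using hf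
  inv_conj_mem f hf := by simpa using hf
  logDeriv_mem i := by
    rw [Units.val_one, ← const_one, partialDeriv_const, mul_zero]
    exact Submodule.zero_mem _

theorem logDeriv_mul {B : Type*} [Ring B] [Algebra ℂ B] (h u : (FormalFun d B)ˣ) (i : Fin d) :
    (↑(h * u)⁻¹ : FormalFun d B) * partialDeriv i (↑(h * u) : FormalFun d B) =
      ↑u⁻¹ * (↑h⁻¹ * partialDeriv i (h : FormalFun d B)) * u
        + ↑u⁻¹ * partialDeriv i (u : FormalFun d B) := by
  rw [mul_inv_rev, Units.val_mul, Units.val_mul, partialDeriv_mul, mul_add]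
  congr 1
  · noncomm_ring
  · rw [mul_assoc, ← mul_assoc (↑h⁻¹ : FormalFun d B), Units.inv_mul, one_mul]

variable {x} in
theorem IsGauge.mul {h u : (FormalFun d (U 𝔤))ˣ} (hh : IsGauge x h) (hu : IsGauge x u) :
    IsGauge x (h * u) where
  coef_zero := by rw [Units.val_mul, coef_zero_mul, hh.coef_zero, hu.coef_zero, mul_one]
  groupLike := by
    have := (formalLeft_commute_formalRight (u : FormalFun d (U 𝔤)) h).eq
    simp only [Units.val_mul, map_mul, hh.groupLike, hu.groupLike]
    rw [mul_assoc, ← mul_assoc (formalRight d 𝔤 h), ← this]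
    noncomm_ring
  equivariant y := by
    have h1 := hh.equivariant y
    have h2 := hu.equivariant y
    rw [Units.val_mul, coadDeriv_mul]
    calc _ = (coadDeriv x y (h : FormalFun d (U 𝔤)) +
            (const d (inc (y : 𝔤)) * h - h * const d (inc (y : 𝔤)))) * u
          + h * (coadDeriv x y (u : FormalFun d (U 𝔤)) +
            (const d (inc (y : 𝔤)) * u - u * const d (inc (y : 𝔤)))) := by noncomm_ring
      _ = 0 := by rw [h1, h2, zero_mul, mul_zero, add_zero]
  conj_mem f hf := by
    have := hh.conj_mem _ (hu.conj_mem f hf)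
    rw [mul_inv_rev, Units.val_mul, Units.val_mul]
    convert this using 1
    noncomm_ring
  inv_conj_mem f hf := by
    have := hu.inv_conj_mem _ (hh.inv_conj_mem f hf)
    rw [mul_inv_rev, Units.val_mul, Units.val_mul]
    convert this using 1
    noncomm_ring
  logDeriv_mem i := by
    rw [logDeriv_mul]
    exact Submodule.add_mem _ (hu.inv_conj_mem _ (hh.logDeriv_mem i)) (hu.logDeriv_mem i)

theorem conj_mem_lieFun_of_const [FiniteDimensional ℂ 𝔤] {h k : FormalFun d (U 𝔤)}
    (H : ∀ y : 𝔤, h * const d (inc y) * k ∈ lieFun d 𝔤) {f : FormalFun d (U 𝔤)}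
    (hf : f ∈ lieFun d 𝔤) : h * f * k ∈ lieFun d 𝔤 := by
  obtain ⟨F, rfl⟩ := mem_valuedIn_range.1 hf
  rw [mapFun_eq_sum_basis (Module.finBasis ℂ 𝔤), mul_sum, sum_mul]
  refine Submodule.sum_mem _ fun i _ => ?_
  rw [mul_smul_comm, smul_mul_assoc]
  exact smul_mem_valuedIn _ (H _)

theorem formalMap_coproduct {f : FormalFun d (U 𝔤)} (hf : f ∈ lieFun d 𝔤) :
    formalMap (coproduct 𝔤) f = formalLeft d 𝔤 f + formalRight d 𝔤 f := by
  refine formalFun_ext fun n => ?_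
  obtain ⟨y, hy⟩ := hf n
  change coproduct 𝔤 (coef n f) = coef n f ⊗ₜ 1 + 1 ⊗ₜ coef n f
  rw [← hy]
  exact UniversalEnvelopingAlgebra.lift_ι_apply ℂ (primitiveHom 𝔤) y

theorem euler_formalMap {B B' : Type*} [Ring B] [Algebra ℂ B] [Ring B'] [Algebra ℂ B']
    (φ : B →ₐ[ℂ] B') (f : FormalFun d B) : euler (formalMap φ f) = formalMap φ (euler f) :=
  euler_mapFun φ.toLinearMap f

/-- The adjoint action of `𝔩` on `𝔤`. -/
def adLie (𝔩 : LieSubalgebra ℂ 𝔤) : 𝔩 →ₗ[ℂ] 𝔤 →ₗ[ℂ] 𝔤 :=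
  (LieModule.toEnd ℂ 𝔤 𝔤 : 𝔤 →ₗ[ℂ] Module.End ℂ 𝔤) ∘ₗ 𝔩.toSubmodule.subtype

theorem mapFun_inc_adLie (y : 𝔩) (f : FormalFun d 𝔤) :
    mapFun (inc (𝔤 := 𝔤)).toLinearMap (mapFun (adLie 𝔩 y) f) =
      const d (inc (y : 𝔤)) * mapFun (inc (𝔤 := 𝔤)).toLinearMap f
        - mapFun (inc (𝔤 := 𝔤)).toLinearMap f * const d (inc (y : 𝔤)) :=
  formalFun_ext fun n => by
    rw [map_sub, coef_const_mul, coef_mul_const]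
    exact (inc (𝔤 := 𝔤)).map_lie (y : 𝔤) (coef n f)

/-- Exponentials of equivariant homogeneous functions with values in `𝔤`. -/
theorem exists_isGauge [FiniteDimensional ℂ 𝔤] {k : ℕ} {f : FormalFun d 𝔤}
    (hf : euler f = ((k + 1 : ℕ) : ℂ) • f)
    (hfx : ∀ y : 𝔩, coadDeriv x y f + mapFun (adLie 𝔩 y) f = 0) :
    ∃ h : (FormalFun d (U 𝔤))ˣ, IsGauge x h ∧ (h : FormalFun d (U 𝔤)) -
      (1 - mapFun (inc (𝔤 := 𝔤)).toLinearMap f) ∈ ordGE (U 𝔤) (k + 2) := by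
  have hc : ((k + 1 : ℕ) : ℂ) ≠ 0 := by exact_mod_cast Nat.succ_ne_zero k
  -- With this scaling the solution of `E h = φ h` is `exp(-f)`. The sign makes the change of the
  -- r-matrix equal to `d̄f - (d̄f)²¹`.
  set φ := -((k + 1 : ℕ) : ℂ) • mapFun (inc (𝔤 := 𝔤)).toLinearMap f with hφd
  have hφ : euler φ = ((k + 1 : ℕ) : ℂ) • φ := by
    rw [hφd, map_smul, euler_mapFun, hf, smul_comm]
    congr 1
    exact map_smul (mapFunₗ (inc (𝔤 := 𝔤)).toLinearMap) _ f
  have hφm : φ ∈ lieFun d 𝔤 := Submodule.smul_mem _ _ (mem_valuedIn_range.2 ⟨f, rfl⟩)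
  have hφ1 : φ ∈ ordGE (U 𝔤) 1 := ordGE_mono (by omega) (mem_ordGE_of_homogeneous hφ)
  have hφx : ∀ y : 𝔩, coadDeriv x y φ
      + (const d (inc (y : 𝔤)) * φ - φ * const d (inc (y : 𝔤))) = 0 := by
    intro y
    rw [hφd, coadDeriv_smul, coadDeriv_mapFun, mul_smul_comm, smul_mul_assoc, ← smul_sub,
      ← smul_add, ← mapFun_inc_adLie]
    have := congrArg (mapFunₗ (inc (𝔤 := 𝔤)).toLinearMap) (hfx y)
    rw [map_add, map_zero] at this
    exact (congrArg _ this).trans (smul_zero _)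
  obtain ⟨h, h0, hh, hcm, hle⟩ := exists_exp hφ
  have hinv := euler_inv hh hcm
  have hcm' : φ * (↑h⁻¹ : FormalFun d (U 𝔤)) = ↑h⁻¹ * φ :=
    (Commute.units_inv_right (show Commute φ h from hcm)).eq
  have h0' : coef 0 (↑h⁻¹ : FormalFun d (U 𝔤)) = 1 := by
    have := coef_zero_mul (↑h⁻¹ : FormalFun d (U 𝔤)) h
    rwa [Units.inv_mul, h0, mul_one, ← const_one, coef_zero_const, eq_comm] at this
  have hneg : -φ ∈ lieFun d 𝔤 := Submodule.neg_mem _ hφm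
  have hneg1 : -φ ∈ ordGE (U 𝔤) 1 := Submodule.neg_mem _ hφ1
  refine ⟨h, ⟨h0, ?_, fun y => ?_, ?_, ?_, fun i => ?_⟩, ?_⟩
  -- The coproduct of `h` and `h ⊗ h` solve the same radial equation, since `φ` is primitive.
  · refine eq_of_euler_mul (φ := formalMap (coproduct 𝔤) φ)
      (mapFun_mem_ordGE (coproduct 𝔤).toLinearMap hφ1) ?_ ?_ ?_
    · rw [euler_formalMap, hh, map_mul]
    · have := (formalLeft_commute_formalRight (h : FormalFun d (U 𝔤)) φ).eq
      rw [formalMap_coproduct hφm, euler_mul, euler_formalMap, euler_formalMap, hh, map_mul,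
        map_mul, ← mul_assoc (formalLeft d 𝔤 h), this]
      noncomm_ring
    · rw [coef_zero_mul]
      change coproduct 𝔤 (coef 0 (h : FormalFun d (U 𝔤))) =
        (coef 0 (h : FormalFun d (U 𝔤)) ⊗ₜ 1) * (1 ⊗ₜ coef 0 (h : FormalFun d (U 𝔤)))
      rw [h0, map_one]
      simp [Algebra.TensorProduct.one_def]
  -- The infinitesimal action of `y` on `h` solves the radial equation of `h` with zero constant
  -- term.
  · refine eq_of_euler_mul hφ1 ?_ (by rw [map_zero, mul_zero]) ?_
    · rw [map_add, map_sub, euler_coadDeriv, euler_mul, euler_mul, euler_const, hh, coadDeriv_mul]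
      rw [← sub_eq_zero]
      calc _ = (coadDeriv x y φ
          + (const d (inc (y : 𝔤)) * φ - φ * const d (inc (y : 𝔤)))) * h := by noncomm_ring
        _ = 0 := by rw [hφx, zero_mul]
    · have h2 : coadDeriv x y (h : FormalFun d (U 𝔤)) ∈ ordGE _ 1 := by
        have : (h : FormalFun d (U 𝔤)) - const d 1 ∈ ordGE _ 1 :=
          mem_ordGE_one.2 (by rw [map_sub, h0, coef_zero_const, sub_self])
        have := coadDeriv_mem_ordGE x y this
        rwa [coadDeriv_sub, coadDeriv_const, sub_zero] at this
      rw [map_add, map_sub, coef_const_mul, coef_mul_const, mem_ordGE_one.1 h2, h0, mul_one,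
        one_mul, sub_self, add_zero, map_zero]
  -- The conjugate `Y = h y h⁻¹` solves `E Y = [φ, Y]`, so its coefficients stay in `𝔤`; conjugation
  -- by `h⁻¹` is the same with `-φ`.
  · refine fun f hf => conj_mem_lieFun_of_const (fun y => ?_) hf
    refine mem_valuedIn_of_euler_lie lie_mem_range_inc 0 (ζ := 0) hφ1 hφm (Submodule.zero_mem _)
      ?_ ?_
    · rw [euler_mul, euler_mul, euler_const, hinv, hcm', hh, Nat.cast_zero, zero_smul]
      noncomm_ring
    · rw [coef_zero_mul, coef_zero_mul, h0, h0', coef_zero_const, one_mul, mul_one]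
      exact ⟨y, rfl⟩
  · refine fun f hf => conj_mem_lieFun_of_const (fun y => ?_) hf
    refine mem_valuedIn_of_euler_lie lie_mem_range_inc 0 (ζ := 0) hneg1 hneg (Submodule.zero_mem _)
      ?_ ?_
    · rw [euler_mul, euler_mul, euler_const, hinv, hh, hcm, Nat.cast_zero, zero_smul]
      noncomm_ring
    · rw [coef_zero_mul, coef_zero_mul, h0, h0', coef_zero_const, one_mul, mul_one]
      exact ⟨y, rfl⟩
  -- The logarithmic derivative `Y` solves `E Y + Y = ∂_i φ - [φ, Y]`. Commutation of `φ` with `h`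
  -- allows `E h` to be written as `h φ` before differentiating.
  · refine mem_valuedIn_of_euler_lie lie_mem_range_inc 1 (ζ := partialDeriv i φ) hneg1 hneg
      (partialDeriv_mem_valuedIn i hφm) ?_ ?_
    · rw [euler_mul, hinv, euler_partialDeriv, hh, hcm, partialDeriv_mul, Nat.cast_one, one_smul]
      have : (↑h⁻¹ : FormalFun d (U 𝔤)) * (h * partialDeriv i φ) = partialDeriv i φ := by
        rw [← mul_assoc, Units.inv_mul, one_mul]
      rw [mul_sub, mul_add, this]
      noncomm_ring
    · have h3 := mem_ordGE_one.1 (ordGE_mono (by omega) (partialDeriv_mem_ordGE i hle) :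
        _ ∈ ordGE (U 𝔤) 1)
      rw [partialDeriv_sub, partialDeriv_add, ← const_one, partialDeriv_const, zero_add, map_sub,
        sub_eq_zero] at h3
      rw [coef_zero_mul, h0', one_mul, h3]
      exact partialDeriv_mem_valuedIn i (Submodule.smul_mem _ _ hφm) 0
  · convert hle using 3
    rw [hφd, smul_smul, mul_neg, inv_mul_cancel₀ hc, neg_smul, one_smul, sub_eq_add_neg]

end Gauge

/-! ### Linearized gauge equivalence -/

section LeadingTerm

open Finset

variable {d : ℕ} {𝔤 : Type*} [LieRing 𝔤] [LieAlgebra ℂ 𝔤] {𝔩 : LieSubalgebra ℂ 𝔤}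
  (x : Module.Basis (Fin d) ℂ 𝔩) {W W' : Type*} [AddCommGroup W] [Module ℂ W] [AddCommGroup W']
  [Module ℂ W']

/-- `y ⊗ w ↦ (k-th coordinate of T y) w`. -/
def contractCoord (T : 𝔤 →ₗ[ℂ] 𝔩) (k : Fin d) : 𝔤 ⊗[ℂ] W →ₗ[ℂ] W :=
  TensorProduct.lift (LinearMap.toSpanSingleton ℂ (W →ₗ[ℂ] W) LinearMap.id ∘ₗ x.coord k ∘ₗ T)

@[simp] theorem contractCoord_tmul (T : 𝔤 →ₗ[ℂ] 𝔩) (k : Fin d) (y : 𝔤) (w : W) :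
    contractCoord x T k (y ⊗ₜ w) = x.repr (T y) k • w := by
  simp [contractCoord]

/-- The contraction of the first tensor factor with `λ ↦ λ ∘ T`. -/
def contract (T : 𝔤 →ₗ[ℂ] 𝔩) : FormalFun d (𝔤 ⊗[ℂ] W) →ₗ[ℂ] FormalFun d W :=
  ∑ k, mulCoordₗ k ∘ₗ mapFunₗ (contractCoord x T k)

theorem contract_apply (T : 𝔤 →ₗ[ℂ] 𝔩) (F : FormalFun d (𝔤 ⊗[ℂ] W)) :
    contract x T F = ∑ k, mulCoord k (mapFun (contractCoord x T k) F) := by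
  simp [contract, mulCoordₗ_apply, mapFunₗ_apply]

theorem dBar_eq_sum (F : FormalFun d W) :
    dBar x F = ∑ i, mapFun (TensorProduct.mk ℂ 𝔤 W (x i : 𝔤)) (partialDeriv i F) :=
  formalFun_ext fun n => by rw [dBar, coef_ofCoef, map_sum]; rfl

theorem mapFun_sum {V V' : Type*} [AddCommGroup V] [Module ℂ V] [AddCommGroup V'] [Module ℂ V']
    {ι : Type*} (s : Finset ι) (L : V →ₗ[ℂ] V') (F : ι → FormalFun d V) :
    mapFun L (∑ i ∈ s, F i) = ∑ i ∈ s, mapFun L (F i) := map_sum (mapFunₗ L) F s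

theorem dBar_sub (F G : FormalFun d W) : dBar x (F - G) = dBar x F - dBar x G := by
  simp only [dBar_eq_sum, partialDeriv_sub, ← mapFunₗ_apply, map_sub, sum_sub_distrib]

theorem dBar_smul (c : ℂ) (F : FormalFun d W) : dBar x (c • F) = c • dBar x F := by
  simp only [dBar_eq_sum, ← partialDerivₗ_apply, ← mapFunₗ_apply, map_smul, smul_sum]

theorem dBar_add (F G : FormalFun d W) : dBar x (F + G) = dBar x F + dBar x G := by
  simp only [dBar_eq_sum, partialDeriv_add, ← mapFunₗ_apply, map_add, sum_add_distrib]

theorem dBar_mem_ordGE {m : ℕ} {F : FormalFun d W} (hF : F ∈ ordGE W (m + 1)) :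
    dBar x F ∈ ordGE (𝔤 ⊗[ℂ] W) m := by
  rw [dBar_eq_sum]
  exact Submodule.sum_mem _ fun i _ => mapFun_mem_ordGE _ (partialDeriv_mem_ordGE i hF)

theorem euler_dBar (F : FormalFun d W) : euler (dBar x F) = dBar x (euler F) - dBar x F := by
  simp only [dBar_eq_sum, map_sum, euler_mapFun, euler_partialDeriv, ← sum_sub_distrib]
  exact sum_congr rfl fun i _ => map_sub (mapFunₗ (TensorProduct.mk ℂ 𝔤 W (x i : 𝔤))) _ _

theorem euler_mulCoord (k : Fin d) (F : FormalFun d W) :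
    euler (mulCoord k F) = mulCoord k F + mulCoord k (euler F) := by
  have := euler_mulLin (Pi.basisFun ℂ (Fin d)) (Pi.basisFun ℂ (Fin d) k) F
  simpa only [mulLin_basis] using this

theorem euler_contract (T : 𝔤 →ₗ[ℂ] 𝔩) (F : FormalFun d (𝔤 ⊗[ℂ] W)) :
    euler (contract x T F) = contract x T (euler F) + contract x T F := by
  simp only [contract_apply, map_sum, euler_mulCoord, euler_mapFun, ← sum_add_distrib]
  exact sum_congr rfl fun k _ => add_comm _ _

/-- The action on the coordinate `x_k` and the action on the first leg correspond through `T`, so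
contraction with the tautological point of `𝔩*` is equivariant. -/
theorem coadDeriv_contract (T : 𝔤 →ₗ[ℂ] 𝔩) (y : 𝔩) (hT : ∀ z, T ⁅(y : 𝔤), z⁆ = ⁅y, T z⁆)
    (F : FormalFun d (𝔤 ⊗[ℂ] W)) :
    coadDeriv x y (contract x T F) =
      contract x T (mapFun (TensorProduct.map (adLie 𝔩 y) LinearMap.id) F)
        + contract x T (coadDeriv x y F) := by
  simp only [contract_apply, coadDeriv_sum, ← mulLin_basis x, coadDeriv_mulLin, coadDeriv_mapFun,
    sum_add_distrib]
  congr 1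
  have h1 : ∀ k, mulLin x ⁅y, x k⁆ (mapFun (contractCoord x T k) F) =
      ∑ j, x.repr ⁅y, x k⁆ j • mulCoord j (mapFun (contractCoord x T k) F) := fun k => rfl
  simp only [h1, mulLin_basis]
  rw [sum_comm]
  refine sum_congr rfl fun j _ => ?_
  have h2 : contractCoord x T j ∘ₗ TensorProduct.map (adLie 𝔩 y) LinearMap.id =
      ∑ k, x.repr ⁅y, x k⁆ j • contractCoord (W := W) x T k := by
    refine TensorProduct.ext' fun z w => ?_
    have h3 : contractCoord x T j (((adLie 𝔩 y) z) ⊗ₜ w) = x.repr ⁅y, T z⁆ j • w := by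
      rw [contractCoord_tmul, ← hT]
      rfl
    simp only [LinearMap.comp_apply, TensorProduct.map_tmul, LinearMap.id_apply, h3,
      LinearMap.sum_apply, LinearMap.smul_apply, contractCoord_tmul, smul_smul, ← sum_smul]
    congr 1
    conv_lhs => rw [← x.sum_repr (T z), lie_sum, ← x.coord_apply, map_sum]
    simp only [lie_smul, map_smul, x.coord_apply]
    exact sum_congr rfl fun i _ => mul_comm _ _
  rw [mapFun_mapFun, h2, ← mulCoordₗ_apply]
  simp only [← mulCoordₗ_apply, ← map_smul, ← map_sum]
  congr 1
  refine formalFun_ext fun n => ?_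
  simp only [map_sum, map_smul, coef_mapFun, LinearMap.sum_apply, LinearMap.smul_apply]

theorem mapFun_contract (T : 𝔤 →ₗ[ℂ] 𝔩) (L : W →ₗ[ℂ] W') (F : FormalFun d (𝔤 ⊗[ℂ] W)) :
    mapFun L (contract x T F) = contract x T (mapFun (TensorProduct.map LinearMap.id L) F) := by
  simp only [contract_apply, mapFun_sum]
  refine sum_congr rfl fun k _ => ?_
  rw [← mulCoord_mapFun, mapFun_mapFun, mapFun_mapFun]
  congr 2
  exact TensorProduct.ext' fun z w => by simp

/-- The contraction of an equivariant function is equivariant. -/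
theorem contract_equivariant (T : 𝔤 →ₗ[ℂ] 𝔩) (y : 𝔩) (hT : ∀ z, T ⁅(y : 𝔤), z⁆ = ⁅y, T z⁆)
    {F : FormalFun d (𝔤 ⊗[ℂ] 𝔤)} (hF : coadDeriv x y F + mapFun (adTensor 𝔩 y) F = 0) :
    coadDeriv x y (contract x T F) + mapFun (adLie 𝔩 y) (contract x T F) = 0 := by
  have h : mapFun (adTensor 𝔩 y) F = mapFun (TensorProduct.map (adLie 𝔩 y) LinearMap.id) F
      + mapFun (TensorProduct.map LinearMap.id (adLie 𝔩 y)) F := by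
    refine formalFun_ext fun n => ?_
    rw [map_add, coef_mapFun, coef_mapFun, coef_mapFun, ← LinearMap.add_apply]
    congr 1
  rw [coadDeriv_contract x T y hT, mapFun_contract, ← map_add, ← map_add,
    ← map_zero (contract x T), ← hF, h]
  congr 1
  abel

variable {π : 𝔤 →ₗ[ℂ] 𝔩}

theorem contract_mk (T : 𝔤 →ₗ[ℂ] 𝔩) (hT : ∀ y : 𝔩, T y = y) (i : Fin d) (F : FormalFun d W) :
    contract x T (mapFun (TensorProduct.mk ℂ 𝔤 W (x i : 𝔤)) F) = mulCoord i F := by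
  rw [contract_apply, sum_eq_single i]
  · rw [mapFun_mapFun]
    congr 1
    refine formalFun_ext fun n => ?_
    simp [hT]
  · intro k _ hk
    rw [mapFun_mapFun]
    have : contractCoord x T k ∘ₗ TensorProduct.mk ℂ 𝔤 W (x i : 𝔤) = 0 :=
      LinearMap.ext fun w => by simp [hT, hk.symm]
    rw [this]
    exact map_zero (mulCoordₗ k)
  · exact fun h => absurd (mem_univ i) h

/-- Pairing the differential with the radial field is the Euler operator. -/
theorem contract_dBar (T : 𝔤 →ₗ[ℂ] 𝔩) (hT : ∀ y : 𝔩, T y = y) (F : FormalFun d W) :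
    contract x T (dBar x F) = euler F := by
  simp only [dBar_eq_sum, map_sum, contract_mk x T hT, euler_apply]

theorem partialDeriv_contract (T : 𝔤 →ₗ[ℂ] 𝔩) (i : Fin d) (F : FormalFun d (𝔤 ⊗[ℂ] W)) :
    partialDeriv i (contract x T F) = mapFun (contractCoord x T i) F
      + contract x T (partialDeriv i F) := by
  simp only [contract_apply, partialDeriv_sum, partialDeriv_mulCoord, partialDeriv_mapFun,
    sum_add_distrib]
  simp

/-- The projection to `𝔩` in the first tensor factor. -/
theorem sum_mk_contractCoord (T : 𝔤 →ₗ[ℂ] 𝔩) (F : FormalFun d (𝔤 ⊗[ℂ] W)) :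
    ∑ i, mapFun (TensorProduct.mk ℂ 𝔤 W (x i : 𝔤)) (mapFun (contractCoord x T i) F) =
      mapFun (TensorProduct.map (𝔩.toSubmodule.subtype ∘ₗ T) LinearMap.id) F := by
  have h : TensorProduct.map (𝔩.toSubmodule.subtype ∘ₗ T) LinearMap.id =
      ∑ i, TensorProduct.mk ℂ 𝔤 W (x i : 𝔤) ∘ₗ contractCoord x T i := by
    refine TensorProduct.ext' fun z w => ?_
    have : (T z : 𝔤) = ∑ i, x.repr (T z) i • (x i : 𝔤) := by
      have := congrArg 𝔩.toSubmodule.subtype (x.sum_repr (T z))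
      simp only [map_sum, map_smul] at this
      exact this.symm
    rw [TensorProduct.map_tmul]
    change (T z : 𝔤) ⊗ₜ[ℂ] w = _
    rw [this, TensorProduct.sum_tmul]
    simp [TensorProduct.smul_tmul]
  rw [h]
  refine formalFun_ext fun n => ?_
  simp [coef_mapFun]

/-- Derivatives falling on the contracting coordinate restore the `𝔩`-component of the first leg;
the others fall on the function. -/
theorem dBar_contract (T : 𝔤 →ₗ[ℂ] 𝔩) (F : FormalFun d (𝔤 ⊗[ℂ] W)) :
    dBar x (contract x T F) =
      mapFun (TensorProduct.map (𝔩.toSubmodule.subtype ∘ₗ T) LinearMap.id) F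
      + ∑ i, mapFun (TensorProduct.mk ℂ 𝔤 W (x i : 𝔤)) (contract x T (partialDeriv i F)) := by
  rw [dBar_eq_sum, ← sum_mk_contractCoord x, ← sum_add_distrib]
  refine sum_congr rfl fun i _ => ?_
  rw [partialDeriv_contract]
  exact map_add (mapFunₗ (TensorProduct.mk ℂ 𝔤 W (x i : 𝔤))) _ _

/-- In the first term of `Alt` the leg `x_i` is contracted, giving `E a`. In the other two it
survives and a leg of `∂_i a` is contracted, giving one sum and its flip. -/
theorem contract_Alt_dBar (T : 𝔤 →ₗ[ℂ] 𝔩) (hT : ∀ y : 𝔩, T y = y) (a : FormalFun d (𝔤 ⊗[ℂ] 𝔤)) :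
    contract x T (mapFun (Alt 𝔤) (dBar x a)) = euler a
      - ∑ i, mapFun (TensorProduct.mk ℂ 𝔤 𝔤 (x i : 𝔤)) (contract x T (partialDeriv i a))
      + mapFun (TensorProduct.comm ℂ 𝔤 𝔤).toLinearMap
        (∑ i, mapFun (TensorProduct.mk ℂ 𝔤 𝔤 (x i : 𝔤)) (contract x T (partialDeriv i a))) := by
  rw [← contract_dBar x T hT]
  have h : ∀ F : FormalFun d (𝔤 ⊗[ℂ] (𝔤 ⊗[ℂ] 𝔤)), mapFun (Alt 𝔤) F = F
      - mapFun (TensorProduct.leftComm ℂ 𝔤 𝔤 𝔤).toLinearMap F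
      + mapFun ((TensorProduct.comm ℂ 𝔤 (𝔤 ⊗[ℂ] 𝔤)).trans
        (TensorProduct.assoc ℂ 𝔤 𝔤 𝔤)).toLinearMap F := fun F => rfl
  rw [h, map_add (contract x T), map_sub (contract x T)]
  refine congrArg₂ (· + ·) (congrArg₂ (· - ·) rfl ?_) ?_
  · rw [dBar_eq_sum, mapFun_sum, map_sum]
    refine sum_congr rfl fun i _ => ?_
    rw [mapFun_mapFun, mapFun_contract]
    congr 2
    exact TensorProduct.ext' fun z w => by simp
  · rw [dBar_eq_sum, mapFun_sum, map_sum, mapFun_sum]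
    refine sum_congr rfl fun i _ => ?_
    rw [mapFun_mapFun, mapFun_mapFun, mapFun_contract]
    congr 2
    exact TensorProduct.ext' fun z w => by simp

/-- Commuting projections can be diagonalized together, and the eigenvalues `k`, `k + 1`, `k + 2`
are nonzero. The proof isolates them by applying `A` and `B`. -/
theorem injective_natCast_add {k : ℕ} (hk : k ≠ 0) {V : Type*} [AddCommGroup V] [Module ℂ V]
    (A B : V →ₗ[ℂ] V) (hA : ∀ v, A (A v) = A v) (hB : ∀ v, B (B v) = B v)
    (hAB : ∀ v, A (B v) = B (A v)) {v : V} (hv : (k : ℂ) • v + A v + B v = 0) : v = 0 := by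
  have hk' : ∀ m : ℕ, ((k + m : ℕ) : ℂ) ≠ 0 := fun m => by
    rw [Nat.cast_ne_zero]; omega
  have h1 : ((k + 1 : ℕ) : ℂ) • A v + A (B v) = 0 := by
    rw [← map_zero A, ← hv, map_add, map_add, map_smul, hA]
    push_cast
    module
  have h2 : ((k + 1 : ℕ) : ℂ) • B v + A (B v) = 0 := by
    rw [← map_zero B, ← hv, map_add, map_add, map_smul, hB, hAB]
    push_cast
    module
  have h3 : ((k + 2 : ℕ) : ℂ) • A (B v) = 0 := by
    rw [← map_zero A, ← h2, map_add, map_smul, hA]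
    push_cast
    module
  have h4 := (smul_eq_zero.1 h3).resolve_left (hk' 2)
  rw [h4, add_zero] at h1 h2
  rw [(smul_eq_zero.1 h1).resolve_left (hk' 1), (smul_eq_zero.1 h2).resolve_left (hk' 1), add_zero,
    add_zero] at hv
  exact (smul_eq_zero.1 hv).resolve_left (hk' 0)

theorem mapFun_dBar (L : W →ₗ[ℂ] W') (F : FormalFun d W) :
    mapFun (TensorProduct.map LinearMap.id L) (dBar x F) = dBar x (mapFun L F) := by
  rw [dBar_eq_sum, dBar_eq_sum, mapFun_sum]
  refine sum_congr rfl fun i _ => ?_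
  rw [partialDeriv_mapFun, mapFun_mapFun, mapFun_mapFun]
  rfl

theorem mapFun_dBar_left (L : 𝔤 →ₗ[ℂ] 𝔤) (hL : ∀ y : 𝔩, L y = y) (F : FormalFun d W) :
    mapFun (TensorProduct.map L LinearMap.id) (dBar x F) = dBar x F := by
  rw [dBar_eq_sum, mapFun_sum]
  refine sum_congr rfl fun i _ => ?_
  rw [mapFun_mapFun]
  congr 1
  exact LinearMap.ext fun w => by simp [hL]

/-- A homogeneous equivariant solution of the linearized equation is an infinitesimal gauge
transformation. -/
theorem exists_eq_dBar_sub (hπ : ∀ y : 𝔩, π y = y)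
    (hπ' : ∀ (y : 𝔩) z, π ⁅(y : 𝔤), z⁆ = ⁅y, π z⁆) {k : ℕ} (hk : k ≠ 0)
    {a : FormalFun d (𝔤 ⊗[ℂ] 𝔤)} (ha : euler a = (k : ℂ) • a)
    (ha' : ∀ y : 𝔩, coadDeriv x y a + mapFun (adTensor 𝔩 y) a = 0)
    (hAlt : mapFun (Alt 𝔤) (dBar x a) = 0) :
    ∃ f : FormalFun d 𝔤, euler f = ((k + 1 : ℕ) : ℂ) • f ∧
      (∀ y : 𝔩, coadDeriv x y f + mapFun (adLie 𝔩 y) f = 0) ∧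
      a = dBar x f - mapFun (TensorProduct.comm ℂ 𝔤 𝔤).toLinearMap (dBar x f) := by
  have hk' : ∀ m : ℕ, ((k + m : ℕ) : ℂ) ≠ 0 := fun m => by
    rw [Nat.cast_ne_zero]; omega
  set p : 𝔤 →ₗ[ℂ] 𝔤 := 𝔩.toSubmodule.subtype ∘ₗ π with hp
  have hpl : ∀ y : 𝔩, p y = y := fun y => congrArg Subtype.val (hπ y)
  have hpp : ∀ z, p (p z) = p z := fun z => hpl (π z)
  have hpy : ∀ (y : 𝔩) z, p (adLie 𝔩 y z) = adLie 𝔩 y (p z) := fun y z =>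
    congrArg Subtype.val (hπ' y z)
  set c := contract x π a with hc
  have hcE : euler c = ((k + 1 : ℕ) : ℂ) • c := by
    rw [hc, euler_contract, ha, map_smul]
    push_cast
    module
  have hcx : ∀ y : 𝔩, coadDeriv x y c + mapFun (adLie 𝔩 y) c = 0 := fun y =>
    contract_equivariant x π y (hπ' y) (ha' y)
  set τ := mapFunₗ (d := d) (TensorProduct.comm ℂ 𝔤 𝔤).toLinearMap with hτ
  have hττ : ∀ F, τ (τ F) = F := fun F => formalFun_ext fun n => by simp [hτ, mapFunₗ_apply]
  set A := mapFunₗ (d := d) (TensorProduct.map p (LinearMap.id : 𝔤 →ₗ[ℂ] 𝔤)) with hA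
  set B := mapFunₗ (d := d) (TensorProduct.map (LinearMap.id : 𝔤 →ₗ[ℂ] 𝔤) p) with hB
  have map_map : ∀ (L L' M M' N N' : 𝔤 →ₗ[ℂ] 𝔤), M ∘ₗ L = N → M' ∘ₗ L' = N' →
      ∀ F : FormalFun d (𝔤 ⊗[ℂ] 𝔤),
      mapFun (TensorProduct.map M M') (mapFun (TensorProduct.map L L') F) =
        mapFun (TensorProduct.map N N') F := by
    rintro L L' M M' _ _ rfl rfl F
    rw [mapFun_mapFun, TensorProduct.map_comp]
  have hp2 : p ∘ₗ p = p := LinearMap.ext hpp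
  have hAA : ∀ F, A (A F) = A F := map_map _ _ _ _ _ _ hp2 rfl
  have hBB : ∀ F, B (B F) = B F := map_map _ _ _ _ _ _ rfl hp2
  have hAB : ∀ F, A (B F) = B (A F) := fun F =>
    (map_map _ _ _ _ p p rfl rfl F).trans (map_map _ _ _ _ p p rfl rfl F).symm
  have hτA : ∀ F, τ (A F) = B (τ F) := fun F => by
    simp only [hτ, hA, hB, mapFunₗ_apply, mapFun_mapFun]
    congr 1
    exact TensorProduct.ext' fun z w => by simp
  have hτB : ∀ F, τ (B F) = A (τ F) := fun F => by rw [← hττ (A (τ F)), hτA, hττ]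
  obtain ⟨M, hM⟩ : ∃ M, M = ∑ i, mapFun (TensorProduct.mk ℂ 𝔤 𝔤 (x i : 𝔤))
    (contract x π (partialDeriv i a)) := ⟨_, rfl⟩
  have e1 : (k : ℂ) • a - M + τ M = 0 := by
    have h1 := contract_Alt_dBar x π hπ a
    rw [hAlt, map_zero, ha, ← hM] at h1
    exact h1.symm
  have e2 : dBar x c = A a + M := by
    rw [hM]
    exact dBar_contract x π a
  -- By `e1`, `k a` equals `M - τ M`, which is antisymmetric; here `k ≠ 0` is needed.
  have hanti : τ a = -a := by
    have h1 : (k : ℂ) • (τ a + a) = 0 := by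
      have h2 := congrArg τ e1
      rw [map_add, map_sub, map_smul, hττ, map_zero] at h2
      have h3 : (k : ℂ) • (τ a + a) = ((k : ℂ) • τ a - τ M + M) + ((k : ℂ) • a - M + τ M) := by
        module
      rw [h3, h2, e1, add_zero]
    rw [eq_neg_iff_add_eq_zero]
    exact (smul_eq_zero.1 h1).resolve_left (hk' 0)
  -- Antisymmetrizing `e2` replaces `M - τ M` by `k a` and leaves the `𝔩`-components of the two
  -- legs.
  have e3 : (k : ℂ) • a + A a + B a = dBar x c - τ (dBar x c) := by
    rw [e2, map_add, hτA, hanti, map_neg]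
    have : (k : ℂ) • a = M - τ M := by
      rw [← sub_eq_zero, ← e1]; abel
    rw [this]
    abel
  -- This is the inverse of `k + 1 + p`, written on the kernel and the image of the projection `p`.
  -- It commutes with `𝔩` because `p` does.
  set q : 𝔤 →ₗ[ℂ] 𝔤 := ((k + 1 : ℕ) : ℂ)⁻¹ • (LinearMap.id - p) + ((k + 2 : ℕ) : ℂ)⁻¹ • p with hq
  have hkq : ∀ z, ((k + 1 : ℕ) : ℂ) • q z + p (q z) = z := by
    intro z
    have h2 : ((k + 2 : ℕ) : ℂ) = ((k + 1 : ℕ) : ℂ) + 1 := by push_cast; ring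
    simp only [hq, LinearMap.add_apply, LinearMap.smul_apply, LinearMap.sub_apply,
      LinearMap.id_apply, map_add, map_smul, map_sub, hpp, sub_self, smul_zero, zero_add]
    rw [smul_add, smul_smul, mul_inv_cancel₀ (hk' 1), one_smul, add_assoc, smul_smul, ← add_smul]
    have h3 : ((k + 1 : ℕ) : ℂ) * ((k + 2 : ℕ) : ℂ)⁻¹ + ((k + 2 : ℕ) : ℂ)⁻¹ = 1 := by
      rw [← add_one_mul, ← h2, mul_inv_cancel₀ (hk' 2)]
    rw [h3, one_smul, sub_add_cancel]
  refine ⟨mapFun q c, ?_, fun y => ?_, ?_⟩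
  · rw [euler_mapFun, hcE]
    exact map_smul (mapFunₗ q) _ c
  · have h1 : mapFun (adLie 𝔩 y) (mapFun q c) = mapFun q (mapFun (adLie 𝔩 y) c) := by
      rw [mapFun_mapFun, mapFun_mapFun]
      congr 1
      exact LinearMap.ext fun z => by simp [hq, hpy]
    rw [coadDeriv_mapFun, h1]
    have := congrArg (mapFunₗ q) (hcx y)
    rwa [map_add, map_zero] at this
  · set D := dBar x (mapFun q c) with hD
    have hAD : A D = D := mapFun_dBar_left x p hpl _
    have hkD : ((k + 1 : ℕ) : ℂ) • D + B D = dBar x c := by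
      have : B D = dBar x (mapFun p (mapFun q c)) := mapFun_dBar x p _
      rw [this, hD, ← dBar_smul, ← dBar_add]
      congr 1
      exact formalFun_ext fun n => hkq _
    rw [← sub_eq_zero]
    -- The first leg of `D` lies in `𝔩`, so `A D = D` and `k + A + B` sends `D` to `d̄c`. By `e3` it
    -- takes the same value on `a` and on `D - τ D`.
    refine injective_natCast_add hk A B hAA hBB hAB ?_
    have h2 : (k : ℂ) • D + A D + B D = dBar x c := by
      rw [hAD, ← hkD]
      push_cast
      module
    have h3 : (k : ℂ) • τ D + A (τ D) + B (τ D) = τ (dBar x c) := by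
      rw [← h2, map_add, map_add, map_smul, hτA, hτB]
      abel
    change (k : ℂ) • (a - (D - τ D)) + A (a - (D - τ D)) + B (a - (D - τ D)) = 0
    have h4 : (k : ℂ) • (a - (D - τ D)) + A (a - (D - τ D)) + B (a - (D - τ D)) =
        ((k : ℂ) • a + A a + B a) - ((k : ℂ) • D + A D + B D)
          + ((k : ℂ) • τ D + A (τ D) + B (τ D)) := by
      simp only [map_sub]
      module
    rw [h4, e3, h2, h3]
    abel

end LeadingTerm

/-! ### Gauge transforms and their dependence on the gauge map. -/

section GaugeTransform

open Finset

attribute [local instance] formalAlgebra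
attribute [local instance 100] LieRing.ofAssociativeRing

variable {d : ℕ} {𝔤 : Type*} [LieRing 𝔤] [LieAlgebra ℂ 𝔤] {𝔩 : LieSubalgebra ℂ 𝔤}
  (x : Module.Basis (Fin d) ℂ 𝔩)

theorem coe_square (u : (FormalFun d (U 𝔤))ˣ) :
    (square u : FormalFun d (U 𝔤 ⊗[ℂ] U 𝔤)) = formalLeft d 𝔤 u * formalRight d 𝔤 u := rfl

theorem square_mul (h u : (FormalFun d (U 𝔤))ˣ) : square (h * u) = square h * square u := by
  ext1
  have := (formalLeft_commute_formalRight (u : FormalFun d (U 𝔤)) h).eq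
  simp only [Units.val_mul, coe_square, map_mul]
  rw [mul_assoc (formalLeft d 𝔤 h) (formalRight d 𝔤 h),
    ← mul_assoc (formalRight d 𝔤 h) (formalLeft d 𝔤 u), ← this]
  noncomm_ring

theorem coef_formalLeft_basisFun_mul (i : Fin d) (g : FormalFun d (U 𝔤)) (n : Fin d →₀ ℕ) :
    coef n (formalLeft d 𝔤 (basisFun x i) * formalRight d 𝔤 g) = inc (x i : 𝔤) ⊗ₜ coef n g := by
  rw [basisFun, coef_formalMap_const_mul]
  change (inc (x i : 𝔤) ⊗ₜ[ℂ] (1 : U 𝔤)) * ((1 : U 𝔤) ⊗ₜ[ℂ] coef n g) = _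
  simp

theorem mapFun_comm_mul (a b : FormalFun d (U 𝔤)) :
    mapFun (TensorProduct.comm ℂ (U 𝔤) (U 𝔤)).toLinearMap
      (formalLeft d 𝔤 a * formalRight d 𝔤 b) = formalLeft d 𝔤 b * formalRight d 𝔤 a := by
  rw [(formalLeft_commute_formalRight b a).eq]
  refine (mapFun_mul (Algebra.TensorProduct.comm ℂ (U 𝔤) (U 𝔤)).toAlgHom _ _).trans
    (congrArg₂ (· * ·) ?_ ?_) <;>
  exact formalFun_ext fun n => by simp [formalMap_apply]

theorem inc₂_dBar (f : FormalFun d 𝔤) : mapFun (inc₂ 𝔤) (dBar x f) =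
    ∑ i, formalLeft d 𝔤 (basisFun x i) *
      formalRight d 𝔤 (partialDeriv i (mapFun (inc (𝔤 := 𝔤)).toLinearMap f)) := by
  refine formalFun_ext fun n => ?_
  rw [map_sum, coef_mapFun, dBar, coef_ofCoef, map_sum]
  refine sum_congr rfl fun i _ => ?_
  rw [coef_formalLeft_basisFun_mul, partialDeriv_mapFun]
  rfl

theorem inc₂_comm_dBar (f : FormalFun d 𝔤) :
    mapFun (inc₂ 𝔤) (mapFun (TensorProduct.comm ℂ 𝔤 𝔤).toLinearMap (dBar x f)) =
    ∑ i, formalLeft d 𝔤 (partialDeriv i (mapFun (inc (𝔤 := 𝔤)).toLinearMap f)) *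
      formalRight d 𝔤 (basisFun x i) := by
  have h : inc₂ 𝔤 ∘ₗ (TensorProduct.comm ℂ 𝔤 𝔤).toLinearMap =
      (TensorProduct.comm ℂ (U 𝔤) (U 𝔤)).toLinearMap ∘ₗ inc₂ 𝔤 :=
    TensorProduct.ext' fun a b => by simp
  rw [mapFun_mapFun, h, ← mapFun_mapFun, inc₂_dBar, mapFun_sum]
  exact sum_congr rfl fun i _ => mapFun_comm_mul _ _

/-- The gauge transform `(g ⊗ g)(r - η̄_g + η̄_g²¹ - τ_g)(g⁻¹ ⊗ g⁻¹)`. -/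
def gauged (u : (FormalFun d (U 𝔤))ˣ) (r : FormalFun d (𝔤 ⊗[ℂ] 𝔤)) :
    FormalFun d (U 𝔤 ⊗[ℂ] U 𝔤) :=
  (square u : FormalFun d (U 𝔤 ⊗[ℂ] U 𝔤)) * (mapFun (inc₂ 𝔤) r +
    gaugeTerm (structFun x) (basisFun x) (fun i => (↑u⁻¹ : FormalFun d (U 𝔤)) * partialDeriv i u)
      (formalLeft d 𝔤) (formalRight d 𝔤)) * (↑(square u)⁻¹ : FormalFun d (U 𝔤 ⊗[ℂ] U 𝔤))

theorem gauged_one (r : FormalFun d (𝔤 ⊗[ℂ] 𝔤)) :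
    gauged x (1 : (FormalFun d (U 𝔤))ˣ) r = mapFun (inc₂ 𝔤) r := by
  have h1 : square (1 : (FormalFun d (U 𝔤))ˣ) = 1 := by
    ext1
    rw [coe_square, Units.val_one, map_one, map_one, mul_one, Units.val_one]
  have h2 : ∀ i, (↑(1 : (FormalFun d (U 𝔤))ˣ)⁻¹ : FormalFun d (U 𝔤)) *
      partialDeriv i ((1 : (FormalFun d (U 𝔤))ˣ) : FormalFun d (U 𝔤)) = 0 := fun i => by
    rw [Units.val_one, ← const_one, partialDeriv_const, mul_zero]
  rw [gauged, h1, inv_one (G := (FormalFun d (U 𝔤 ⊗[ℂ] U 𝔤))ˣ), Units.val_one, one_mul, mul_one,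
    gaugeTerm_eq]
  simp only [h2, map_zero, zero_mul, mul_zero, smul_zero, sum_const_zero, sub_zero, add_zero]

/-! #### Congruences -/

theorem formalMap_mem_ordGE {B B' : Type*} [Ring B] [Algebra ℂ B] [Ring B'] [Algebra ℂ B']
    (φ : B →ₐ[ℂ] B') {m : ℕ} {f : FormalFun d B} (hf : f ∈ ordGE B m) :
    formalMap φ f ∈ ordGE B' m := mapFun_mem_ordGE φ.toLinearMap hf

theorem inv_sub_one_mem_ordGE {B : Type*} [Ring B] [Algebra ℂ B] {m : ℕ} {v : (FormalFun d B)ˣ}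
    (hv : (v : FormalFun d B) - 1 ∈ ordGE B m) : (↑v⁻¹ : FormalFun d B) - 1 ∈ ordGE B m := by
  have : (↑v⁻¹ : FormalFun d B) - 1 = -(↑v⁻¹ * ((v : FormalFun d B) - 1)) := by
    rw [mul_sub, Units.inv_mul, mul_one, neg_sub]
  rw [this]
  exact Submodule.neg_mem _ (mul_mem_ordGE_right hv _)

theorem conj_sub_mem_ordGE {B : Type*} [Ring B] [Algebra ℂ B] {a b m : ℕ} {v : (FormalFun d B)ˣ}
    (hv : (v : FormalFun d B) - 1 ∈ ordGE B a) {t : FormalFun d B} (ht : t ∈ ordGE B b)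
    (h : m ≤ a + b) : v * t * (↑v⁻¹ : FormalFun d B) - t ∈ ordGE B m := by
  have : v * t * (↑v⁻¹ : FormalFun d B) - t =
      (((v : FormalFun d B) - 1) * t - t * ((v : FormalFun d B) - 1)) * ↑v⁻¹ := by
    have h1 : ((v : FormalFun d B) - 1) * t - t * ((v : FormalFun d B) - 1) = v * t - t * v := by
      noncomm_ring
    rw [h1, sub_mul, mul_assoc t, Units.mul_inv, mul_one]
  rw [this]
  exact mul_mem_ordGE_left (Submodule.sub_mem _ (mul_mem_ordGE hv ht h)
    (mul_mem_ordGE ht hv (by omega))) _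

theorem square_sub_one_mem_ordGE {m : ℕ} {v : (FormalFun d (U 𝔤))ˣ}
    (hv : (v : FormalFun d (U 𝔤)) - 1 ∈ ordGE _ m) :
    (square v : FormalFun d (U 𝔤 ⊗[ℂ] U 𝔤)) - 1 ∈ ordGE _ m := by
  have : (square v : FormalFun d (U 𝔤 ⊗[ℂ] U 𝔤)) - 1 =
      formalLeft d 𝔤 (v - 1) * formalRight d 𝔤 v + formalRight d 𝔤 (v - 1) := by
    rw [coe_square, map_sub, map_sub, map_one, map_one]
    noncomm_ring
  rw [this]
  exact Submodule.add_mem _ (mul_mem_ordGE_left (formalMap_mem_ordGE _ hv) _)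
    (formalMap_mem_ordGE _ hv)

theorem sub_one_mem_ordGE_one {B : Type*} [Ring B] [Algebra ℂ B] {u : FormalFun d B}
    (hu : coef 0 u = 1) : u - 1 ∈ ordGE B 1 :=
  mem_ordGE_one.2 (by rw [map_sub, hu, ← const_one, coef_zero_const, sub_self])

/-- The logarithmic derivative of `h u` is `Ad(u⁻¹)` of that of `h`, plus that of `u`. To lowest
order the former is `-∂_i F`, and `Ad(u⁻¹)` is the identity because `u` has value `1` at `0`. -/
theorem logDeriv_mul_sub_mem_ordGE {B : Type*} [Ring B] [Algebra ℂ B] {k : ℕ}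
    {h u : (FormalFun d B)ˣ} {F : FormalFun d B} (hu : coef 0 (u : FormalFun d B) = 1)
    (hF : F ∈ ordGE B (k + 1)) (hh : (h : FormalFun d B) - (1 - F) ∈ ordGE B (k + 2)) (i : Fin d) :
    (↑(h * u)⁻¹ : FormalFun d B) * partialDeriv i (↑(h * u) : FormalFun d B)
      - (↑u⁻¹ * partialDeriv i (u : FormalFun d B) - partialDeriv i F) ∈ ordGE B (k + 1) := by
  have h1 : (h : FormalFun d B) - 1 ∈ ordGE B (k + 1) := by
    have : (h : FormalFun d B) - 1 = (h - (1 - F)) - F := by abel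
    rw [this]
    exact Submodule.sub_mem _ (ordGE_mono (by omega) hh) hF
  have h2 : partialDeriv i (h : FormalFun d B) + partialDeriv i F ∈ ordGE B (k + 1) := by
    have := partialDeriv_mem_ordGE i hh
    rwa [partialDeriv_sub, partialDeriv_sub, ← const_one, partialDeriv_const, zero_sub,
      sub_neg_eq_add] at this
  have h3 : partialDeriv i (h : FormalFun d B) ∈ ordGE B k := by
    have := Submodule.sub_mem _ (ordGE_mono (Nat.le_succ k) h2) (partialDeriv_mem_ordGE i hF)
    rwa [add_sub_cancel_right] at this
  have h4 := mul_mem_ordGE (inv_sub_one_mem_ordGE h1) h3 (m := k + 1) (by omega)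
  have h5 : (↑h⁻¹ : FormalFun d B) * partialDeriv i (h : FormalFun d B) ∈ ordGE B k :=
    mul_mem_ordGE_right h3 _
  have h6 := conj_sub_mem_ordGE (v := u⁻¹) (inv_sub_one_mem_ordGE (sub_one_mem_ordGE_one hu)) h5
    (m := k + 1) (by omega)
  rw [inv_inv] at h6
  rw [logDeriv_mul]
  have := Submodule.add_mem _ (Submodule.add_mem _ h6 h4) h2
  convert this using 1
  noncomm_ring

/-- Only the part linear in `η` changes in degree `k`. The quadratic part carries a factor linear in
`λ`, so its change has order `k + 1`. -/
theorem gaugeTerm_sub_mem_ordGE {k : ℕ} {η η' : Fin d → FormalFun d (U 𝔤)} {f : FormalFun d 𝔤}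
    (hf : f ∈ ordGE 𝔤 (k + 1)) (h : ∀ i, η' i -
      (η i - partialDeriv i (mapFun (inc (𝔤 := 𝔤)).toLinearMap f)) ∈ ordGE (U 𝔤) (k + 1)) :
    gaugeTerm (structFun x) (basisFun x) η' (formalLeft d 𝔤) (formalRight d 𝔤) -
      (gaugeTerm (structFun x) (basisFun x) η (formalLeft d 𝔤) (formalRight d 𝔤) +
        mapFun (inc₂ 𝔤) (dBar x f - mapFun (TensorProduct.comm ℂ 𝔤 𝔤).toLinearMap (dBar x f)))
      ∈ ordGE (U 𝔤 ⊗[ℂ] U 𝔤) (k + 1) := by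
  have hF : ∀ i, partialDeriv i (mapFun (inc (𝔤 := 𝔤)).toLinearMap f) ∈ ordGE (U 𝔤) k := fun i =>
    partialDeriv_mem_ordGE i (mapFun_mem_ordGE _ hf)
  have h' : ∀ i, η' i - η i ∈ ordGE (U 𝔤) k := fun i => by
    have := Submodule.sub_mem _ (ordGE_mono (Nat.le_succ k) (h i)) (hF i)
    convert this using 1
    abel
  have hsub : mapFun (inc₂ 𝔤) (dBar x f - mapFun (TensorProduct.comm ℂ 𝔤 𝔤).toLinearMap (dBar x f))
      = ∑ i, (formalLeft d 𝔤 (basisFun x i) *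
          formalRight d 𝔤 (partialDeriv i (mapFun (inc (𝔤 := 𝔤)).toLinearMap f))
        - formalLeft d 𝔤 (partialDeriv i (mapFun (inc (𝔤 := 𝔤)).toLinearMap f)) *
          formalRight d 𝔤 (basisFun x i)) := by
    rw [sum_sub_distrib, ← inc₂_dBar, ← inc₂_comm_dBar]
    exact map_sub (mapFunₗ (inc₂ 𝔤)) _ _
  rw [hsub, gaugeTerm_eq, gaugeTerm_eq]
  have key : ∀ a b c e g : FormalFun d (U 𝔤 ⊗[ℂ] U 𝔤), a + b - (c + e + g) =
      (a - c - g) + (b - e) :=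
    fun a b c e g => by abel
  rw [key]
  simp only [← sum_sub_distrib]
  refine Submodule.add_mem _ (Submodule.sum_mem _ fun i _ => ?_)
    (Submodule.sum_mem _ fun i _ => Submodule.sum_mem _ fun j _ => ?_)
  · have h1 : formalLeft d 𝔤 (η' i - (η i - partialDeriv i (mapFun (inc (𝔤 := 𝔤)).toLinearMap f)))
        ∈ ordGE _ (k + 1) := formalMap_mem_ordGE _ (h i)
    have h2 : formalRight d 𝔤 (η' i - (η i - partialDeriv i (mapFun (inc (𝔤 := 𝔤)).toLinearMap f)))
        ∈ ordGE _ (k + 1) := formalMap_mem_ordGE _ (h i)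
    have := Submodule.sub_mem _ (mul_mem_ordGE_left h1 (formalRight d 𝔤 (basisFun x i)))
      (mul_mem_ordGE_right h2 (formalLeft d 𝔤 (basisFun x i)))
    convert this using 1
    simp only [map_sub]
    noncomm_ring
  · have h1 : formalLeft d 𝔤 (η' j - η j) ∈ ordGE _ k := formalMap_mem_ordGE _ (h' j)
    have h2 : formalRight d 𝔤 (η' i - η i) ∈ ordGE _ k := formalMap_mem_ordGE _ (h' i)
    have := mulLin_mem_ordGE x ⁅x i, x j⁆ (Submodule.add_mem _
      (mul_mem_ordGE_left h1 (formalRight d 𝔤 (η' i)))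
      (mul_mem_ordGE_right h2 (formalLeft d 𝔤 (η j))))
    rw [← structFun_smul] at this
    convert this using 1
    rw [← smul_sub]
    congr 1
    simp only [map_sub]
    noncomm_ring

/-- The effect of a gauge transformation on the terms of lowest degree. -/
theorem gauged_mul_sub_mem_ordGE {k : ℕ} {h u : (FormalFun d (U 𝔤))ˣ} {f : FormalFun d 𝔤}
    (r : FormalFun d (𝔤 ⊗[ℂ] 𝔤)) (hu : coef 0 (u : FormalFun d (U 𝔤)) = 1)
    (hf : f ∈ ordGE 𝔤 (k + 1)) (hh : (h : FormalFun d (U 𝔤)) -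
      (1 - mapFun (inc (𝔤 := 𝔤)).toLinearMap f) ∈ ordGE (U 𝔤) (k + 2)) :
    gauged x (h * u) r - (gauged x u r +
      mapFun (inc₂ 𝔤) (dBar x f - mapFun (TensorProduct.comm ℂ 𝔤 𝔤).toLinearMap (dBar x f)))
      ∈ ordGE (U 𝔤 ⊗[ℂ] U 𝔤) (k + 1) := by
  have hF : mapFun (inc (𝔤 := 𝔤)).toLinearMap f ∈ ordGE (U 𝔤) (k + 1) := mapFun_mem_ordGE _ hf
  have h1 : (h : FormalFun d (U 𝔤)) - 1 ∈ ordGE (U 𝔤) (k + 1) := by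
    have : (h : FormalFun d (U 𝔤)) - 1 = (h - (1 - mapFun (inc (𝔤 := 𝔤)).toLinearMap f))
        - mapFun (inc (𝔤 := 𝔤)).toLinearMap f := by abel
    rw [this]
    exact Submodule.sub_mem _ (ordGE_mono (by omega) hh) hF
  have hu1 := square_sub_one_mem_ordGE (sub_one_mem_ordGE_one hu)
  have h2 := gaugeTerm_sub_mem_ordGE x hf (logDeriv_mul_sub_mem_ordGE hu hF hh)
  obtain ⟨b, hb⟩ : ∃ b, b = mapFun (inc₂ 𝔤)
    (dBar x f - mapFun (TensorProduct.comm ℂ 𝔤 𝔤).toLinearMap (dBar x f)) := ⟨_, rfl⟩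
  have hbk : b ∈ ordGE _ k := by
    rw [hb]
    exact mapFun_mem_ordGE _ (Submodule.sub_mem _ (dBar_mem_ordGE x hf)
      (mapFun_mem_ordGE _ (dBar_mem_ordGE x hf)))
  rw [← hb] at h2 ⊢
  have h3 : gauged x (h * u) r = square h * (square u * (mapFun (inc₂ 𝔤) r +
      gaugeTerm (structFun x) (basisFun x) (fun i => (↑(h * u)⁻¹ : FormalFun d (U 𝔤)) *
        partialDeriv i (↑(h * u) : FormalFun d (U 𝔤))) (formalLeft d 𝔤) (formalRight d 𝔤)) *
      (↑(square u)⁻¹ : FormalFun d (U 𝔤 ⊗[ℂ] U 𝔤))) *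
      (↑(square h)⁻¹ : FormalFun d (U 𝔤 ⊗[ℂ] U 𝔤)) := by
    rw [gauged, square_mul, mul_inv_rev, Units.val_mul, Units.val_mul]
    noncomm_ring
  -- Three errors of order `k + 1` add up: conjugation by `h ⊗ h`, conjugation of the correction `b`
  -- by `u ⊗ u`, and the error in the gauge term.
  have h4 := conj_sub_mem_ordGE (square_sub_one_mem_ordGE h1) (mem_ordGE_zero
    ((square u : FormalFun d (U 𝔤 ⊗[ℂ] U 𝔤)) * (mapFun (inc₂ 𝔤) r +
      gaugeTerm (structFun x) (basisFun x) (fun i => (↑(h * u)⁻¹ : FormalFun d (U 𝔤)) *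
        partialDeriv i (↑(h * u) : FormalFun d (U 𝔤))) (formalLeft d 𝔤) (formalRight d 𝔤)) *
      (↑(square u)⁻¹ : FormalFun d (U 𝔤 ⊗[ℂ] U 𝔤)))) (m := k + 1) (by omega)
  have h5 := conj_sub_mem_ordGE hu1 hbk (m := k + 1) (by omega)
  have h6 := mul_mem_ordGE_left (mul_mem_ordGE_right h2 (square u : FormalFun d (U 𝔤 ⊗[ℂ] U 𝔤)))
    (↑(square u)⁻¹ : FormalFun d (U 𝔤 ⊗[ℂ] U 𝔤))
  rw [h3]
  have := Submodule.add_mem _ (Submodule.add_mem _ h4 h5) h6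
  convert this using 1
  rw [gauged]
  noncomm_ring

/-! #### Gauge transforms take values in `𝔤 ⊗ 𝔤` -/

theorem mul_mem_valuedIn_inc₂ {f g : FormalFun d (U 𝔤)} (hf : f ∈ lieFun d 𝔤)
    (hg : g ∈ lieFun d 𝔤) :
    formalLeft d 𝔤 f * formalRight d 𝔤 g ∈ valuedIn (LinearMap.range (inc₂ 𝔤)) := by
  intro n
  rw [mul_eq_conv, coef_conv]
  refine Submodule.sum_mem _ fun p _ => ?_
  obtain ⟨a, ha⟩ := hf p.1
  obtain ⟨b, hb⟩ := hg p.2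
  refine ⟨a ⊗ₜ b, ?_⟩
  change _ = (coef p.1 f ⊗ₜ[ℂ] (1 : U 𝔤)) * ((1 : U 𝔤) ⊗ₜ[ℂ] coef p.2 g)
  rw [← ha, ← hb]
  simp

theorem square_conj_mul (u : (FormalFun d (U 𝔤))ˣ) (f g : FormalFun d (U 𝔤)) :
    (square u : FormalFun d (U 𝔤 ⊗[ℂ] U 𝔤)) * (formalLeft d 𝔤 f * formalRight d 𝔤 g) *
      (↑(square u)⁻¹ : FormalFun d (U 𝔤 ⊗[ℂ] U 𝔤)) =
    formalLeft d 𝔤 (u * f * ↑u⁻¹) * formalRight d 𝔤 (u * g * ↑u⁻¹) := by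
  rw [Units.mul_inv_eq_iff_eq_mul, coe_square]
  have h1 := (formalLeft_commute_formalRight f (u : FormalFun d (U 𝔤))).eq
  have h2 := (formalLeft_commute_formalRight (u : FormalFun d (U 𝔤)) (u * g * ↑u⁻¹)).eq
  have h3 : ∀ a : FormalFun d (U 𝔤), u * a * ↑u⁻¹ * (u : FormalFun d (U 𝔤)) = u * a := fun a => by
    rw [mul_assoc, Units.inv_mul, mul_one]
  calc _ = formalLeft d 𝔤 u * (formalRight d 𝔤 u * formalLeft d 𝔤 f) * formalRight d 𝔤 g := by
        noncomm_ring
    _ = formalLeft d 𝔤 (u * f) * formalRight d 𝔤 (u * g) := by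
        rw [← h1, map_mul, map_mul]
        noncomm_ring
    _ = formalLeft d 𝔤 (u * f * ↑u⁻¹ * u) * formalRight d 𝔤 (u * g * ↑u⁻¹ * u) := by rw [h3, h3]
    _ = formalLeft d 𝔤 (u * f * ↑u⁻¹) * (formalLeft d 𝔤 u * formalRight d 𝔤 (u * g * ↑u⁻¹)) *
          formalRight d 𝔤 u := by
        rw [map_mul _ (u * f * ↑u⁻¹ : FormalFun d (U 𝔤)),
          map_mul _ (u * g * ↑u⁻¹ : FormalFun d (U 𝔤))]
        noncomm_ring
    _ = _ := by
        rw [h2]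
        noncomm_ring

-- Conjugation by `u ⊗ u` acts separately on the two legs and preserves `𝔤` in each. The gauge term
-- is a sum of products whose legs `x_i`, `η_i` and `Ad(u⁻¹) x_i` are `𝔤`-valued.
variable {x} in
theorem IsGauge.exists_gauged_eq [FiniteDimensional ℂ 𝔤] {u : (FormalFun d (U 𝔤))ˣ}
    (hu : IsGauge x u) (r : FormalFun d (𝔤 ⊗[ℂ] 𝔤)) :
    ∃ s : FormalFun d (𝔤 ⊗[ℂ] 𝔤), gauged x u r = mapFun (inc₂ 𝔤) s := by
  rw [← mem_valuedIn_range]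
  have key : ∀ f ∈ lieFun d 𝔤, ∀ g ∈ lieFun d 𝔤,
      (square u : FormalFun d (U 𝔤 ⊗[ℂ] U 𝔤)) * (formalLeft d 𝔤 f * formalRight d 𝔤 g) *
      (↑(square u)⁻¹ : FormalFun d (U 𝔤 ⊗[ℂ] U 𝔤)) ∈ valuedIn (LinearMap.range (inc₂ 𝔤)) := by
    intro f hf g hg
    rw [square_conj_mul]
    exact mul_mem_valuedIn_inc₂ (hu.conj_mem f hf) (hu.conj_mem g hg)
  have hc : ∀ y : 𝔤, const d (inc y) ∈ lieFun d 𝔤 := fun y => const_mem_valuedIn ⟨y, rfl⟩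
  rw [gauged, mul_add, add_mul]
  refine Submodule.add_mem _ ?_ ?_
  · rw [mapFun_eq_sum_basis ((Module.finBasis ℂ 𝔤).tensorProduct (Module.finBasis ℂ 𝔤)), mul_sum,
      sum_mul]
    refine Submodule.sum_mem _ fun i _ => ?_
    rw [mul_smul_comm, smul_mul_assoc]
    refine smul_mem_valuedIn _ ?_
    have h1 : const d (inc₂ 𝔤 ((Module.finBasis ℂ 𝔤).tensorProduct (Module.finBasis ℂ 𝔤) i)) =
        formalLeft d 𝔤 (const d (inc (Module.finBasis ℂ 𝔤 i.1))) *
        formalRight d 𝔤 (const d (inc (Module.finBasis ℂ 𝔤 i.2))) := by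
      rw [formalMap_const, formalMap_const, ← const_mul, Module.Basis.tensorProduct_apply']
      simp
    rw [h1]
    exact key _ (hc _) _ (hc _)
  · rw [gaugeTerm, mul_sum, sum_mul]
    refine Submodule.sum_mem _ fun i _ => ?_
    rw [mul_sub, sub_mul]
    refine Submodule.sub_mem _ (key _ (hu.logDeriv_mem i) _ (hc _))
      (key _ (Submodule.sub_mem _ (hc _) (Submodule.sum_mem _ fun j _ => ?_)) _ (hu.logDeriv_mem i))
    exact smul_mem_valuedIn _ (hu.logDeriv_mem j)

end GaugeTransform

/-! ### Successive approximation of the gauge equivalence. -/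

section Existence

open Finset

attribute [local instance] formalAlgebra
attribute [local instance 100] LieRing.ofAssociativeRing

/-- The homogeneous component of degree `m`. -/
def homogPart {d : ℕ} {V : Type*} [AddCommGroup V] [Module ℂ V] (m : ℕ) (f : FormalFun d V) :
    FormalFun d V := ofCoef fun n => if n.degree = m then coef n f else 0

section HomogPart

variable {d : ℕ} {V : Type*} [AddCommGroup V] [Module ℂ V]

theorem coef_homogPart (m : ℕ) (f : FormalFun d V) (n : Fin d →₀ ℕ) :
    coef n (homogPart m f) = if n.degree = m then coef n f else 0 := rfl

theorem euler_homogPart (m : ℕ) (f : FormalFun d V) :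
    euler (homogPart m f) = (m : ℂ) • homogPart m f := formalFun_ext fun n => by
  rw [coef_euler, map_smul, coef_homogPart]
  split_ifs with h
  · rw [h]
  · rw [smul_zero, smul_zero]

theorem sub_homogPart_mem_ordGE {m : ℕ} {f : FormalFun d V} (hf : f ∈ ordGE V m) :
    f - homogPart m f ∈ ordGE V (m + 1) := fun n hn => by
  rw [map_sub, coef_homogPart]
  split_ifs with h
  · rw [sub_self]
  · rw [hf n (by omega), sub_zero]

theorem eq_zero_of_homogeneous {m : ℕ} {f : FormalFun d V} (h : euler f = (m : ℂ) • f)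
    (hf : f ∈ ordGE V (m + 1)) : f = 0 :=
  eq_zero_of_euler_sub hf fun _ _ => by
    rw [h, sub_self]
    exact Submodule.zero_mem _

end HomogPart

variable {d : ℕ} {𝔤 : Type*} [LieRing 𝔤] [LieAlgebra ℂ 𝔤] {𝔩 : LieSubalgebra ℂ 𝔤}
  (x : Module.Basis (Fin d) ℂ 𝔩)

theorem CYB_eq_conv (r : FormalFun d (𝔤 ⊗[ℂ] 𝔤)) : CYB r =
    conv (TensorProduct.curry (bracket1213 𝔤 + bracket1223 𝔤 + bracket1323 𝔤)) r r := rfl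

theorem CYB_sub_mem_ordGE {m : ℕ} {r s : FormalFun d (𝔤 ⊗[ℂ] 𝔤)} (h : r - s ∈ ordGE _ m) :
    CYB r - CYB s ∈ ordGE _ m := by
  obtain ⟨β, hβ⟩ : ∃ β, β =
    TensorProduct.curry (bracket1213 𝔤 + bracket1223 𝔤 + bracket1323 𝔤) := ⟨_, rfl⟩
  rw [CYB_eq_conv, CYB_eq_conv, ← hβ]
  have : conv β r r - conv β s s = conv β (r - s) r + conv β s (r - s) := by
    rw [map_sub, map_sub, LinearMap.sub_apply]
    abel
  rw [this]
  exact Submodule.add_mem _ (conv_mem_ordGE β h (mem_ordGE_zero r) (by omega))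
    (conv_mem_ordGE β (mem_ordGE_zero s) h (by omega))

theorem mapFun_inc₂_sub (r s : FormalFun d (𝔤 ⊗[ℂ] 𝔤)) :
    mapFun (inc₂ 𝔤) (r - s) = mapFun (inc₂ 𝔤) r - mapFun (inc₂ 𝔤) s :=
  map_sub (mapFunₗ (inc₂ 𝔤)) r s

variable {π : 𝔤 →ₗ[ℂ] 𝔩}

/-- The lowest degree term of the difference of two equivariant solutions. -/
theorem exists_leading_term (hπ : ∀ y : 𝔩, π y = y)
    (hπ' : ∀ (y : 𝔩) z, π ⁅(y : 𝔤), z⁆ = ⁅y, π z⁆) {k : ℕ} {s ρ : FormalFun d (𝔤 ⊗[ℂ] 𝔤)}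
    (hs₁ : IsEquivariant x (fun y t => ⁅(y : 𝔤), t⁆) s)
    (hs₂ : mapFun (Alt 𝔤) (dBar x s) + CYB s = 0)
    (hρ₁ : IsEquivariant x (fun y t => ⁅(y : 𝔤), t⁆) ρ)
    (hρ₂ : mapFun (Alt 𝔤) (dBar x ρ) + CYB ρ = 0)
    (h : ρ - s ∈ ordGE (𝔤 ⊗[ℂ] 𝔤) (k + 1)) :
    ∃ f : FormalFun d 𝔤, euler f = ((k + 1 + 1 : ℕ) : ℂ) • f ∧
      (∀ y : 𝔩, coadDeriv x y f + mapFun (adLie 𝔩 y) f = 0) ∧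
      ρ - (s + (dBar x f - mapFun (TensorProduct.comm ℂ 𝔤 𝔤).toLinearMap (dBar x f))) ∈
        ordGE (𝔤 ⊗[ℂ] 𝔤) (k + 1 + 1) := by
  have he := euler_homogPart (k + 1) (ρ - s)
  have hd := sub_homogPart_mem_ordGE h
  obtain ⟨a, ha⟩ : ∃ a, a = homogPart (k + 1) (ρ - s) := ⟨_, rfl⟩
  rw [← ha] at he hd
  -- The action preserves degrees, so the expression is homogeneous of degree `k + 1`; equivariance
  -- of `ρ` and `s` shows that it has larger order, hence it vanishes.
  have hequi : ∀ y : 𝔩, coadDeriv x y a + mapFun (adTensor 𝔩 y) a = 0 := by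
    intro y
    refine eq_zero_of_homogeneous (m := k + 1) ?_ ?_
    · rw [map_add, euler_coadDeriv, euler_mapFun, he, coadDeriv_smul, smul_add]
      congr 1
      exact map_smul (mapFunₗ (adTensor 𝔩 y)) _ a
    · replace hs₁ := (isEquivariant_iff x (fun y => adTensor 𝔩 y) (fun _ _ => rfl) s).1 hs₁ y
      replace hρ₁ := (isEquivariant_iff x (fun y => adTensor 𝔩 y) (fun _ _ => rfl) ρ).1 hρ₁ y
      have h1 : coadDeriv x y a + mapFun (adTensor 𝔩 y) a =
          (coadDeriv x y ρ + mapFun (adTensor 𝔩 y) ρ) - (coadDeriv x y s + mapFun (adTensor 𝔩 y) s)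
          - (coadDeriv x y (ρ - s - a) + mapFun (adTensor 𝔩 y) (ρ - s - a)) := by
        simp only [coadDeriv_sub, ← mapFunₗ_apply, map_sub]
        abel
      rw [h1, hs₁, hρ₁, sub_self, zero_sub]
      exact Submodule.neg_mem _ (Submodule.add_mem _ (coadDeriv_mem_ordGE x y hd)
        (mapFun_mem_ordGE _ hd))
  -- This term is homogeneous of degree `k`, while subtracting the two Yang-Baxter equations bounds
  -- its order by `k + 1`, as the quadratic terms differ only from that order on.
  have hAlt : mapFun (Alt 𝔤) (dBar x a) = 0 := by
    refine eq_zero_of_homogeneous (m := k) ?_ ?_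
    · rw [euler_mapFun, euler_dBar, he, dBar_smul]
      refine Eq.trans ?_ (map_smul (mapFunₗ (Alt 𝔤)) _ _)
      rw [mapFunₗ_apply]
      congr 1
      push_cast
      module
    · have h1 : mapFun (Alt 𝔤) (dBar x a) =
          (mapFun (Alt 𝔤) (dBar x ρ) + CYB ρ) - (mapFun (Alt 𝔤) (dBar x s) + CYB s)
          - (CYB ρ - CYB s) - mapFun (Alt 𝔤) (dBar x (ρ - s - a)) := by
        simp only [dBar_sub, ← mapFunₗ_apply, map_sub]
        abel
      rw [h1, hs₂, hρ₂, sub_self, zero_sub]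
      exact Submodule.sub_mem _ (Submodule.neg_mem _ (CYB_sub_mem_ordGE h))
        (mapFun_mem_ordGE _ (dBar_mem_ordGE x hd))
  obtain ⟨f, hf₁, hf₂, hf₃⟩ := exists_eq_dBar_sub x hπ hπ' (Nat.succ_ne_zero k) he hequi hAlt
  exact ⟨f, hf₁, hf₂, by rwa [← hf₃, ← sub_sub]⟩

theorem mem_ordGE_of_mapFun_inc₂ [FiniteDimensional ℂ 𝔤] {m : ℕ} {t : FormalFun d (𝔤 ⊗[ℂ] 𝔤)}
    (h : mapFun (inc₂ 𝔤) t ∈ ordGE (U 𝔤 ⊗[ℂ] U 𝔤) m) : t ∈ ordGE (𝔤 ⊗[ℂ] 𝔤) m := fun n hn =>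
  inc₂_injective (by rw [map_zero]; exact h n hn)

/-- Improvement of an approximate gauge equivalence. -/
theorem IsGauge.exists_step [FiniteDimensional ℂ 𝔤] (hπ : ∀ y : 𝔩, π y = y)
    (hπ' : ∀ (y : 𝔩) z, π ⁅(y : 𝔤), z⁆ = ⁅y, π z⁆) {r ρ : FormalFun d (𝔤 ⊗[ℂ] 𝔤)}
    (hr : IsDynamicalRMatrix x r) (hρ : IsDynamicalRMatrix x ρ) {k : ℕ}
    {u : (FormalFun d (U 𝔤))ˣ} (hu : IsGauge x u)
    (h : mapFun (inc₂ 𝔤) ρ - gauged x u r ∈ ordGE (U 𝔤 ⊗[ℂ] U 𝔤) (k + 1)) :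
    ∃ u' : (FormalFun d (U 𝔤))ˣ, IsGauge x u' ∧
      mapFun (inc₂ 𝔤) ρ - gauged x u' r ∈ ordGE (U 𝔤 ⊗[ℂ] U 𝔤) (k + 1 + 1) ∧
      (u' : FormalFun d (U 𝔤)) - u ∈ ordGE (U 𝔤) k := by
  obtain ⟨s, hs⟩ := hu.exists_gauged_eq r
  -- The current approximation is itself an equivariant solution, so it can be compared with `ρ` to
  -- leading order.
  have hs' := gauge_isEquivariant_and_cdybe x u hu.equivariant (r := r) (s := s) (by
    rw [← hs, gauged, coe_square, mul_assoc, ← coe_square, Units.inv_mul, mul_one])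
    hr.equivariant hr.cdybe
  rw [hs, ← mapFun_inc₂_sub] at h
  obtain ⟨f, hf₁, hf₂, hf₃⟩ := exists_leading_term x hπ hπ' hs'.1 hs'.2 hρ.equivariant hρ.cdybe
    (mem_ordGE_of_mapFun_inc₂ h)
  obtain ⟨g, hg, hgf⟩ := exists_isGauge x hf₁ hf₂
  have hfo := mem_ordGE_of_homogeneous hf₁
  refine ⟨g * u, hg.mul hu, ?_, ?_⟩
  · have h1 := gauged_mul_sub_mem_ordGE x r hu.coef_zero hfo hgf
    have h2 := Submodule.sub_mem _ (mapFun_mem_ordGE (inc₂ 𝔤) hf₃) h1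
    convert h2 using 1
    rw [hs, mapFun_inc₂_sub ρ]
    have h3 : ∀ b, mapFun (inc₂ 𝔤) (s + b) = mapFun (inc₂ 𝔤) s + mapFun (inc₂ 𝔤) b :=
      map_add (mapFunₗ (inc₂ 𝔤)) s
    rw [h3]
    abel
  · have h1 : (g : FormalFun d (U 𝔤)) - 1 ∈ ordGE (U 𝔤) k := by
      have : (g : FormalFun d (U 𝔤)) - 1 = (g - (1 - mapFun (inc (𝔤 := 𝔤)).toLinearMap f))
        - mapFun (inc (𝔤 := 𝔤)).toLinearMap f := by abel
      rw [this]
      exact Submodule.sub_mem _ (ordGE_mono (by omega) hgf)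
        (mapFun_mem_ordGE _ (ordGE_mono (by omega) hfo))
    have h2 := mul_mem_ordGE_left h1 (u : FormalFun d (U 𝔤))
    rwa [sub_mul, one_mul, ← Units.val_mul] at h2

/-- Starting from `1`, which is admissible because `r` and `ρ` have the same constant term, the
corrections have growing order. Their product converges, and all the conditions are closed under
this limit. -/
theorem exists_gauge_equivalence [FiniteDimensional ℂ 𝔤] (hπ : ∀ y : 𝔩, π y = y)
    (hπ' : ∀ (y : 𝔩) z, π ⁅(y : 𝔤), z⁆ = ⁅y, π z⁆) {r ρ : FormalFun d (𝔤 ⊗[ℂ] 𝔤)}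
    (hr : IsDynamicalRMatrix x r) (hρ : IsDynamicalRMatrix x ρ) (h0 : coef 0 r = coef 0 ρ) :
    ∃ v : (FormalFun d (U 𝔤))ˣ, coef 0 (v : FormalFun d (U 𝔤)) = 1 ∧
      formalMap (coproduct 𝔤) (v : FormalFun d (U 𝔤)) = formalLeft d 𝔤 v * formalRight d 𝔤 v ∧
      (∀ y : 𝔩, coadDeriv x y (v : FormalFun d (U 𝔤)) +
        (const d (inc (y : 𝔤)) * v - v * const d (inc (y : 𝔤))) = 0) ∧
      mapFun (inc₂ 𝔤) ρ = gauged x v r := by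
  have hstep : ∀ (k : ℕ) (u : (FormalFun d (U 𝔤))ˣ), IsGauge x u ∧
      mapFun (inc₂ 𝔤) ρ - gauged x u r ∈ ordGE (U 𝔤 ⊗[ℂ] U 𝔤) (k + 1) →
      ∃ u' : (FormalFun d (U 𝔤))ˣ, (IsGauge x u' ∧
      mapFun (inc₂ 𝔤) ρ - gauged x u' r ∈ ordGE (U 𝔤 ⊗[ℂ] U 𝔤) (k + 1 + 1)) ∧
      (u' : FormalFun d (U 𝔤)) - u ∈ ordGE (U 𝔤) k := fun k u hu => by
    obtain ⟨u', h1, h2, h3⟩ := hu.1.exists_step x hπ hπ' hr hρ hu.2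
    exact ⟨u', ⟨h1, h2⟩, h3⟩
  choose! S hS hS' using hstep
  obtain ⟨F, hF0, hF1⟩ : ∃ F : ℕ → (FormalFun d (U 𝔤))ˣ, F 0 = 1 ∧ ∀ k, F (k + 1) = S k (F k) :=
    ⟨fun k => Nat.rec 1 S k, rfl, fun _ => rfl⟩
  have hF : ∀ k, IsGauge x (F k) ∧
      mapFun (inc₂ 𝔤) ρ - gauged x (F k) r ∈ ordGE (U 𝔤 ⊗[ℂ] U 𝔤) (k + 1) := by
    intro k
    induction k with
    | zero =>
      rw [hF0]
      refine ⟨IsGauge.one x, ?_⟩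
      rw [gauged_one, zero_add, mem_ordGE_one, ← mapFun_inc₂_sub, coef_mapFun, map_sub, h0,
        sub_self, map_zero]
    | succ k ih =>
      rw [hF1]
      exact hS k (F k) ih
  have hFS : ∀ k, (F (k + 1) : FormalFun d (U 𝔤)) - (F k : FormalFun d (U 𝔤)) ∈ ordGE (U 𝔤) k := by
    intro k
    rw [hF1]
    exact hS' k (F k) (hF k)
  obtain ⟨G, hG⟩ := exists_limit (fun k => (F k : FormalFun d (U 𝔤))) hFS
  have hG0 : coef 0 G = 1 := by
    have := mem_ordGE_one.1 (hG 1)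
    rwa [map_sub, (hF 1).1.coef_zero, sub_eq_zero] at this
  obtain ⟨v, rfl⟩ := isUnit_of_coef_zero hG0
  refine ⟨v, hG0, ?_, fun y => ?_, ?_⟩
  · refine eq_of_sub_mem_ordGE fun m => ?_
    have h1 := formalMap_mem_ordGE (coproduct 𝔤) (hG m)
    have h2 : formalLeft d 𝔤 (v - F m) ∈ ordGE _ m := formalMap_mem_ordGE _ (hG m)
    have h3 : formalRight d 𝔤 (v - F m) ∈ ordGE _ m := formalMap_mem_ordGE _ (hG m)
    have h4 := Submodule.sub_mem _ h1 (Submodule.add_mem _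
      (mul_mem_ordGE_left h2 (formalRight d 𝔤 v)) (mul_mem_ordGE_right h3 (formalLeft d 𝔤 (F m))))
    convert h4 using 1
    simp only [map_sub, (hF m).1.groupLike]
    noncomm_ring
  · refine eq_of_sub_mem_ordGE fun m => ?_
    have h1 := Submodule.add_mem _ (coadDeriv_mem_ordGE x y (hG m)) (Submodule.sub_mem _
      (mul_mem_ordGE_right (hG m) (const d (inc (y : 𝔤))))
      (mul_mem_ordGE_left (hG m) (const d (inc (y : 𝔤)))))
    convert h1 using 1
    rw [← (hF m).1.equivariant y, coadDeriv_sub]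
    noncomm_ring
  · refine eq_of_sub_mem_ordGE fun m => ?_
    -- The limit differs from `F (m + 2)` by a factor equal to `1` up to order `m + 2`. The
    -- congruence with `f = 0` then compares the two gauge transforms; the index is shifted because
    -- differentiation costs one order.
    have h1 : (↑(v * (F (m + 2))⁻¹) : FormalFun d (U 𝔤)) -
        (1 - mapFun (inc (𝔤 := 𝔤)).toLinearMap (0 : FormalFun d 𝔤)) ∈ ordGE (U 𝔤) (m + 2) := by
      have h2 : mapFun (inc (𝔤 := 𝔤)).toLinearMap (0 : FormalFun d 𝔤) = 0 :=
        map_zero (mapFunₗ (inc (𝔤 := 𝔤)).toLinearMap)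
      have h3 := mul_mem_ordGE_left (hG (m + 2)) (↑(F (m + 2))⁻¹ : FormalFun d (U 𝔤))
      rwa [sub_mul, Units.mul_inv, ← Units.val_mul, ← sub_zero (1 : FormalFun d (U 𝔤)), ← h2] at h3
    have h2 := gauged_mul_sub_mem_ordGE x r (hF (m + 2)).1.coef_zero (Submodule.zero_mem _) h1
    have h3 : mapFun (inc₂ 𝔤) (dBar x (0 : FormalFun d 𝔤) -
        mapFun (TensorProduct.comm ℂ 𝔤 𝔤).toLinearMap (dBar x (0 : FormalFun d 𝔤))) = 0 := by
      rw [mapFun_inc₂_sub, inc₂_comm_dBar, inc₂_dBar]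
      have h4 : mapFun (inc (𝔤 := 𝔤)).toLinearMap (0 : FormalFun d 𝔤) = 0 :=
        map_zero (mapFunₗ (inc (𝔤 := 𝔤)).toLinearMap)
      have h5 : ∀ i, partialDeriv i (0 : FormalFun d (U 𝔤)) = 0 := fun i =>
        map_zero (partialDerivₗ i)
      simp only [h4, h5, map_zero, mul_zero, zero_mul, sum_const_zero, sub_zero]
    rw [h3, add_zero, inv_mul_cancel_right] at h2
    have h6 := Submodule.sub_mem _ (ordGE_mono (by omega) (hF (m + 2)).2)
      (ordGE_mono (Nat.le_succ m) h2)
    rwa [sub_sub_sub_cancel_right] at h6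

/-- The projection along `𝔪` commutes with `𝔩` because both summands are stable under `𝔩`. -/
theorem exists_equivariant_projection
    (h𝔪 : ∃ 𝔪 : LieSubmodule ℂ 𝔩 𝔤, IsCompl 𝔩.toSubmodule 𝔪.toSubmodule) :
    ∃ π : 𝔤 →ₗ[ℂ] 𝔩, (∀ y : 𝔩, π y = y) ∧ ∀ (y : 𝔩) z, π ⁅(y : 𝔤), z⁆ = ⁅y, π z⁆ := by
  obtain ⟨𝔪, h⟩ := h𝔪
  have h1 : ∀ y : 𝔩, Submodule.projectionOnto 𝔩.toSubmodule 𝔪.toSubmodule h y = y := fun y =>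
    Submodule.projectionOnto_apply_left h y
  have h2 : ∀ z ∈ 𝔪, Submodule.projectionOnto 𝔩.toSubmodule 𝔪.toSubmodule h z = 0 := fun z hz =>
    (Submodule.projectionOnto_apply_eq_zero_iff h).2 hz
  refine ⟨Submodule.projectionOnto 𝔩.toSubmodule 𝔪.toSubmodule h, h1, fun y z => ?_⟩
  have hz : z ∈ 𝔩.toSubmodule ⊔ 𝔪.toSubmodule := by rw [h.sup_eq_top]; trivial
  obtain ⟨l, hl, m, hm, rfl⟩ := Submodule.mem_sup.1 hz
  have h3 : ⁅(y : 𝔤), l⁆ = ((⁅y, (⟨l, hl⟩ : 𝔩)⁆ : 𝔩) : 𝔤) := rfl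
  rw [lie_add, map_add, map_add, h2 m hm]
  have h4 : Submodule.projectionOnto 𝔩.toSubmodule 𝔪.toSubmodule h ⁅(y : 𝔤), m⁆ = 0 :=
    h2 _ (𝔪.lie_mem (x := y) hm)
  rw [h4, add_zero, add_zero, h3, h1]
  congr 1
  exact (h1 ⟨l, hl⟩).symm

/-- The sign of `τ` comes from exchanging the indices in the antisymmetric coefficients `λ([x_i,
x_j])`. -/
theorem gaugeTerm_eq_sub_tau (η : Fin d → FormalFun d (U 𝔤)) :
    gaugeTerm (structFun x) (basisFun x) η (formalLeft d 𝔤) (formalRight d 𝔤) =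
      ∑ i, formalLeft d 𝔤 (η i) * formalRight d 𝔤 (basisFun x i)
      - ∑ i, formalLeft d 𝔤 (basisFun x i) * formalRight d 𝔤 (η i)
      - ∑ i, ∑ j, mulLin x ⁅x i, x j⁆ (formalLeft d 𝔤 (η i) * formalRight d 𝔤 (η j)) := by
  rw [gaugeTerm_eq, sum_sub_distrib, sub_eq_add_neg _ (∑ i, ∑ j, mulLin x _ _), sum_comm,
    ← sum_neg_distrib]
  congr 1
  refine sum_congr rfl fun i _ => ?_
  rw [← sum_neg_distrib]
  refine sum_congr rfl fun j _ => ?_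
  rw [structFun_skew, neg_smul, structFun_smul]

end Existence

/-! ### The adjoint action of the identity. -/

section Ad

variable {𝔤 : Type*} [LieRing 𝔤] [LieAlgebra ℂ 𝔤] {N : ℕ} {G : Type*} [TopologicalSpace G]
  [ChartedSpace (Model N) G] [Group G] [LieGroup 𝓘(ℂ, Model N) ω G]

theorem Ad_one (e : GroupLieAlgebra 𝓘(ℂ, Model N) G ≃ₗ⁅ℂ⁆ 𝔤) : Ad e (1 : G) = LinearMap.id := by
  have h : (fun h : G => 1 * h * 1⁻¹) = id := by
    funext h
    simp
  refine LinearMap.ext fun y => ?_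
  change e (mfderiv 𝓘(ℂ, Model N) 𝓘(ℂ, Model N) (fun h : G => 1 * h * 1⁻¹) 1 (e.symm y)) = y
  rw [h, mfderiv_id]
  exact e.apply_symm_apply y

end Ad

end DynamicalRMatrix

end

open DynamicalRMatrix in
theorem theorem1
    -- a finite-dimensional complex Lie algebra `𝔤`, a subalgebra `𝔩`, a basis of `𝔩`
    {𝔤 : Type*} [LieRing 𝔤] [LieAlgebra ℂ 𝔤] [FiniteDimensional ℂ 𝔤]
    (𝔩 : LieSubalgebra ℂ 𝔤) {d : ℕ} (x : Module.Basis (Fin d) ℂ 𝔩)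
    -- the simply connected complex Lie group `G` with Lie algebra `𝔤`
    {N : ℕ} {G : Type*} [TopologicalSpace G] [ChartedSpace (EuclideanSpace ℂ (Fin N)) G]
    [Group G] [LieGroup 𝓘(ℂ, EuclideanSpace ℂ (Fin N)) ω G] [SimplyConnectedSpace G]
    (e : GroupLieAlgebra 𝓘(ℂ, EuclideanSpace ℂ (Fin N)) G ≃ₗ⁅ℂ⁆ 𝔤)
    -- `𝔩` has an `𝔩`-invariant complement in `𝔤`
    (h𝔪 : ∃ 𝔪 : LieSubmodule ℂ 𝔩 𝔤, IsCompl 𝔩.toSubmodule 𝔪.toSubmodule)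
    (r ρ : FormalFun d (𝔤 ⊗[ℂ] 𝔤))
    (hr : IsDynamicalRMatrix x r) (hρ : IsDynamicalRMatrix x ρ) (h0 : coef 0 r = coef 0 ρ) :
    ∃ g : FormalMap 𝔤 d G, g.Equivariant x e ∧ g.IsGaugeTransform x e r ρ := by
  obtain ⟨π, hπ, hπ'⟩ := exists_equivariant_projection h𝔪
  obtain ⟨v, hv0, hvΔ, hvx, hv⟩ := exists_gauge_equivalence x hπ hπ' hr hρ h0
  have hAd : ∀ y, Ad e (1 : G) y = y := fun y => by rw [Ad_one]; rfl
  -- The gauge map takes the value `1` at `0`, where `Ad` is the identity; hence `ρ` itself serves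
  -- as the conjugate by `v ⊗ v`.
  refine ⟨⟨1, v, hv0, hvΔ⟩, ⟨fun y => hAd y, fun y n => ?_⟩, ρ, ?_, ?_⟩
  · have := congrArg (coef n) (hvx y)
    rwa [map_add, map_sub, coef_const_mul, coef_mul_const, map_zero] at this
  · rw [hv, gauged, gaugeTerm_eq_sub_tau]
    have h2 : FormalMap.etaBar x (⟨1, v, hv0, hvΔ⟩ : FormalMap 𝔤 d G) =
        ∑ i, formalLeft d 𝔤 (basisFun x i) *
          formalRight d 𝔤 ((↑v⁻¹ : FormalFun d (U 𝔤)) * partialDeriv i v) :=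
      formalFun_ext fun n => by
        rw [map_sum, FormalMap.etaBar, coef_ofCoef]
        exact Finset.sum_congr rfl fun i _ => (coef_formalLeft_basisFun_mul x i _ n).symm
    have h3 : FormalMap.etaBar21 x (⟨1, v, hv0, hvΔ⟩ : FormalMap 𝔤 d G) =
        ∑ i, formalLeft d 𝔤 ((↑v⁻¹ : FormalFun d (U 𝔤)) * partialDeriv i v) *
          formalRight d 𝔤 (basisFun x i) := by
      rw [FormalMap.etaBar21, h2, mapFun_sum]
      exact Finset.sum_congr rfl fun i _ => mapFun_comm_mul _ _
    rw [h2, h3]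
    refine congrArg₂ (· * ·) (congrArg₂ (· * ·) rfl ?_) rfl
    rw [FormalMap.tau]
    change _ + (_ - _ - FormalMap.tau x (⟨1, v, hv0, hvΔ⟩ : FormalMap 𝔤 d G)) =
      _ - FormalMap.tau x (⟨1, v, hv0, hvΔ⟩ : FormalMap 𝔤 d G)
    abel
  · rw [Ad_one, TensorProduct.map_id]
    rfl
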